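/- **Setting (submodular $k$-secretary problem with shortlists).** A ground set $\mathcal U$ of $n\ge 1$ items carries a nonnegative monotone submodular function $f:2^{\mathcal U}\to\mathbb R_{\ge 0}$. The items arrive one by one in uniformly random order. The algorithm knows $n$ and $k\ge 1$, but not $\mathcal U$; it may query $f(S)$ for any set $S$ of items that have already arrived. In each round it irrevocably decides whether to put the item that has just arrived on a shortlist $A$. At the end it returns a set $A^*\subseteq A$ with $|A^*|\le k$. Let $$\mathrm{OPT}=\max_{S\subseteq\mathcal U,\,|S|\le k} f(S),\qquad \mathrm{ALG}=\mathbb E\Big[\max_{S\subseteq A,\,|S|\le k} f(S)\Big],$$ where the expectation is over the random order and the random choices of the algorithm. Running time is the worst-case number of steps of a randomized random access machine with value oracle: integer arithmetic, drawing a uniformly random element of $\{0,\dots,b\}$, copying, addition, subtraction and comparison of reals returned by the oracle, adding one item to a (persistent, linked-list) set, receiving an item, and an oracle query each take one step. **Theorem.** There are absolute constants $C>0$ and $c\in\mathbb N$ such that for every $\varepsilon\in(0,1]$ there is a randomized online algorithm for this problem (one program for all $n$, $k$ and $f$) with the following properties. 1. For all $n,k\ge 1$ and all $f$, with certainty: it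 stops after at most $C\,\frac{n}{\varepsilon}\log^c\!\frac2\varepsilon=\tilde O(n/\varepsilon)$ steps; it makes at most $C\,\frac{n}{\varepsilon}\log^c\!\frac2\varepsilon=\tilde O(n/\varepsilon)$ oracle queries; the shortlist satisfies $|A|\le C\,\frac{k}{\varepsilon^2}\log^c\!\frac2\varepsilon=\tilde O(k/\varepsilon^2)$; it returns $A^*\subseteq A$ with $|A^*|\le k$; and every integer written during the computation is at most $C\big(\frac{n+k}{\varepsilon}\big)^c$. 2. If $k\ge 1/\varepsilon^2$, then it has competitive ratio $1-\frac1e-\varepsilon$, and already the returned set attains it: $$\mathbb E[f(A^*)]\ \ge\ \Big(1-\frac1e-\varepsilon\Big)\mathrm{OPT}\qquad\text{and}\qquad \mathrm{ALG}\ \ge\ \Big(1-\frac1e-\varepsilon\Big)\mathrm{OPT}.$$ -/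

import Mathlib

open Finset

namespace ShortlistSecretary

/-! ### Value functions -/

/-- A nonnegative monotone submodular set function on the finite ground set `α`. -/
structure IsMonotoneSubmodular {α : Type} [DecidableEq α] (f : Finset α → ℝ) : Prop where
  nonneg : ∀ A, 0 ≤ f A
  mono : ∀ A B, A ⊆ B → f A ≤ f B
  submodular : ∀ A B, f (A ∪ B) + f (A ∩ B) ≤ f A + f B

/-- `max {f S | S ⊆ A, |S| ≤ k}`. -/
noncomputable def bestValue {α : Type} (f : Finset α → ℝ) (A : Finset α) (k : ℕ) : ℝ :=
  (A.powerset.filter fun S => S.card ≤ k).sup' ⟨∅, by simp⟩ f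

/-! ### The machine model

Online algorithms are programs of a randomized random access machine.  The machine has four
memories, each indexed by the natural numbers: for integers, for items, for sets of items and for
real numbers.  Items are opaque tokens: the only way to obtain one is to receive it from the input
stream.  Sets of items are pointers to immutable linked lists, so that adding one element, copying
the pointer, and handing the pointer to the value oracle are unit cost operations (membership,
cardinality and union are not available as operations).  Reals come only from the value oracle. -/

/-- The address of a memory cell: a fixed address, or the address found in an integer cell. -/
inductive Addr where
  | dir (a : ℕ)
  | ind (a : ℕ)

inductive NatOp where
  | add
  | sub
  | mul
  | div

/-- Truncated subtraction and integer division, with `a / 0 = 0`. -/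
def NatOp.eval : NatOp → ℕ → ℕ → ℕ
  | .add, a, b => a + b
  | .sub, a, b => a - b
  | .mul, a, b => a * b
  | .div, a, b => a / b

/-- Elementary instructions; the first argument is the destination. -/
inductive Instr where
  /-- store the constant `c` -/
  | const (r : Addr) (c : ℕ)
  /-- integer arithmetic -/
  | arith (o : NatOp) (r a b : Addr)
  /-- store a uniformly random element of `{0, …, b}`, where `b` is the content of an integer cell,
  independent of everything before -/
  | rand (r b : Addr)
  /-- receive the next arriving item (no effect after the last item) -/
  | next (x : Addr)
  /-- put the item that arrived last on the shortlist -/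
  | keep
  /-- copy an item -/
  | copyItem (x y : Addr)
  /-- store the empty set -/
  | empty (S : Addr)
  /-- `S := V ∪ {x}` (a copy of `V` if the cell `x` holds no item) -/
  | insert (S V x : Addr)
  /-- copy a set -/
  | copySet (S V : Addr)
  /-- ask the value oracle: `v := f(S)` -/
  | query (v S : Addr)
  /-- copy a real -/
  | copyVal (v w : Addr)
  /-- add reals -/
  | addVal (v w u : Addr)
  /-- subtract reals -/
  | subVal (v w u : Addr)

/-- Branching conditions: comparison of two integers or of two reals. -/
inductive Cond where
  | natLt (a b : Addr)
  | valLt (v w : Addr)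

/-- Programs. -/
inductive Prog where
  | instr (i : Instr)
  | seq (p q : Prog)
  | ite (c : Cond) (p q : Prog)
  | loop (c : Cond) (p : Prog)

/-- Configuration of the machine on an input with `n` items. -/
structure State (n : ℕ) where
  /-- what remains to be executed -/
  todo : List Prog
  nat : ℕ → ℕ
  item : ℕ → Option (Fin n)
  set : ℕ → Finset (Fin n)
  val : ℕ → ℝ
  /-- the items that have not yet arrived, in order of arrival -/
  stream : List (Fin n)
  /-- the item that arrived last -/
  current : Option (Fin n)
  shortlist : Finset (Fin n)
  /-- number of oracle queries so far -/
  queries : ℕ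
  /-- largest integer written so far -/
  peak : ℕ

namespace State

variable {n : ℕ}

def addr (s : State n) : Addr → ℕ
  | .dir a => a
  | .ind a => s.nat a

def getNat (s : State n) (a : Addr) : ℕ := s.nat (s.addr a)

def getItem (s : State n) (a : Addr) : Option (Fin n) := s.item (s.addr a)

def getSet (s : State n) (a : Addr) : Finset (Fin n) := s.set (s.addr a)

def getVal (s : State n) (a : Addr) : ℝ := s.val (s.addr a)

def setNat (s : State n) (a : Addr) (m : ℕ) : State n :=
  { s with nat := Function.update s.nat (s.addr a) m, peak := max s.peak m }

def setItem (s : State n) (a : Addr) (x : Option (Fin n)) : State n :=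
  { s with item := Function.update s.item (s.addr a) x }

def setSet (s : State n) (a : Addr) (S : Finset (Fin n)) : State n :=
  { s with set := Function.update s.set (s.addr a) S }

def setVal (s : State n) (a : Addr) (v : ℝ) : State n :=
  { s with val := Function.update s.val (s.addr a) v }

/-- The program has terminated. -/
def Halted (s : State n) : Prop := s.todo = []

/-- The set returned by the algorithm is the content of set cell `0`. -/
def output (s : State n) : Finset (Fin n) := s.set 0

end State

variable {n : ℕ}

/-- The item held by an item cell, as a set with at most one element. -/
def tokenSet (x : Option (Fin n)) : Finset (Fin n) := x.toFinset

/-- The effect of one elementary instruction, with value oracle `f`. -/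
noncomputable def Instr.exec (f : Finset (Fin n) → ℝ) (s : State n) : Instr → PMF (State n)
  | .const r c => PMF.pure (s.setNat r c)
  | .arith o r a b => PMF.pure (s.setNat r (o.eval (s.getNat a) (s.getNat b)))
  | .rand r b =>
      PMF.map (fun i : Fin (s.getNat b + 1) => s.setNat r i.val)
        (PMF.uniformOfFintype (Fin (s.getNat b + 1)))
  | .next x =>
      match s.stream with
      | [] => PMF.pure s
      | y :: l => PMF.pure ({ s with stream := l, current := some y }.setItem x (some y))
  | .keep => PMF.pure { s with shortlist := s.shortlist ∪ tokenSet s.current }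
  | .copyItem x y => PMF.pure (s.setItem x (s.getItem y))
  | .empty S => PMF.pure (s.setSet S ∅)
  | .insert S V x => PMF.pure (s.setSet S (s.getSet V ∪ tokenSet (s.getItem x)))
  | .copySet S V => PMF.pure (s.setSet S (s.getSet V))
  | .query v S => PMF.pure ({ s with queries := s.queries + 1 }.setVal v (f (s.getSet S)))
  | .copyVal v w => PMF.pure (s.setVal v (s.getVal w))
  | .addVal v w u => PMF.pure (s.setVal v (s.getVal w + s.getVal u))
  | .subVal v w u => PMF.pure (s.setVal v (s.getVal w - s.getVal u))

def Cond.Holds (s : State n) : Cond → Prop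
  | .natLt a b => s.getNat a < s.getNat b
  | .valLt v w => s.getVal v < s.getVal w

open Classical in
/-- One step of the machine; a halted machine does not move.  Every elementary instruction, every
test, and every control step takes one step. -/
noncomputable def step (f : Finset (Fin n) → ℝ) (s : State n) : PMF (State n) :=
  match s.todo with
  | [] => PMF.pure s
  | .instr i :: K => i.exec f { s with todo := K }
  | .seq p q :: K => PMF.pure { s with todo := p :: q :: K }
  | .ite c p q :: K => PMF.pure { s with todo := (if c.Holds s then p else q) :: K }
  | .loop c p :: K => PMF.pure { s with todo := if c.Holds s then p :: .loop c p :: K else K }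

/-- The distribution of the configuration after `t` steps from `s`. -/
noncomputable def steps (f : Finset (Fin n) → ℝ) : ℕ → State n → PMF (State n)
  | 0, s => PMF.pure s
  | t + 1, s => (step f s).bind (steps f t)

/-- Initial configuration: integer cells `0` and `1` hold `n` and `k`, all else is empty, and the
items will arrive in the order `σ 0, σ 1, …, σ (n - 1)`. -/
def initial (P : Prog) (n k : ℕ) (σ : Equiv.Perm (Fin n)) : State n where
  todo := [P]
  nat := fun a => if a = 0 then n else if a = 1 then k else 0
  item := fun _ => none
  set := fun _ => ∅
  val := fun _ => 0
  stream := List.ofFn σ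
  current := none
  shortlist := ∅
  queries := 0
  peak := 0

/-- The distribution of the configuration after `t` steps when the items arrive in uniformly random
order, over the random order and the random choices of the program. -/
noncomputable def run (P : Prog) (k : ℕ) (f : Finset (Fin n) → ℝ) (t : ℕ) : PMF (State n) :=
  (PMF.uniformOfFintype (Equiv.Perm (Fin n))).bind fun σ => steps f t (initial P n k σ)

/-- Expectation of `g` under a distribution (a finite sum for the distributions `run`, see
`run_support_finite`). -/
noncomputable def expectation {Ω : Type} (p : PMF Ω) (g : Ω → ℝ) : ℝ :=
  ∑' s, (p s).toReal * g s

theorem step_support_finite (f : Finset (Fin n) → ℝ) (s : State n) :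
    (step f s).support.Finite := by
  unfold step
  split
  · simp
  · rename_i i K _
    cases i <;> simp only [Instr.exec, PMF.support_pure, Set.finite_singleton]
    · rw [PMF.support_map]
      exact (Set.toFinite _).image _
    · split <;> simp
  all_goals simp

theorem steps_support_finite (f : Finset (Fin n) → ℝ) (t : ℕ) (s : State n) :
    (steps f t s).support.Finite := by
  induction t generalizing s with
  | zero => simp [steps]
  | succ t ih =>
    rw [steps, PMF.support_bind]
    exact (step_support_finite f s).biUnion fun s' _ => ih s'

theorem run_support_finite (P : Prog) (k : ℕ) (f : Finset (Fin n) → ℝ) (t : ℕ) :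
    (run P k f t).support.Finite := by
  rw [run, PMF.support_bind]
  exact (Set.toFinite _).biUnion fun σ _ => steps_support_finite f t _

end ShortlistSecretary

/-!
The algorithm keeps, for the levels `ℓ` of a band of half-width about `1 / ε` around a schedule that
rises from `0` to `k`, a solution `S ℓ` with at most `ℓ` items.  Random labels cut the arrivals into
`m = α k` windows, where `α = O(1 / ε)`.  In a window, an item `e` offers `S (ℓ - 1) ∪ {e}` as the
new solution of level `ℓ`, and `e` is put on the shortlist when some level accepts the offer.  A
window has `D = O(1 / ε)` labels, and the arrivals with the first of them are only observed: an
offer has to be at least as good as the best one observed.  So with high probability a level accepts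
`O(log D)` offers per window and does not miss the best one, and the shortlist has
`O(m log D / ε)` items.  A window also samples old items from the shortlist.  Thus it tries each
item of an optimal set `O` with probability about `1 / m`: as a new arrival if its label is still
unknown, as a sample if it is on the shortlist.

*No item is lost.*  The labels are revealed one decision at a time, and only as far as the decision
depends on them (`sum_reveal`).  Then for each item either all future labels are still possible and
equally likely, or it is on the shortlist, or its label is among those that are only observed
(`Valid`).  The items of the last kind are dropped from `O` in advance, which costs a factor
`1 - 1 / D` (`target`, `le_sum_target`).

*The gain of a window.*  Let each item `o` of `O` have a weight, and let a window be worth the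
largest weight among the items of `O` that it tries.  After thinning, each item is tried with
probability at most `1 / m` and the correlations of pairs are at most `1 / m ^ 2`, so the expected
worth is at least the sum of the weights times `(1 - 3 / D) / m - k / m ^ 2`, which is `Par.rate`;
the term `3 / D` accounts for the items only observed and for the bound on the number of offers
accepted (`sum_gain_le`, `window_gain`).

*Potential.*  By induction on the number of windows left, the expected value returned is at least a
potential that depends on the value of the solution of any one level `ℓ` of the band
(`potentialBound`).  Being ahead of schedule by `y` levels costs the price `ramp W y`.  In a window
the solution may stay on its level, or go up one level and take a new item; the better choice
gains the positive part of the value of the item minus the difference of the prices.  With these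
positive parts as weights, and by submodularity, a window closes the fraction `Par.rate` of the gap
to `f O`, and pays for at most `Par.rate * k ≤ 1 / α` levels, the speed of the schedule.  Since the
price is quadratic, its drift is at most `1 / (4 W α)` per window (`ramp_step`); at the upper end of
the band it falls faster than anything that could be gained (`le_ramp_sub`), so waiting is good
enough; and at the lower end it vanishes, so that an abandoned level can hand its solution to the
next one.  At the start the potential is at least
`(1 - 1 / e - O(ε)) f O - (W / (4 k) + 1 / (4 W)) f O`.  For `W` about `1 / ε` the last two terms
are `O(ε)`, as `k ≥ 1 / ε ^ 2` (`stream_value`).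

When `n` is less than `α k` times the number of samples per window, the whole stream may be put on
the shortlist, and greedy steps on random samples attain the ratio (`keep_value`).

The machine program carries out both variants.  Its running time, its integers and the law of its
output are determined by a program logic (`Sim`), in which the outcome of a program is distributed
as a finite tree of random choices (`Rnd`); see `program_sim_stream` and `program_sim_keep`.
-/

set_option linter.unusedSimpArgs false

namespace ShortlistSecretary

/-! ### Finite random choices -/

/-- Finite decision trees of uniform random choices: `rand b k` draws a uniformly random element of
`{0, …, b}` and continues with `k`. -/
inductive Rnd (α : Type) : Type
  | pure (a : α) : Rnd α
  | rand (b : ℕ) (k : Fin (b + 1) → Rnd α) : Rnd α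

namespace Rnd

variable {α β γ : Type}

/-- Expectation of a real function of the outcome. -/
noncomputable def E : Rnd α → (α → ℝ) → ℝ
  | pure a, g => g a
  | rand b k, g => (∑ i, E (k i) g) / (b + 1)

/-- Continue with a choice that depends on the outcome. -/
def bind : Rnd α → (α → Rnd β) → Rnd β
  | pure a, h => h a
  | rand b k, h => rand b fun i => bind (k i) h

@[simp] theorem E_pure (a : α) (g : α → ℝ) : (pure a).E g = g a := rfl

@[simp] theorem E_rand (b : ℕ) (k : Fin (b + 1) → Rnd α) (g : α → ℝ) :
    (rand b k).E g = (∑ i, (k i).E g) / (b + 1) := rfl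

@[simp] theorem E_bind (a : Rnd α) (h : α → Rnd β) (g : β → ℝ) :
    (a.bind h).E g = a.E fun x => (h x).E g := by
  induction a with
  | pure a => rfl
  | rand b k ih => simp [bind, ih]

/-- `N` rounds of a random process, round `i` using the body `body i`. -/
def iter : (N : ℕ) → (ℕ → α → Rnd α) → α → Rnd α
  | 0, _, x => pure x
  | N + 1, body, x => (body 0 x).bind (iter N fun i => body (i + 1))

end Rnd

/-! ### Expectations of machine runs -/

theorem expectation_pure {Ω : Type} (a : Ω) (g : Ω → ℝ) : expectation (PMF.pure a) g = g a := by
  classical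
  unfold expectation
  rw [tsum_eq_single a]
  · simp
  · intro b hb
    simp [PMF.pure_apply, hb]

theorem expectation_uniform_bind {ι Ω : Type} [Fintype ι] [Nonempty ι] (q : ι → PMF Ω)
    (hq : ∀ i, (q i).support.Finite) (g : Ω → ℝ) :
    expectation ((PMF.uniformOfFintype ι).bind q) g =
      (∑ i, expectation (q i) g) / Fintype.card ι := by
  have h1 : ∀ s, (((PMF.uniformOfFintype ι).bind q) s).toReal * g s =
      ∑ i, (Fintype.card ι : ℝ)⁻¹ * ((q i s).toReal * g s) := by
    intro s
    rw [PMF.bind_apply, tsum_fintype, ENNReal.toReal_sum, Finset.sum_mul]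
    · refine Finset.sum_congr rfl fun i _ => ?_
      simp [PMF.uniformOfFintype_apply, ENNReal.toReal_mul, mul_assoc]
    · intro i _
      exact ENNReal.mul_ne_top (PMF.apply_ne_top _ _) (PMF.apply_ne_top _ _)
  have h2 : ∀ i, Summable fun s => (q i s).toReal * g s := fun i =>
    summable_of_hasFiniteSupport ((hq i).subset fun s hs => by
      rw [PMF.mem_support_iff]
      intro h0
      simp [h0] at hs)
  unfold expectation
  simp_rw [h1]
  rw [Summable.tsum_finsetSum fun i _ => (h2 i).mul_left _]
  simp_rw [tsum_mul_left]
  rw [← Finset.mul_sum, div_eq_inv_mul]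

theorem expectation_mono_support {Ω : Type} (p : PMF Ω) (hp : p.support.Finite) {g g' : Ω → ℝ}
    (h : ∀ s ∈ p.support, g s ≤ g' s) : expectation p g ≤ expectation p g' := by
  have hs : ∀ u : Ω → ℝ, Summable fun s => (p s).toReal * u s := fun u =>
    summable_of_hasFiniteSupport (hp.subset fun s hs => by
      rw [PMF.mem_support_iff]
      intro h0
      simp [h0] at hs)
  refine Summable.tsum_le_tsum (fun s => ?_) (hs g) (hs g')
  by_cases h0 : p s = 0
  · simp [h0]
  · exact mul_le_mul_of_nonneg_left (h s ((PMF.mem_support_iff _ _).2 h0)) ENNReal.toReal_nonneg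

/-! ### Program logic -/

variable {n : ℕ}

namespace State

/-- The same data, with `K` left to be executed. -/
def withTodo (s : State n) (K : List Prog) : State n := { s with todo := K }

end State

/-- The effect of an instruction that makes no random choice (no effect for `rand`). -/
noncomputable def detExec (f : Finset (Fin n) → ℝ) (s : State n) : Instr → State n
  | .const r c => s.setNat r c
  | .arith o r a b => s.setNat r (o.eval (s.getNat a) (s.getNat b))
  | .rand _ _ => s
  | .next x =>
      match s.stream with
      | [] => s
      | y :: l => { s with stream := l, current := some y }.setItem x (some y)
  | .keep => { s with shortlist := s.shortlist ∪ tokenSet s.current }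
  | .copyItem x y => s.setItem x (s.getItem y)
  | .empty S => s.setSet S ∅
  | .insert S V x => s.setSet S (s.getSet V ∪ tokenSet (s.getItem x))
  | .copySet S V => s.setSet S (s.getSet V)
  | .query v S => { s with queries := s.queries + 1 }.setVal v (f (s.getSet S))
  | .copyVal v w => s.setVal v (s.getVal w)
  | .addVal v w u => s.setVal v (s.getVal w + s.getVal u)
  | .subVal v w u => s.setVal v (s.getVal w - s.getVal u)

/-- Programs without loops and random choices. -/
def Straight : Prog → Prop
  | .instr (.rand _ _) => False
  | .instr _ => True
  | .seq p q => Straight p ∧ Straight q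
  | .ite _ p q => Straight p ∧ Straight q
  | .loop _ _ => False

open Classical in
/-- The effect of a program without loops and random choices. -/
noncomputable def evalP (f : Finset (Fin n) → ℝ) : Prog → State n → State n
  | .instr i, s => detExec f s i
  | .seq p q, s => evalP f q (evalP f p s)
  | .ite c p q, s => if c.Holds s then evalP f p s else evalP f q s
  | .loop _ _, s => s

/-- An upper bound for the running time of a program without loops. -/
def psize : Prog → ℕ
  | .instr _ => 1
  | .seq p q => psize p + psize q + 1
  | .ite _ p q => psize p + psize q + 1
  | .loop _ _ => 0

/-- After at least `B` steps from `s` the machine has surely halted with the property `Z`, and the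
expectation of `u` is at least `e`. -/
def Res (f : Finset (Fin n) → ℝ) (Z : State n → Prop) (u : State n → ℝ) (s : State n) (B : ℕ)
    (e : ℝ) : Prop :=
  ∀ N, B ≤ N → (∀ x ∈ (steps f N s).support, x.Halted ∧ Z x) ∧ e ≤ expectation (steps f N s) u

theorem Res.mono {f : Finset (Fin n) → ℝ} {Z : State n → Prop} {u : State n → ℝ} {s : State n}
    {B B' : ℕ} {e e' : ℝ} (h : Res f Z u s B e) (hB : B ≤ B') (he : e' ≤ e) :
    Res f Z u s B' e' := fun N hN =>
  ⟨(h N (hB.trans hN)).1, he.trans (h N (hB.trans hN)).2⟩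

/-- From data `s`, the program `p` takes at most `B` steps and ends, with the abstract outcome `x`
distributed as `a`, in a state `s'` with `R x s'`.  This is expressed by what any continuation can
achieve. -/
def Sim (f : Finset (Fin n) → ℝ) {X : Type} (p : Prog) (s : State n) (a : Rnd X) (B : ℕ)
    (R : X → State n → Prop) : Prop :=
  ∀ (Z : State n → Prop) (u : State n → ℝ) (K : List Prog) (B' : ℕ) (g : X → ℝ),
    (∀ x s', R x s' → Res f Z u (s'.withTodo K) B' (g x)) →
      Res f Z u (s.withTodo (p :: K)) (B + B') (a.E g)

theorem Res.of_step_pure {f : Finset (Fin n) → ℝ} {Z : State n → Prop} {u : State n → ℝ}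
    {s s' : State n} {B : ℕ} {e : ℝ} (hs : step f s = PMF.pure s') (h : Res f Z u s' B e) :
    Res f Z u s (B + 1) e := by
  intro N hN
  obtain ⟨N, rfl⟩ : ∃ N', N = N' + 1 := ⟨N - 1, by omega⟩
  rw [steps, hs, PMF.pure_bind]
  exact h N (by omega)

section Rules

variable {f : Finset (Fin n) → ℝ} {X Y : Type}

theorem Sim.conseq {p : Prog} {s : State n} {a : Rnd X} {B B' : ℕ} {R R' : X → State n → Prop}
    (h : Sim f p s a B R) (hB : B ≤ B') (hR : ∀ x s', R x s' → R' x s') :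
    Sim f p s a B' R' := fun Z u K C g hg =>
  (h Z u K C g fun x s' hx => hg x s' (hR x s' hx)).mono (by omega) le_rfl

theorem Sim.seq {p q : Prog} {s : State n} {a : Rnd X} {b : X → Rnd Y} {B B' : ℕ}
    {R : X → State n → Prop} {R' : Y → State n → Prop} (hp : Sim f p s a B R)
    (hq : ∀ x s', R x s' → Sim f q s' (b x) B' R') :
    Sim f (.seq p q) s (a.bind b) (B + B' + 1) R' := by
  intro Z u K C g hg
  have h1 := hp Z u (q :: K) (B' + C) (fun x => (b x).E g)
    fun x s' hx => hq x s' hx Z u K C g hg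
  rw [Rnd.E_bind]
  refine Res.mono (Res.of_step_pure (s' := s.withTodo (p :: q :: K)) rfl h1) (by omega) le_rfl

/-- A deterministic first part can be given by its postcondition alone. -/
theorem Sim.seq_det {p q : Prog} {s : State n} {b : Rnd Y} {B B' : ℕ}
    {R : Unit → State n → Prop} {R' : Y → State n → Prop} (hp : Sim f p s (.pure ()) B R)
    (hq : ∀ s', R () s' → Sim f q s' b B' R') :
    Sim f (.seq p q) s b (B + B' + 1) R' :=
  Sim.seq (b := fun _ => b) hp fun _ s' h => hq s' h

theorem Sim.ite {c : Cond} {p q : Prog} {s : State n} {a : Rnd X} {B : ℕ}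
    {R : X → State n → Prop} (hp : c.Holds s → Sim f p s a B R)
    (hq : ¬c.Holds s → Sim f q s a B R) : Sim f (.ite c p q) s a (B + 1) R := by
  intro Z u K C g hg
  by_cases hc : c.Holds s
  · have hc' : c.Holds (s.withTodo (.ite c p q :: K)) := by cases c <;> exact hc
    refine Res.mono (Res.of_step_pure (s' := s.withTodo (p :: K)) ?_ (hp hc Z u K C g hg))
      (by omega) le_rfl
    simp only [step, State.withTodo] at hc' ⊢
    simp [hc']
  · have hc' : ¬c.Holds (s.withTodo (.ite c p q :: K)) := by cases c <;> exact hc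
    refine Res.mono (Res.of_step_pure (s' := s.withTodo (q :: K)) ?_ (hq hc Z u K C g hg))
      (by omega) le_rfl
    simp only [step, State.withTodo] at hc' ⊢
    simp [hc']

theorem step_instr_det (s : State n) (i : Instr) (K : List Prog) (hi : Straight (.instr i)) :
    step f (s.withTodo (.instr i :: K)) = PMF.pure ((detExec f s i).withTodo K) := by
  cases i <;> try rfl
  · exact hi.elim
  · rename_i x
    obtain ⟨_, _, _, _, _, stream, _, _, _, _⟩ := s
    cases stream <;> rfl

theorem Sim.straight (p : Prog) (hp : Straight p) (s : State n) :
    Sim f p s (.pure ()) (psize p) fun _ s' => s' = evalP f p s := by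
  induction p generalizing s with
  | instr i =>
    intro Z u K C g hg
    exact (Res.of_step_pure (step_instr_det s i K hp) (hg () _ rfl)).mono
      (by simp only [psize]; omega) le_rfl
  | seq p q ihp ihq =>
    refine Sim.seq_det (ihp hp.1 s) ?_
    rintro _ rfl
    exact ihq hp.2 _
  | ite c p q ihp ihq =>
    refine Sim.conseq (Sim.ite (B := psize p + psize q)
      (R := fun _ s' => s' = evalP f (.ite c p q) s)
      (fun hc => ?_) (fun hc => ?_)) le_rfl (fun _ _ h => h)
    · exact (ihp hp.1 s).conseq (by omega) (by simp [evalP, hc])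
    · exact (ihq hp.2 s).conseq (by omega) (by simp [evalP, hc])
  | loop c p _ => exact hp.elim

/-- Verification of loop-free code by symbolic evaluation. -/
theorem Sim.eval {p : Prog} (hp : Straight p) {s : State n} {B : ℕ} {x : X}
    {R : X → State n → Prop} (h : R x (evalP f p s)) (hB : psize p ≤ B) :
    Sim f p s (.pure x) B R := by
  intro Z u K C g hg
  refine (Sim.straight p hp s Z u K C (fun _ => g x) ?_).mono (by omega) le_rfl
  rintro _ _ rfl
  exact hg x _ h

theorem Sim.rand {r b : Addr} {s : State n} {m : ℕ} (hm : s.getNat b = m) {a : ℕ → X}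
    {R : X → State n → Prop} (h : ∀ i ≤ m, R (a i) (s.setNat r i)) :
    Sim f (.instr (.rand r b)) s (.rand m fun i => .pure (a i)) 1 R := by
  subst hm
  intro Z u K C g hg N hN
  obtain ⟨N, rfl⟩ : ∃ N', N = N' + 1 := ⟨N - 1, by omega⟩
  have hstep : steps f (N + 1) (s.withTodo (.instr (.rand r b) :: K)) =
      (PMF.uniformOfFintype (Fin (s.getNat b + 1))).bind
        fun i => steps f N ((s.setNat r i.val).withTodo K) := by
    rw [steps]
    change (PMF.map _ _).bind _ = _
    rw [PMF.bind_map]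
    rfl
  have hres : ∀ i : Fin (s.getNat b + 1), Res f Z u ((s.setNat r i.val).withTodo K) C (g (a i)) :=
    fun i => hg _ _ (h i (by omega))
  rw [hstep]
  constructor
  · intro x hx
    rw [PMF.support_bind] at hx
    simp only [Set.mem_iUnion] at hx
    obtain ⟨i, -, hx⟩ := hx
    exact (hres i N (by omega)).1 x hx
  · rw [expectation_uniform_bind _ fun i => steps_support_finite f N _]
    simp only [Rnd.E_rand, Rnd.E_pure, Fintype.card_fin]
    push_cast
    gcongr with i
    exact (hres i N (by omega)).2

/-- A loop with `N` iterations. -/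
theorem Sim.loop {c : Cond} {p : Prog} (N : ℕ) {body : ℕ → X → Rnd X} {cost : ℕ → ℕ}
    {R : ℕ → X → State n → Prop} {x : X} {s : State n}
    (hbody : ∀ i < N, ∀ x s, R i x s →
      c.Holds s ∧ Sim f p s (body i x) (cost i) (R (i + 1)))
    (hend : ∀ x s, R N x s → ¬c.Holds s) (hx : R 0 x s) :
    Sim f (.loop c p) s (Rnd.iter N body x) (∑ i ∈ range N, (cost i + 1) + 1) (R N) := by
  induction N generalizing R body cost x s with
  | zero =>
    intro Z u K C g hg
    have hc := hend x s hx
    have hc' : ¬c.Holds (s.withTodo (.loop c p :: K)) := by cases c <;> exact hc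
    refine Res.mono (Res.of_step_pure (s' := s.withTodo K) ?_ (hg x s hx))
      (by simp) le_rfl
    simp only [step, State.withTodo] at hc' ⊢
    simp [hc']
  | succ N ih =>
    obtain ⟨hc, h1⟩ := hbody 0 (by omega) x s hx
    have h2 : ∀ x s, R 1 x s → Sim f (.loop c p) s
        (Rnd.iter N (fun i => body (i + 1)) x) (∑ i ∈ range N, (cost (i + 1) + 1) + 1)
        (R (N + 1)) := by
      intro x s hx
      exact ih (R := fun i => R (i + 1)) (cost := fun i => cost (i + 1))
        (fun i hi x s h => hbody (i + 1) (by omega) x s h) hend hx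
    intro Z u K C g hg
    have hc' : c.Holds (s.withTodo (.loop c p :: K)) := by cases c <;> exact hc
    have h3 := h1 Z u (.loop c p :: K) _ _ fun x s' hx => h2 x s' hx Z u K C g hg
    rw [Rnd.iter, Rnd.E_bind]
    refine Res.mono (Res.of_step_pure (s' := s.withTodo (p :: .loop c p :: K)) ?_ h3)
      (by rw [Finset.sum_range_succ']; omega) le_rfl
    simp only [step, State.withTodo] at hc' ⊢
    simp [hc']

/-- A loop with `N` deterministic iterations. -/
theorem Sim.loop_det {c : Cond} {p : Prog} (N : ℕ) {cost : ℕ → ℕ}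
    {R : ℕ → State n → Prop} {s : State n}
    (hbody : ∀ i < N, ∀ s, R i s →
      c.Holds s ∧ Sim f p s (.pure ()) (cost i) (fun _ => R (i + 1)))
    (hend : ∀ s, R N s → ¬c.Holds s) (hx : R 0 s) :
    Sim f (.loop c p) s (.pure ()) (∑ i ∈ range N, (cost i + 1) + 1) (fun _ => R N) := by
  have h := Sim.loop (f := f) N (body := fun _ x => .pure x) (cost := cost)
    (R := fun i (_ : Unit) => R i) (x := ()) (s := s) (c := c) (p := p)
    (fun i hi x s h => hbody i hi s h) (fun _ s h => hend s h) hx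
  have hp : ∀ N : ℕ, Rnd.iter N (fun _ x => Rnd.pure x) () = Rnd.pure () := by
    intro N
    induction N with
    | zero => rfl
    | succ N ih => exact ih
  rwa [hp] at h

end Rules

theorem queries_le_of_mem_steps (f : Finset (Fin n) → ℝ) (t : ℕ) (s x : State n)
    (hx : x ∈ (steps f t s).support) : x.queries ≤ s.queries + t := by
  have hstep : ∀ s y : State n, y ∈ (step f s).support → y.queries ≤ s.queries + 1 := by
    intro s y hy
    unfold step at hy
    split at hy
    · simp at hy; subst hy; omega
    · rename_i i K _
      cases i <;> simp only [Instr.exec, PMF.support_pure, Set.mem_singleton_iff] at hy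
      case rand => 
        rw [PMF.support_map] at hy
        obtain ⟨j, -, rfl⟩ := hy
        simp [State.setNat]
      case next =>
        split at hy <;> simp only [PMF.support_pure, Set.mem_singleton_iff] at hy <;> subst hy <;>
          simp [State.setItem]
      all_goals subst hy; simp [State.setNat, State.setItem, State.setSet, State.setVal]
    all_goals simp at hy; subst hy; simp
  induction t generalizing s with
  | zero => simp [steps] at hx; subst hx; simp
  | succ t ih =>
    rw [steps, PMF.support_bind] at hx
    simp only [Set.mem_iUnion] at hx
    obtain ⟨y, hy, hx⟩ := hx
    have := ih y hx
    have := hstep s y hy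
    omega

/-- From the runs for the individual arrival orders to the run in random order. -/
theorem run_of_res (P : Prog) (k : ℕ) (f : Finset (Fin n) → ℝ) (T : ℕ) (Z : State n → Prop)
    (u : State n → ℝ) (e : Equiv.Perm (Fin n) → ℝ)
    (h : ∀ σ, Res f Z u (initial P n k σ) T (e σ)) :
    (∀ s ∈ (run P k f T).support, s.Halted ∧ Z s ∧ s.queries ≤ T) ∧
      (∑ σ, e σ) / (Fintype.card (Equiv.Perm (Fin n))) ≤ expectation (run P k f T) u := by
  constructor
  · intro s hs
    rw [run, PMF.support_bind] at hs
    simp only [Set.mem_iUnion] at hs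
    obtain ⟨σ, -, hs⟩ := hs
    have h1 := (h σ T le_rfl).1 s hs
    refine ⟨h1.1, h1.2, ?_⟩
    have := queries_le_of_mem_steps f T _ s hs
    simpa [initial] using this
  · rw [run, expectation_uniform_bind _ fun σ => steps_support_finite f T _]
    gcongr with σ
    exact (h σ T le_rfl).2

end ShortlistSecretary

namespace ShortlistSecretary

variable {n : ℕ}

/-! ### The algorithm -/

/-- The parameters of the algorithm: the number `K` of items to be selected, the number `m` of
windows, the number `α` of windows per level, the half-width `W` of the band of levels, the number
`Q` of old items sampled per window, their range (`R1 + 1` indices, shifted by `stride` from one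
sample to the next), the number `D` of labels per window, and the bound `L` for the number of
improvements per window and level. -/
structure Par where
  (K α W Q R1 stride D L m : ℕ)

/-- Lowest level in use at the start of window `j`. -/
def Par.lo (P : Par) (j : ℕ) : ℕ := j / P.α - P.W

/-- Highest level in use in window `j`. -/
def Par.hi (P : Par) (j : ℕ) : ℕ := min P.K (j / P.α + P.W + 1)

/-- The data of the algorithm inside a window.  `S ℓ` is the solution of level `ℓ` at the start of
the window, `N ℓ` the best new solution of level `ℓ` so far, `tv ℓ` the highest value seen so far,
`c ℓ` the number of improvements, and `H` lists the items put on the shortlist. -/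
structure St (n : ℕ) where
  S : ℕ → Finset (Fin n)
  N : ℕ → Finset (Fin n)
  tv : ℕ → ℝ
  c : ℕ → ℕ
  H : List (Fin n)

/-- The data at the start of a window. -/
def clean (f : Finset (Fin n) → ℝ) (S : ℕ → Finset (Fin n)) (H : List (Fin n)) : St n :=
  ⟨S, S, fun ℓ => f (S ℓ), fun _ => 0, H⟩

/-- The candidate for level `ℓ` obtained from the item `x`. -/
def St.cand (st : St n) (x : Option (Fin n)) (ℓ : ℕ) : Finset (Fin n) := st.S (ℓ - 1) ∪ tokenSet x

/-- The candidate of the item `x` replaces the new solution of level `ℓ`. -/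
def St.Acc (f : Finset (Fin n) → ℝ) (L lo hi : ℕ) (pm : Bool) (x : Option (Fin n)) (st : St n)
    (ℓ : ℕ) : Prop :=
  lo < ℓ ∧ ℓ ≤ hi ∧ pm = false ∧ f (st.N ℓ) < f (st.cand x ℓ) ∧ ¬f (st.cand x ℓ) < st.tv ℓ ∧
    st.c ℓ < L

open Classical in
/-- Try the item `x` on all levels.  If `pm` is set, then the item only raises the thresholds. -/
noncomputable def tryItem (f : Finset (Fin n) → ℝ) (L lo hi : ℕ) (pm : Bool) (inc : ℕ)
    (x : Option (Fin n)) (st : St n) : St n where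
  S := st.S
  N := fun ℓ => if st.Acc f L lo hi pm x ℓ then st.cand x ℓ else st.N ℓ
  tv := fun ℓ =>
    if st.Acc f L lo hi pm x ℓ ∨
      (lo < ℓ ∧ ℓ ≤ hi ∧ pm = true ∧ st.tv ℓ < f (st.cand x ℓ)) then f (st.cand x ℓ) else st.tv ℓ
  c := fun ℓ => if st.Acc f L lo hi pm x ℓ then st.c ℓ + inc else st.c ℓ
  H := st.H

open Classical in
/-- A new item arrives; it is put on the shortlist if it improves some level. -/
noncomputable def arrive (f : Finset (Fin n) → ℝ) (L lo hi : ℕ) (pm : Bool) (x : Fin n)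
    (st : St n) : St n :=
  if ∃ ℓ, st.Acc f L lo hi pm (some x) ℓ then
    { tryItem f L lo hi pm 1 (some x) st with H := st.H ++ [x] }
  else tryItem f L lo hi pm 1 (some x) st

/-- Sample `i` of old items in a window. -/
noncomputable def hStep (f : Finset (Fin n) → ℝ) (P : Par) (lo hi i : ℕ) (st : St n) :
    Rnd (St n) :=
  .rand P.R1 fun h => .pure (tryItem f P.L lo hi false 0 (st.H[i * P.stride + h]?) st)

/-- The arrivals with a label in `{lab, …, lab + D - 1}`; those with label `lab` are only
observed. -/
noncomputable def scan (f : Finset (Fin n) → ℝ) (L lo hi : ℕ) (blk : ℕ → List (Fin n)) (lab D : ℕ)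
    (st : St n) : St n :=
  (List.range D).foldl (fun st d =>
    (blk (lab + d)).foldl (fun st x => arrive f L lo hi (decide (d = 0)) x st) st) st

open Classical in
/-- Level `a` is abandoned; its solution is moved up if it is better than that of level `a + 1`. -/
noncomputable def merge (f : Finset (Fin n) → ℝ) (a : ℕ) (S : ℕ → Finset (Fin n)) :
    ℕ → Finset (Fin n) :=
  fun ℓ => if ℓ = a + 1 ∧ f (S (a + 1)) < f (S a) then S a else S ℓ

/-- The levels `a, …, a + t - 1` are abandoned one after the other. -/
noncomputable def mergeUp (f : Finset (Fin n) → ℝ) (a : ℕ) :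
    ℕ → (ℕ → Finset (Fin n)) → ℕ → Finset (Fin n)
  | 0, S => S
  | t + 1, S => merge f (a + t) (mergeUp f a t S)

/-- The data between windows: the solutions and the list of the items on the shortlist. -/
abbrev Cf (n : ℕ) := (ℕ → Finset (Fin n)) × List (Fin n)

/-- The first half of window `j`: old items are tried again. -/
noncomputable def samples (f : Finset (Fin n) → ℝ) (P : Par) (j : ℕ) (x : Cf n) : Rnd (St n) :=
  Rnd.iter P.Q (hStep f P (P.lo j) (P.hi j)) (clean f x.1 x.2)

/-- The second half of window `j`. -/
noncomputable def finish (f : Finset (Fin n) → ℝ) (P : Par) (blk : ℕ → List (Fin n)) (j : ℕ)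
    (st : St n) : Cf n :=
  let st' := scan f P.L (P.lo j) (P.hi j) blk (j * P.D) P.D st
  (mergeUp f (P.lo j) (P.lo (j + 1) - P.lo j) st'.N, st'.H)

/-- Window `j`. -/
noncomputable def window (f : Finset (Fin n) → ℝ) (P : Par) (blk : ℕ → List (Fin n)) (j : ℕ)
    (x : Cf n) : Rnd (Cf n) :=
  (samples f P j x).bind fun st => .pure (finish f P blk j st)

/-- The solution returned at the end. -/
noncomputable def answer (f : Finset (Fin n) → ℝ) (P : Par) (x : Cf n) : Finset (Fin n) :=
  mergeUp f (P.lo P.m) (P.K - P.lo P.m) x.1 P.K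

/-- All windows, where `blk` lists the items of each label, and `H` the items put on the shortlist
beforehand. -/
noncomputable def windows (f : Finset (Fin n) → ℝ) (P : Par) (blk : ℕ → List (Fin n))
    (H : List (Fin n)) : Rnd (Cf n) :=
  Rnd.iter P.m (window f P blk) (fun _ => ∅, H)

/-! ### Invariants of the algorithm -/

/-- The invariant between windows: a solution of level `ℓ` consists of at most `ℓ` items, which are
on the shortlist, and `H` has at most `b` items. -/
structure Cf.Good (x : Cf n) (b : ℕ) : Prop where
  card : ∀ ℓ, (x.1 ℓ).card ≤ ℓ
  sub : ∀ ℓ, x.1 ℓ ⊆ x.2.toFinset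
  len : x.2.length ≤ b

/-- The invariant inside a window with levels in `(lo, hi]` that started with at most `b` items on
the shortlist. -/
structure St.Good (f : Finset (Fin n) → ℝ) (L lo hi b : ℕ) (st : St n) : Prop where
  cardS : ∀ ℓ, (st.S ℓ).card ≤ ℓ
  subS : ∀ ℓ, st.S ℓ ⊆ st.H.toFinset
  cardN : ∀ ℓ, (st.N ℓ).card ≤ ℓ
  subN : ∀ ℓ, st.N ℓ ⊆ st.H.toFinset
  cL : ∀ ℓ, st.c ℓ ≤ L
  len : st.H.length ≤ b + ∑ ℓ ∈ Ioc lo hi, st.c ℓ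
  out : ∀ ℓ, ¬(lo < ℓ ∧ ℓ ≤ hi) → st.N ℓ = st.S ℓ ∧ st.tv ℓ = f (st.S ℓ) ∧ st.c ℓ = 0

theorem Cf.Good.clean {x : Cf n} {b : ℕ} (hx : x.Good b) (f : Finset (Fin n) → ℝ) (L lo hi : ℕ) :
    (clean f x.1 x.2).Good f L lo hi b where
  cardS := hx.card
  subS := hx.sub
  cardN := hx.card
  subN := hx.sub
  cL := fun _ => Nat.zero_le _
  len := hx.len.trans (Nat.le_add_right _ _)
  out := fun _ _ => ⟨rfl, rfl, rfl⟩

theorem card_tokenSet_le (x : Option (Fin n)) : (tokenSet x).card ≤ 1 := by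
  cases x <;> simp [tokenSet]

theorem St.Good.card_cand {f : Finset (Fin n) → ℝ} {L lo hi b : ℕ} {st : St n}
    (h : st.Good f L lo hi b) (x : Option (Fin n)) {ℓ : ℕ} (hℓ : lo < ℓ) :
    (st.cand x ℓ).card ≤ ℓ := by
  have h1 := card_union_le (st.S (ℓ - 1)) (tokenSet x)
  have h2 := h.cardS (ℓ - 1)
  have h3 := card_tokenSet_le x
  unfold St.cand
  omega

theorem St.Good.tryItem {f : Finset (Fin n) → ℝ} {L lo hi b : ℕ} {st : St n}
    (h : st.Good f L lo hi b) {x : Option (Fin n)} (hx : ∀ y ∈ x, y ∈ st.H) :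
    (tryItem f L lo hi false 0 x st).Good f L lo hi b where
  cardS := h.cardS
  subS := h.subS
  cardN := fun ℓ => by
    simp only [ShortlistSecretary.tryItem]
    split_ifs with ha
    · exact h.card_cand x ha.1
    · exact h.cardN ℓ
  subN := fun ℓ => by
    simp only [ShortlistSecretary.tryItem]
    split_ifs with ha
    · refine union_subset (h.subS _) fun y hy => ?_
      simpa using hx y (by simpa [tokenSet] using hy)
    · exact h.subN ℓ
  cL := fun ℓ => by simpa [ShortlistSecretary.tryItem] using h.cL ℓ
  len := by simpa [ShortlistSecretary.tryItem] using h.len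
  out := fun ℓ hℓ => by
    have h1 : ¬st.Acc f L lo hi false x ℓ := fun ha => hℓ ⟨ha.1, ha.2.1⟩
    simpa [ShortlistSecretary.tryItem, h1] using h.out ℓ hℓ

theorem arrive_H (f : Finset (Fin n) → ℝ) (L lo hi : ℕ) (pm : Bool) (x : Fin n) (st : St n) :
    st.H.toFinset ⊆ (arrive f L lo hi pm x st).H.toFinset ∧
      (∀ ℓ, st.Acc f L lo hi pm (some x) ℓ → x ∈ (arrive f L lo hi pm x st).H) := by
  unfold arrive
  split_ifs with h
  · exact ⟨by simp, by simp⟩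
  · exact ⟨by simp [tryItem], fun ℓ hℓ => (h ⟨ℓ, hℓ⟩).elim⟩

theorem arrive_S (f : Finset (Fin n) → ℝ) (L lo hi : ℕ) (pm : Bool) (x : Fin n) (st : St n) :
    (arrive f L lo hi pm x st).S = st.S := by
  unfold arrive
  split_ifs <;> rfl

theorem arrive_N (f : Finset (Fin n) → ℝ) (L lo hi : ℕ) (pm : Bool) (x : Fin n) (st : St n) :
    (arrive f L lo hi pm x st).N = (tryItem f L lo hi pm 1 (some x) st).N := by
  unfold arrive
  split_ifs <;> rfl

theorem arrive_tv (f : Finset (Fin n) → ℝ) (L lo hi : ℕ) (pm : Bool) (x : Fin n) (st : St n) :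
    (arrive f L lo hi pm x st).tv = (tryItem f L lo hi pm 1 (some x) st).tv := by
  unfold arrive
  split_ifs <;> rfl

theorem arrive_c (f : Finset (Fin n) → ℝ) (L lo hi : ℕ) (pm : Bool) (x : Fin n) (st : St n) :
    (arrive f L lo hi pm x st).c = (tryItem f L lo hi pm 1 (some x) st).c := by
  unfold arrive
  split_ifs <;> rfl

theorem St.Good.arrive {f : Finset (Fin n) → ℝ} {L lo hi b : ℕ} {st : St n}
    (h : st.Good f L lo hi b) (pm : Bool) (x : Fin n) :
    (arrive f L lo hi pm x st).Good f L lo hi b where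
  cardS := fun ℓ => by rw [arrive_S]; exact h.cardS ℓ
  subS := fun ℓ => by rw [arrive_S]; exact (h.subS ℓ).trans (arrive_H f L lo hi pm x st).1
  cardN := fun ℓ => by
    rw [arrive_N]
    simp only [ShortlistSecretary.tryItem]
    split_ifs with ha
    · exact h.card_cand _ ha.1
    · exact h.cardN ℓ
  subN := fun ℓ => by
    have h1 := arrive_H f L lo hi pm x st
    rw [arrive_N]
    simp only [ShortlistSecretary.tryItem]
    split_ifs with ha
    · refine union_subset ((h.subS _).trans h1.1) fun y hy => ?_
      obtain rfl : y = x := by simpa [tokenSet] using hy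
      simpa using h1.2 ℓ ha
    · exact (h.subN ℓ).trans h1.1
  cL := fun ℓ => by
    rw [arrive_c]
    simp only [ShortlistSecretary.tryItem]
    split_ifs with ha
    · exact ha.2.2.2.2.2
    · exact h.cL ℓ
  len := by
    have h1 := h.len
    have h2 : ∀ ℓ ∈ Ioc lo hi, st.c ℓ ≤ (ShortlistSecretary.arrive f L lo hi pm x st).c ℓ := by
      intro ℓ _
      rw [arrive_c]
      simp only [ShortlistSecretary.tryItem]
      split_ifs <;> omega
    by_cases hex : ∃ ℓ, st.Acc f L lo hi pm (some x) ℓ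
    · obtain ⟨ℓ, hℓ⟩ := hex
      have h3 : ∑ ℓ ∈ Ioc lo hi, st.c ℓ <
          ∑ ℓ ∈ Ioc lo hi, (ShortlistSecretary.arrive f L lo hi pm x st).c ℓ := by
        refine sum_lt_sum h2 ⟨ℓ, mem_Ioc.2 ⟨hℓ.1, hℓ.2.1⟩, ?_⟩
        rw [arrive_c]
        simp [ShortlistSecretary.tryItem, hℓ]
      have h4 : (ShortlistSecretary.arrive f L lo hi pm x st).H.length = st.H.length + 1 := by
        rw [ShortlistSecretary.arrive, if_pos ⟨ℓ, hℓ⟩]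
        simp
      omega
    · have h3 := sum_le_sum h2
      have h4 : (ShortlistSecretary.arrive f L lo hi pm x st).H = st.H := by
        rw [ShortlistSecretary.arrive, if_neg hex]
        rfl
      rw [h4]
      omega
  out := fun ℓ hℓ => by
    have h1 : ¬st.Acc f L lo hi pm (some x) ℓ := fun ha => hℓ ⟨ha.1, ha.2.1⟩
    have h2 : ¬(lo < ℓ ∧ ℓ ≤ hi ∧ pm = true ∧ st.tv ℓ < f (st.cand (some x) ℓ)) :=
      fun ha => hℓ ⟨ha.1, ha.2.1⟩
    rw [arrive_S, arrive_N, arrive_tv, arrive_c]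
    simpa [ShortlistSecretary.tryItem, h1, h2] using h.out ℓ hℓ

/-- The levels in use span at most `2 * W + 1`. -/
theorem Par.hi_sub_lo (P : Par) (j : ℕ) : P.hi j - P.lo j ≤ 2 * P.W + 1 := by
  unfold Par.hi Par.lo
  omega

theorem St.Good.foldl {f : Finset (Fin n) → ℝ} {L lo hi b : ℕ} (pm : Bool) (l : List (Fin n))
    {st : St n} (h : st.Good f L lo hi b) :
    (l.foldl (fun st x => ShortlistSecretary.arrive f L lo hi pm x st) st).Good f L lo hi b := by
  induction l generalizing st with
  | nil => exact h
  | cons x l ih => exact ih (h.arrive pm x)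

theorem scan_succ (f : Finset (Fin n) → ℝ) (L lo hi : ℕ) (blk : ℕ → List (Fin n)) (lab D : ℕ)
    (st : St n) : scan f L lo hi blk lab (D + 1) st =
      (blk (lab + D)).foldl (fun st x => arrive f L lo hi (decide (D = 0)) x st)
        (scan f L lo hi blk lab D st) := by
  simp [scan, List.range_succ]

theorem St.Good.scan {f : Finset (Fin n) → ℝ} {L lo hi b : ℕ} (blk : ℕ → List (Fin n)) (lab D : ℕ)
    {st : St n} (h : st.Good f L lo hi b) :
    (scan f L lo hi blk lab D st).Good f L lo hi b := by
  induction D with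
  | zero => exact h
  | succ D ih =>
    rw [scan_succ]
    exact ih.foldl _ _

theorem mergeUp_good {f : Finset (Fin n) → ℝ} {H : List (Fin n)} {S : ℕ → Finset (Fin n)} {b : ℕ}
    (a t : ℕ) (h : Cf.Good (S, H) b) : Cf.Good (mergeUp f a t S, H) b := by
  induction t with
  | zero => exact h
  | succ t ih =>
    refine ⟨fun ℓ => ?_, fun ℓ => ?_, h.len⟩
    · change (merge f (a + t) (mergeUp f a t S) ℓ).card ≤ ℓ
      unfold merge
      split_ifs with hℓ
      · have := ih.card (a + t)
        simp only at this
        omega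
      · exact ih.card ℓ
    · change merge f (a + t) (mergeUp f a t S) ℓ ⊆ H.toFinset
      unfold merge
      split_ifs with hℓ
      · exact ih.sub (a + t)
      · exact ih.sub ℓ

theorem St.Good.finish {f : Finset (Fin n) → ℝ} {P : Par} {blk : ℕ → List (Fin n)} {j b : ℕ}
    {st : St n} (h : st.Good f P.L (P.lo j) (P.hi j) b) :
    (finish f P blk j st).Good (b + (2 * P.W + 1) * P.L) := by
  have h1 := h.scan blk (j * P.D) P.D
  refine mergeUp_good _ _ ⟨h1.cardN, h1.subN, h1.len.trans ?_⟩
  have h2 : ∑ ℓ ∈ Ioc (P.lo j) (P.hi j), (ShortlistSecretary.scan f P.L (P.lo j) (P.hi j) blk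
      (j * P.D) P.D st).c ℓ ≤ (Ioc (P.lo j) (P.hi j)).card • P.L :=
    sum_le_card_nsmul _ _ _ fun ℓ _ => h1.cL ℓ
  rw [Nat.card_Ioc, smul_eq_mul] at h2
  have h3 := Nat.mul_le_mul_right P.L (P.hi_sub_lo j)
  omega

end ShortlistSecretary

namespace ShortlistSecretary

/-! ### The program -/

namespace Code

open Addr Instr Prog Cond

/-! The cells have the following uses.
* Integer cells `0` and `1` hold `n` and `k`, cells `2` to `9` the parameters
  `K, α, W, Q, R1, stride, D, L`, cell `19` the number `m` of windows, cells `10` to `13` the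
  constants `1, 0, 2, 64`, cell `14` the address of level `K`, and cell `15` nothing of interest.
* Cell `16` holds the number of the current window, cells `17` and `18` the addresses of the lowest
  and highest level in use, cell `20` the address of the number of arrivals with the current label,
  cell `21` the item cell for the next item of the shortlist.
* Cells `22` to `25` hold the number of the sample, its offset in the shortlist, the position of the
  label within the window and the number of arrivals left of this label.  Cell `26` is positive when
  items are only observed, `27` is added to the number of improvements, `29` is set when an item
  improves a level.  Cells `28` and `30` to `34` are auxiliary.
* The address of level `ℓ` is `64 + 2 * ℓ`.  The set cells there and at the next address hold the
  old and the new solution, the real cells the value of the new solution and the highest value seen,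
  both minus `f ∅`, and the integer cell the number of improvements.  Integer cell `65 + 2 * l`
  holds the number of arrivals with label `l`.
* Item cell `0` holds the current item, the cells from `1` on the items of the shortlist. -/

/-- Straight-line code. -/
def code : List Instr → Prog
  | [] => instr (const (dir 15) 0)
  | [i] => instr i
  | i :: l => seq (instr i) (code l)

/-- Do nothing of interest. -/
abbrev nop : Prog := instr (const (dir 15) 0)

abbrev add (r a b : Addr) : Instr := arith .add r a b
abbrev mul (r a b : Addr) : Instr := arith .mul r a b
abbrev sub (r a b : Addr) : Instr := arith .sub r a b
abbrev div (r a b : Addr) : Instr := arith .div r a b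

/-- Try the item in item cell `0` on the level above the one at address `30`. -/
def levelBody : Prog :=
  seq (code [insert (dir 1) (ind 30) (dir 0), query (dir 0) (dir 1), subVal (dir 0) (dir 0) (dir 1),
    add (dir 31) (dir 30) (dir 12), add (dir 32) (dir 31) (dir 10)])
  (seq (ite (natLt (dir 11) (dir 26))
      (ite (valLt (ind 32) (dir 0)) (instr (copyVal (ind 32) (dir 0))) nop)
      (ite (valLt (ind 31) (dir 0))
        (ite (valLt (dir 0) (ind 32)) nop
          (ite (natLt (ind 31) (dir 9))
            (code [copyVal (ind 31) (dir 0), copyVal (ind 32) (dir 0), copySet (ind 32) (dir 1),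
              add (ind 31) (ind 31) (dir 27), const (dir 29) 1]) nop)) nop))
    (instr (add (dir 30) (dir 31) (dir 11))))

/-- Try the item in item cell `0` on all levels in use. -/
def levelLoop : Prog :=
  seq (instr (add (dir 30) (dir 17) (dir 11))) (loop (natLt (dir 30) (dir 18)) levelBody)

/-- Draw one old item and try it. -/
def hBody : Prog :=
  seq (instr (rand (dir 28) (dir 6)))
  (seq (code [add (dir 28) (dir 28) (dir 23), copyItem (dir 0) (ind 28),
    add (dir 23) (dir 23) (dir 7), add (dir 22) (dir 22) (dir 10)]) levelLoop)

/-- Try the samples of old items of a window. -/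
def hLoop : Prog :=
  seq (code [const (dir 26) 0, const (dir 27) 0, const (dir 22) 0, const (dir 23) 1])
    (loop (natLt (dir 22) (dir 5)) hBody)

/-- Receive an item, try it, and put it on the shortlist if it improves some level. -/
def itemBody : Prog :=
  seq (code [next (dir 0), const (dir 29) 0])
  (seq levelLoop
  (seq (ite (natLt (dir 11) (dir 29))
      (code [keep, copyItem (ind 21) (dir 0), add (dir 21) (dir 21) (dir 10)]) nop)
    (instr (sub (dir 25) (dir 25) (dir 10)))))

/-- The arrivals with one label. -/
def dBody : Prog :=
  seq (code [sub (dir 26) (dir 10) (dir 24), add (dir 25) (ind 20) (dir 11)])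
  (seq (loop (natLt (dir 11) (dir 25)) itemBody)
    (code [add (dir 20) (dir 20) (dir 12), add (dir 24) (dir 24) (dir 10)]))

/-- The arrivals of a window. -/
def dLoop : Prog :=
  seq (code [const (dir 27) 1, const (dir 24) 0]) (loop (natLt (dir 24) (dir 8)) dBody)

/-- The new solution becomes the old solution, on the level above the one at address `30`. -/
def commitBody : Prog :=
  code [add (dir 31) (dir 30) (dir 12), add (dir 32) (dir 31) (dir 10), copySet (ind 31) (ind 32),
    copyVal (ind 32) (ind 31), const (ind 31) 0, add (dir 30) (dir 31) (dir 11)]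

/-- The new solutions become the old solutions. -/
def commitLoop : Prog :=
  seq (instr (add (dir 30) (dir 17) (dir 11))) (loop (natLt (dir 30) (dir 18)) commitBody)

/-- Abandon the lowest level in use. -/
def mergeBody : Prog :=
  seq (code [add (dir 31) (dir 17) (dir 12), add (dir 32) (dir 31) (dir 10)])
  (seq (ite (valLt (ind 31) (ind 17))
      (code [copySet (ind 31) (ind 17), copySet (ind 32) (ind 17), copyVal (ind 32) (ind 17),
        copyVal (ind 31) (ind 17)]) nop)
    (instr (add (dir 17) (dir 31) (dir 11))))

/-- Abandon the levels below the one at address `33`. -/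
def mergeLoop : Prog := loop (natLt (dir 17) (dir 33)) mergeBody

/-- Set the address of the highest level from the address `34`. -/
def setHi : Prog :=
  ite (natLt (dir 34) (dir 2))
    (code [mul (dir 18) (dir 34) (dir 12), add (dir 18) (dir 18) (dir 13)])
    (instr (add (dir 18) (dir 14) (dir 11)))

/-- One window. -/
def windowBody : Prog :=
  seq hLoop (seq dLoop (seq commitLoop
  (seq (code [add (dir 16) (dir 16) (dir 10), div (dir 33) (dir 16) (dir 3),
    add (dir 34) (dir 33) (dir 4), add (dir 34) (dir 34) (dir 10), sub (dir 33) (dir 33) (dir 4),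
    mul (dir 33) (dir 33) (dir 12), add (dir 33) (dir 33) (dir 13)])
  (seq mergeLoop setHi))))

/-- All windows, and the answer. -/
def mainLoop : Prog :=
  seq (code [const (dir 16) 0, add (dir 34) (dir 4) (dir 10)])
  (seq setHi
  (seq (loop (natLt (dir 16) (dir 19)) windowBody)
  (seq (instr (add (dir 33) (dir 14) (dir 11)))
  (seq mergeLoop (instr (copySet (dir 0) (ind 14)))))))

/-- Draw one label and count it. -/
def labelBody : Prog :=
  seq (instr (rand (dir 28) (dir 33)))
    (code [mul (dir 28) (dir 28) (dir 12), add (dir 28) (dir 28) (dir 13),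
      add (dir 28) (dir 28) (dir 10), add (ind 28) (ind 28) (dir 10),
      add (dir 24) (dir 24) (dir 10)])

/-- Few items are to be selected: draw the labels. -/
def streamSetup : Prog :=
  seq (code [add (dir 2) (dir 1) (dir 11), mul (dir 14) (dir 2) (dir 12),
    add (dir 14) (dir 14) (dir 13), add (dir 17) (dir 13) (dir 11), add (dir 18) (dir 13) (dir 11),
    add (dir 19) (dir 33) (dir 11), sub (dir 6) (dir 33) (dir 10), add (dir 7) (dir 33) (dir 11),
    mul (dir 33) (dir 33) (dir 8),
    sub (dir 33) (dir 33) (dir 10), const (dir 24) 0])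
  (loop (natLt (dir 24) (dir 0)) labelBody)

/-- Put one item on the shortlist. -/
def receiveBody : Prog :=
  code [next (dir 0), keep, copyItem (ind 21) (dir 0), add (dir 21) (dir 21) (dir 10),
    add (dir 24) (dir 24) (dir 10)]

/-- Many items are to be selected: put all items on the shortlist. -/
def keepSetup : Prog :=
  seq (seq (code [const (dir 3) 1, const (dir 4) 0, const (dir 8) 0, sub (dir 6) (dir 0) (dir 10),
      const (dir 7) 0])
    (seq (ite (natLt (dir 1) (dir 0)) (instr (add (dir 2) (dir 1) (dir 11)))
        (instr (add (dir 2) (dir 0) (dir 11))))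
      (code [mul (dir 14) (dir 2) (dir 12), add (dir 14) (dir 14) (dir 13),
        add (dir 17) (dir 13) (dir 11), add (dir 18) (dir 13) (dir 11),
        mul (dir 33) (dir 0) (dir 9), div (dir 33) (dir 33) (dir 2), add (dir 5) (dir 33) (dir 10),
        add (dir 19) (dir 2) (dir 11), const (dir 24) 0])))
  (loop (natLt (dir 24) (dir 0)) receiveBody)

/-- The whole program; its constants depend on `ε`. -/
def program (α W Q D L : ℕ) : Prog :=
  seq (code [const (dir 10) 1, const (dir 12) 2, const (dir 13) 64, const (dir 3) α,
    const (dir 4) W, const (dir 9) L, const (dir 8) D, const (dir 5) Q,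
    mul (dir 33) (dir 3) (dir 1), mul (dir 34) (dir 33) (dir 5), query (dir 1) (dir 0),
    const (dir 21) 1, const (dir 20) 65])
  (seq (ite (natLt (dir 0) (dir 34)) keepSetup streamSetup) mainLoop)

end Code

variable {n : ℕ}

/-! ### Representation of the data by the machine -/

/-- The machine state `s` represents the data `st` of the algorithm, where the levels in use are
those from `lo` to `hi`, the label `lab` occurs `cnt lab` times, and `str` is still to arrive.  The
cells of level `ℓ` have the addresses `64 + 2 * ℓ` and `65 + 2 * ℓ`. -/
structure Rep (f : Finset (Fin n) → ℝ) (P : Par) (M lo hi : ℕ) (cnt : ℕ → ℕ) (st : St n)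
    (str : List (Fin n)) (s : State n) : Prop where
  rK : s.nat 2 = P.K
  rα : s.nat 3 = P.α
  rW : s.nat 4 = P.W
  rQ : s.nat 5 = P.Q
  rR1 : s.nat 6 = P.R1
  rstride : s.nat 7 = P.stride
  rD : s.nat 8 = P.D
  rL : s.nat 9 = P.L
  r1 : s.nat 10 = 1
  r0 : s.nat 11 = 0
  r2 : s.nat 12 = 2
  r64 : s.nat 13 = 64
  rpK : s.nat 14 = 64 + 2 * P.K
  rlo : s.nat 17 = 64 + 2 * lo
  rhi : s.nat 18 = 64 + 2 * hi
  rm : s.nat 19 = P.m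
  rH : s.nat 21 = st.H.length + 1
  v1 : s.val 1 = f ∅
  S : ∀ ℓ, s.set (64 + 2 * ℓ) = st.S ℓ
  N : ∀ ℓ, s.set (65 + 2 * ℓ) = st.N ℓ
  nv : ∀ ℓ, s.val (64 + 2 * ℓ) = f (st.N ℓ) - f ∅
  tv : ∀ ℓ, s.val (65 + 2 * ℓ) = st.tv ℓ - f ∅
  c : ∀ ℓ, s.nat (64 + 2 * ℓ) = st.c ℓ
  cnt : ∀ l, s.nat (65 + 2 * l) = cnt l
  H : ∀ h, s.item (h + 1) = st.H[h]?
  short : s.shortlist = st.H.toFinset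
  stream : s.stream = str
  peak : s.peak ≤ M
  len : st.H.length + str.length ≤ n

/-- The integers that occur are at most `M`. -/
structure Par.Bdd (P : Par) (M n : ℕ) : Prop where
  K : 2 * P.K + 100 ≤ M
  W : P.K + P.W + 1 ≤ M
  α : P.α ≤ M
  Q : P.Q ≤ M
  H : P.Q * P.stride + P.R1 + 1 ≤ M
  D : P.D ≤ M
  lab : 65 + 2 * (P.m * P.D) ≤ M
  L : P.L ≤ M
  m : P.m ≤ M
  n : n + 2 ≤ M
  mK : P.m = P.K * P.α
  α0 : 0 < P.α

open Code

/-- Registers that the innermost loop does not change. -/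
def Frame (s s' : State n) : Prop := ∀ a, 16 ≤ a → a < 29 → s'.nat a = s.nat a

theorem addr_even_ne {a ℓ : ℕ} (h : a < 64) : (64 + 2 * ℓ = a) = False := by
  simp only [eq_iff_iff, iff_false]; omega

theorem addr_odd_ne {a ℓ : ℕ} (h : a < 64) : (65 + 2 * ℓ = a) = False := by
  simp only [eq_iff_iff, iff_false]; omega

theorem addr_ne_even {a ℓ : ℕ} (h : a < 64) : (a = 64 + 2 * ℓ) = False := by
  simp only [eq_iff_iff, iff_false]; omega

theorem addr_ne_odd {a ℓ : ℕ} (h : a < 64) : (a = 65 + 2 * ℓ) = False := by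
  simp only [eq_iff_iff, iff_false]; omega

theorem addr_even_ne_odd {ℓ ℓ' : ℕ} : (64 + 2 * ℓ = 65 + 2 * ℓ') = False := by
  simp only [eq_iff_iff, iff_false]; omega

theorem addr_odd_ne_even {ℓ ℓ' : ℕ} : (65 + 2 * ℓ = 64 + 2 * ℓ') = False := by
  simp only [eq_iff_iff, iff_false]; omega

theorem addr_next {ℓ : ℕ} : 64 + 2 * ℓ + 2 = 64 + 2 * (ℓ + 1) := by omega

theorem addr_odd {ℓ : ℕ} : 64 + 2 * ℓ + 1 = 65 + 2 * ℓ := by omega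

attribute [local simp] addr_even_ne addr_odd_ne addr_ne_even addr_ne_odd addr_even_ne_odd
  addr_odd_ne_even addr_next addr_odd evalP code detExec State.setNat State.setVal State.setSet
  State.setItem State.getNat State.getVal State.getSet State.getItem State.addr NatOp.eval
  Cond.Holds Function.update_apply

theorem tryItem_of_silent {f : Finset (Fin n) → ℝ} {L lo hi inc : ℕ} {pm : Bool}
    {x : Option (Fin n)} {st : St n} (h : ∀ ℓ, ¬st.Acc f L lo hi pm x ℓ)
    (h' : ∀ ℓ, lo < ℓ → ℓ ≤ hi → pm = true → ¬st.tv ℓ < f (st.cand x ℓ)) :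
    tryItem f L lo hi pm inc x st = st := by
  obtain ⟨S, N, tv, c, H⟩ := st
  simp only [tryItem, h, if_false, false_or, St.mk.injEq, true_and, and_true]
  funext ℓ
  rw [if_neg]
  rintro ⟨h1, h2, h3, h4⟩
  exact h' ℓ h1 h2 h3 h4

theorem tryItem_of_prefix {f : Finset (Fin n) → ℝ} {L ℓ inc : ℕ}
    {x : Option (Fin n)} {st : St n} (h : st.tv (ℓ + 1) < f (st.cand x (ℓ + 1))) :
    tryItem f L ℓ (ℓ + 1) true inc x st =
      { st with tv := Function.update st.tv (ℓ + 1) (f (st.cand x (ℓ + 1))) } := by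
  obtain ⟨S, N, tv, c, H⟩ := st
  simp only [tryItem, St.Acc, St.mk.injEq, true_and, and_true]
  refine ⟨by simp, ?_, by simp⟩
  funext ℓ'
  by_cases hl : ℓ' = ℓ + 1
  · subst hl
    simp [h]
  · rw [if_neg, Function.update_of_ne hl]
    rintro (⟨h1, h2, h3⟩ | ⟨h1, h2, h3⟩) <;> omega

theorem tryItem_of_acc {f : Finset (Fin n) → ℝ} {L ℓ inc : ℕ} {pm : Bool}
    {x : Option (Fin n)} {st : St n} (h : st.Acc f L ℓ (ℓ + 1) pm x (ℓ + 1)) :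
    tryItem f L ℓ (ℓ + 1) pm inc x st =
      { st with
        N := Function.update st.N (ℓ + 1) (st.cand x (ℓ + 1))
        tv := Function.update st.tv (ℓ + 1) (f (st.cand x (ℓ + 1)))
        c := Function.update st.c (ℓ + 1) (st.c (ℓ + 1) + inc) } := by
  have h' : ∀ ℓ', st.Acc f L ℓ (ℓ + 1) pm x ℓ' ↔ ℓ' = ℓ + 1 := by
    intro ℓ'
    constructor
    · rintro ⟨h1, h2, h3⟩; omega
    · rintro rfl; exact h
  have hpm : pm = false := h.2.2.1
  simp only [tryItem, h', St.mk.injEq, true_and]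
  refine ⟨?_, ?_, ?_, trivial⟩ <;> funext ℓ' <;> by_cases hl : ℓ' = ℓ + 1 <;> simp [hl, hpm]

theorem levelBody_eval (f : Finset (Fin n) → ℝ) (P : Par) (M lo hi : ℕ) (cnt : ℕ → ℕ) (st : St n)
    (str : List (Fin n)) (s : State n) (pm : Bool) (inc : ℕ) (x : Option (Fin n)) (ℓ : ℕ)
    (hP : P.Bdd M n) (hℓ : ℓ < P.K) (hinc : inc ≤ 1)
    (h : Rep f P M lo hi cnt st str s) (h30 : s.nat 30 = 64 + 2 * ℓ) (hx : s.item 0 = x)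
    (h26 : s.nat 26 = if pm then 1 else 0) (h27 : s.nat 27 = inc) :
    Rep f P M lo hi cnt (tryItem f P.L ℓ (ℓ + 1) pm inc x st) str (evalP f levelBody s) ∧
      (evalP f levelBody s).nat 30 = 64 + 2 * (ℓ + 1) ∧ (evalP f levelBody s).item 0 = x ∧
      Frame s (evalP f levelBody s) ∧ (evalP f levelBody s).current = s.current ∧
      ((st.Acc f P.L ℓ (ℓ + 1) pm x (ℓ + 1) → (evalP f levelBody s).nat 29 = 1) ∧
        (¬st.Acc f P.L ℓ (ℓ + 1) pm x (ℓ + 1) → (evalP f levelBody s).nat 29 = s.nat 29)) := by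
  have hcd : st.cand x (ℓ + 1) = st.S ℓ ∪ tokenSet x := rfl
  have hK := hP.K
  have hL := hP.L
  obtain ⟨rK, rα, rW, rQ, rR1, rstride, rD, rL, r1, r0, r2, r64, rpK, rlo, rhi, rm,
    rH, v1, rS, rN,
    nv, rtv, rc, rcnt, rIt, short, stream, hpk, hlen⟩ := h
  cases pm
  · have h26' : s.nat 26 = 0 := h26
    clear h26
    by_cases h1 : f (st.N (ℓ + 1)) < f (st.cand x (ℓ + 1))
    · by_cases h2 : f (st.cand x (ℓ + 1)) < st.tv (ℓ + 1)
      · have hna : ∀ ℓ', ¬st.Acc f P.L ℓ (ℓ + 1) false x ℓ' := by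
          rintro ℓ' ⟨a1, a2, a3, a4, a5, a6⟩
          obtain rfl : ℓ' = ℓ + 1 := by omega
          exact a5 h2
        rw [tryItem_of_silent hna (by simp)]
        generalize hs : evalP f levelBody s = s'
        simp [levelBody, h30, hx, r2, r1, rS, v1, ← hcd, r0, h26', h27, nv, rtv, rc, rL, h1,
          h2] at hs
        subst hs
        refine ⟨?_, by simp, by simp [hx], ?_, by simp, by simp [hna], by simp [hna]⟩
        · constructor <;> simp [*]
          omega
        · intro a ha ha'
          simp
          grind
      · by_cases h3 : st.c (ℓ + 1) < P.L
        · have hacc : st.Acc f P.L ℓ (ℓ + 1) false x (ℓ + 1) :=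
            ⟨by omega, le_rfl, rfl, h1, h2, h3⟩
          rw [tryItem_of_acc hacc]
          generalize hs : evalP f levelBody s = s'
          simp [levelBody, h30, hx, r2, r1, rS, v1, ← hcd, r0, h26', h27, nv, rtv, rc, rL, h1, h2,
            h3] at hs
          subst hs
          refine ⟨?_, by simp, by simp [hx], ?_, by simp, by simp [hacc], by simp [hacc]⟩
          · constructor <;> simp [*]
            · intro ℓ'; split_ifs <;> rfl
            · intro ℓ'; split_ifs <;> rfl
            · omega
          · intro a ha ha'
            simp
            grind
        · have hna : ∀ ℓ', ¬st.Acc f P.L ℓ (ℓ + 1) false x ℓ' := by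
            rintro ℓ' ⟨a1, a2, a3, a4, a5, a6⟩
            obtain rfl : ℓ' = ℓ + 1 := by omega
            exact h3 a6
          rw [tryItem_of_silent hna (by simp)]
          generalize hs : evalP f levelBody s = s'
          simp [levelBody, h30, hx, r2, r1, rS, v1, ← hcd, r0, h26', h27, nv, rtv, rc, rL, h1, h2,
            h3] at hs
          subst hs
          refine ⟨?_, by simp, by simp [hx], ?_, by simp, by simp [hna], by simp [hna]⟩
          · constructor <;> simp [*]
            omega
          · intro a ha ha'
            simp
            grind
    · have hna : ∀ ℓ', ¬st.Acc f P.L ℓ (ℓ + 1) false x ℓ' := by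
        rintro ℓ' ⟨a1, a2, a3, a4, a5, a6⟩
        obtain rfl : ℓ' = ℓ + 1 := by omega
        exact h1 a4
      rw [tryItem_of_silent hna (by simp)]
      generalize hs : evalP f levelBody s = s'
      simp [levelBody, h30, hx, r2, r1, rS, v1, ← hcd, r0, h26', h27, nv, rtv, rc, rL, h1] at hs
      subst hs
      refine ⟨?_, by simp, by simp [hx], ?_, by simp, by simp [hna], by simp [hna]⟩
      · constructor <;> simp [*]
        omega
      · intro a ha ha'
        simp
        grind
  · have h26' : s.nat 26 = 1 := h26
    clear h26
    have hna : ∀ ℓ', ¬st.Acc f P.L ℓ (ℓ + 1) true x ℓ' := fun ℓ' h => by simpa using h.2.2.1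
    by_cases h1 : st.tv (ℓ + 1) < f (st.cand x (ℓ + 1))
    · rw [tryItem_of_prefix h1]
      generalize hs : evalP f levelBody s = s'
      simp [levelBody, h30, hx, r2, r1, rS, v1, ← hcd, r0, h26', h27, nv, rtv, rc, rL, h1] at hs
      subst hs
      refine ⟨?_, by simp, by simp [hx], ?_, by simp, by simp [hna], by simp [hna]⟩
      · constructor <;> simp [*]
        · intro ℓ'; split_ifs <;> rfl
        · omega
      · intro a ha ha'
        simp
        grind
    · rw [tryItem_of_silent hna (by
        intro ℓ' a1 a2 _
        obtain rfl : ℓ' = ℓ + 1 := by omega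
        exact h1)]
      generalize hs : evalP f levelBody s = s'
      simp [levelBody, h30, hx, r2, r1, rS, v1, ← hcd, r0, h26', h27, nv, rtv, rc, rL, h1] at hs
      subst hs
      refine ⟨?_, by simp, by simp [hx], ?_, by simp, by simp [hna], by simp [hna]⟩
      · constructor <;> simp [*]
        omega
      · intro a ha ha'
        simp
        grind

end ShortlistSecretary

namespace ShortlistSecretary

open Code

variable {n : ℕ}

attribute [local simp] addr_even_ne addr_odd_ne addr_ne_even addr_ne_odd addr_even_ne_odd
  addr_odd_ne_even addr_next addr_odd evalP code detExec State.setNat State.setVal State.setSet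
  State.setItem State.getNat State.getVal State.getSet State.getItem State.addr NatOp.eval
  Cond.Holds Function.update_apply

theorem acc_tryItem_iff {f : Finset (Fin n) → ℝ} {L lo h inc : ℕ} {pm : Bool}
    {x : Option (Fin n)} {st : St n} (hlo : lo ≤ h) (ℓ : ℕ) :
    (tryItem f L lo h pm inc x st).Acc f L h (h + 1) pm x ℓ ↔
      h < ℓ ∧ st.Acc f L lo (h + 1) pm x ℓ := by
  by_cases hl : h < ℓ
  · have h1 : ¬ℓ ≤ h := by omega
    have h2 : lo < ℓ := by omega
    simp [St.Acc, tryItem, St.cand, hl, h1, h2]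
  · simp [St.Acc, hl]

open Classical in
theorem tryItem_succ {f : Finset (Fin n) → ℝ} {L lo h inc : ℕ} {pm : Bool}
    {x : Option (Fin n)} {st : St n} (hlo : lo ≤ h) :
    tryItem f L h (h + 1) pm inc x (tryItem f L lo h pm inc x st) =
      tryItem f L lo (h + 1) pm inc x st := by
  have h1 : ∀ ℓ, h < ℓ → ¬st.Acc f L lo h pm x ℓ := fun ℓ hl ha => by have := ha.2.1; omega
  have h2 : ∀ ℓ, ¬h < ℓ → (st.Acc f L lo (h + 1) pm x ℓ ↔ st.Acc f L lo h pm x ℓ) := by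
    intro ℓ hl
    have a1 : ℓ ≤ h := by omega
    have a2 : ℓ ≤ h + 1 := by omega
    simp [St.Acc, a1, a2]
  generalize hst : tryItem f L lo h pm inc x st = st'
  have h3 : ∀ ℓ, st'.Acc f L h (h + 1) pm x ℓ ↔ h < ℓ ∧ st.Acc f L lo (h + 1) pm x ℓ := by
    subst hst
    exact acc_tryItem_iff hlo
  unfold tryItem
  rw [St.mk.injEq]
  refine ⟨by rw [← hst]; rfl, ?_, ?_, ?_, by rw [← hst]; rfl⟩ <;> funext ℓ
  · rw [if_congr (h3 ℓ) rfl rfl, ← hst]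
    by_cases hl : h < ℓ
    · simp [hl, tryItem, h1 ℓ hl, St.cand]
    · simp [hl, h2 ℓ hl, tryItem]
  · rw [if_congr (or_congr (h3 ℓ) Iff.rfl) rfl rfl, ← hst]
    by_cases hl : h < ℓ
    · have a1 : ¬ℓ ≤ h := by omega
      have a2 : lo < ℓ := by omega
      simp [hl, tryItem, h1 ℓ hl, St.cand, a1, a2]
    · have a1 : ℓ ≤ h := by omega
      have a2 : ℓ ≤ h + 1 := by omega
      simp [hl, h2 ℓ hl, tryItem, a1, a2]
  · rw [if_congr (h3 ℓ) rfl rfl, ← hst]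
    by_cases hl : h < ℓ
    · simp [hl, tryItem, h1 ℓ hl]
    · simp [hl, h2 ℓ hl, tryItem]

theorem tryItem_self {f : Finset (Fin n) → ℝ} {L lo inc : ℕ} {pm : Bool}
    {x : Option (Fin n)} {st : St n} : tryItem f L lo lo pm inc x st = st :=
  tryItem_of_silent (fun ℓ h => by have := h.1; have := h.2.1; omega) (fun ℓ h1 h2 => by omega)

/-! ### Trying an item on all levels -/

/-- Running time of trying one item on `w` levels. -/
def levelTime (w : ℕ) : ℕ := 40 * w + 3

/-- The loop over the levels computes `tryItem`, and cell `29` is set when the item improves a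
level. -/
theorem levelLoop_sim {f : Finset (Fin n) → ℝ} {P : Par} {M lo hi : ℕ} {cnt : ℕ → ℕ} {st : St n}
    {str : List (Fin n)} {s : State n} {pm : Bool} {inc : ℕ} {x : Option (Fin n)}
    (hP : P.Bdd M n) (hlo : lo ≤ hi) (hhi : hi ≤ P.K) (hinc : inc ≤ 1)
    (h : Rep f P M lo hi cnt st str s) (hx : s.item 0 = x)
    (h26 : s.nat 26 = if pm then 1 else 0) (h27 : s.nat 27 = inc) :
    Sim f levelLoop s (.pure ()) (levelTime (hi - lo)) fun _ s' =>
      Rep f P M lo hi cnt (tryItem f P.L lo hi pm inc x st) str s' ∧ s'.item 0 = x ∧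
      Frame s s' ∧ s'.current = s.current ∧
      ((∃ ℓ, st.Acc f P.L lo hi pm x ℓ) → s'.nat 29 = 1) ∧
      ((¬∃ ℓ, st.Acc f P.L lo hi pm x ℓ) → s'.nat 29 = s.nat 29) := by
  unfold levelLoop
  have hK := hP.K
  refine (Sim.seq_det (R := fun _ s' => Rep f P M lo hi cnt st str s' ∧ s'.nat 30 = 64 + 2 * lo ∧
      s'.item 0 = x ∧ Frame s s' ∧ s'.current = s.current ∧ s'.nat 29 = s.nat 29) (B := 1)
    (B' := ∑ i ∈ range (hi - lo), (36 + 1) + 1)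
    (R' := fun _ s' =>
      Rep f P M lo hi cnt (tryItem f P.L lo hi pm inc x st) str s' ∧ s'.item 0 = x ∧
      Frame s s' ∧ s'.current = s.current ∧
      ((∃ ℓ, st.Acc f P.L lo hi pm x ℓ) → s'.nat 29 = 1) ∧
      ((¬∃ ℓ, st.Acc f P.L lo hi pm x ℓ) → s'.nat 29 = s.nat 29))
    (Sim.eval (by trivial) ?_ le_rfl) ?_).conseq ?_ (fun _ _ h => h)
  · generalize hs : evalP f (.instr (add (.dir 30) (.dir 17) (.dir 11))) s = s'
    obtain ⟨rK, rα, rW, rQ, rR1, rstride, rD, rL, r1, r0, r2, r64, rpK, rlo, rhi, rm,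
      rH, v1, rS, rN,
      nv, rtv, rc, rcnt, rIt, short, stream, hpk, hlen⟩ := h
    simp [rlo, r0] at hs
    subst hs
    refine ⟨?_, by simp, by simp [hx], ?_, by simp, by simp⟩
    · constructor <;> simp [*]
      omega
    · intro a ha ha'
      simp
      omega
  · rintro s1 ⟨g1, g2, g3, g4, g5, g6⟩
    have hloop := Sim.loop_det (f := f) (c := .natLt (.dir 30) (.dir 18)) (p := levelBody)
      (hi - lo) (cost := fun _ => 36)
      (R := fun i s' => Rep f P M lo hi cnt (tryItem f P.L lo (lo + i) pm inc x st) str s' ∧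
        s'.nat 30 = 64 + 2 * (lo + i) ∧ s'.item 0 = x ∧ Frame s s' ∧ s'.current = s.current ∧
        ((∃ ℓ, st.Acc f P.L lo (lo + i) pm x ℓ) → s'.nat 29 = 1) ∧
        ((¬∃ ℓ, st.Acc f P.L lo (lo + i) pm x ℓ) → s'.nat 29 = s.nat 29))
      (s := s1) ?_ ?_ ?_
    · refine hloop.conseq le_rfl ?_
      rintro _ s' ⟨a1, a2, a3, a4, a5, a6, a7⟩
      rw [show lo + (hi - lo) = hi by omega] at a1 a6 a7
      exact ⟨a1, a3, a4, a5, a6, a7⟩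
    · rintro i hi' s' ⟨a1, a2, a3, a4, a5, a6, a7⟩
      refine ⟨?_, Sim.eval (by simp [Straight, levelBody, code]) ?_
        (by simp [psize, levelBody, code])⟩
      · simp [a2, a1.rhi]
        omega
      · have b := levelBody_eval f P M lo hi cnt _ str s' pm inc x (lo + i) hP (by omega) hinc a1 a2
          a3 (by rw [a4 26 (by norm_num) (by norm_num), h26])
          (by rw [a4 27 (by norm_num) (by norm_num), h27])
        rw [tryItem_succ (by omega)] at b
        obtain ⟨b1, b2, b3, b4, b5, b6, b7⟩ := b
        refine ⟨b1, b2, b3, fun a h1 h2 => (b4 a h1 h2).trans (a4 a h1 h2), b5.trans a5, ?_, ?_⟩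
        · rintro ⟨ℓ, hℓ⟩
          by_cases hl : lo + i < ℓ
          · refine b6 ((acc_tryItem_iff (by omega) _).2 ⟨by omega, ?_⟩)
            have h1 := hℓ.2.1
            obtain rfl : ℓ = lo + i + 1 := by omega
            exact hℓ
          · have h1 : st.Acc f P.L lo (lo + i) pm x ℓ := ⟨hℓ.1, by omega, hℓ.2.2⟩
            have h2 := a6 ⟨ℓ, h1⟩
            by_cases h3 : (tryItem f P.L lo (lo + i) pm inc x st).Acc f P.L (lo + i) (lo + i + 1) pm
              x (lo + i + 1)
            · exact b6 h3
            · rw [b7 h3, h2]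
        · intro hno
          rw [b7 fun h3 => hno ⟨_, ((acc_tryItem_iff (by omega) _).1 h3).2⟩]
          refine a7 ?_
          rintro ⟨ℓ, hℓ⟩
          exact hno ⟨ℓ, hℓ.1, by have := hℓ.2.1; omega, hℓ.2.2⟩
    · rintro s' ⟨a1, a2, -⟩
      simp [a2, a1.rhi]
      omega
    · have hno : ∀ ℓ, ¬st.Acc f P.L lo lo pm x ℓ := fun ℓ h => by
        have := h.1; have := h.2.1; omega
      simp only [add_zero, tryItem_self]
      exact ⟨g1, g2, g3, g4, g5, fun ⟨ℓ, hℓ⟩ => (hno ℓ hℓ).elim, fun _ => g6⟩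
  · simp [levelTime]
    omega

end ShortlistSecretary

namespace ShortlistSecretary

open Code

variable {n : ℕ}

attribute [local simp] addr_even_ne addr_odd_ne addr_ne_even addr_ne_odd addr_even_ne_odd
  addr_odd_ne_even addr_next addr_odd evalP code detExec State.setNat State.setVal State.setSet
  State.setItem State.getNat State.getVal State.getSet State.getItem State.addr NatOp.eval
  Cond.Holds Function.update_apply

/-! ### Sampling old items -/

/-- The loop over the samples has the law of `Q` rounds of `hStep`. -/
theorem hLoop_sim {f : Finset (Fin n) → ℝ} {P : Par} {M lo hi b : ℕ} {cnt : ℕ → ℕ} {st : St n}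
    {str : List (Fin n)} {s : State n} (hP : P.Bdd M n) (hlo : lo ≤ hi) (hhi : hi ≤ P.K)
    (h : Rep f P M lo hi cnt st str s) (hg : st.Good f P.L lo hi b) :
    Sim f hLoop s (Rnd.iter P.Q (hStep f P lo hi) st) (P.Q * (levelTime (hi - lo) + 11) + 9)
      fun st' s' => Rep f P M lo hi cnt st' str s' ∧ st'.Good f P.L lo hi b ∧
        s'.nat 16 = s.nat 16 ∧ s'.nat 20 = s.nat 20 := by
  unfold hLoop
  have hK := hP.K
  have hQ := hP.Q
  have hH := hP.H
  refine (Sim.seq_det (R := fun _ s' => Rep f P M lo hi cnt st str s' ∧ s'.nat 16 = s.nat 16 ∧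
      s'.nat 20 = s.nat 20 ∧ s'.nat 26 = 0 ∧ s'.nat 27 = 0 ∧ s'.nat 22 = 0 ∧ s'.nat 23 = 1) (B := 7)
    (B' := ∑ i ∈ range P.Q, (levelTime (hi - lo) + 10 + 1) + 1)
    (R' := fun st' s' => Rep f P M lo hi cnt st' str s' ∧ st'.Good f P.L lo hi b ∧
        s'.nat 16 = s.nat 16 ∧ s'.nat 20 = s.nat 20)
    (Sim.eval (by simp [Straight]) ?_ (by simp [psize])) ?_).conseq ?_ (fun _ _ h => h)
  · obtain ⟨rK, rα, rW, rQ, rR1, rstride, rD, rL, r1, r0, r2, r64, rpK, rlo, rhi, rm,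
      rH, v1, rS, rN,
      nv, rtv, rc, rcnt, rIt, short, stream, hpk, hlen⟩ := h
    refine ⟨?_, by simp, by simp, by simp, by simp, by simp, by simp⟩
    constructor <;> simp [*]
    omega
  · rintro s1 ⟨g1, g2, g3, g4, g5, g6, g7⟩
    refine (Sim.loop (f := f) P.Q (cost := fun _ => levelTime (hi - lo) + 10)
      (R := fun i st' s' => Rep f P M lo hi cnt st' str s' ∧ st'.Good f P.L lo hi b ∧
        s'.nat 16 = s.nat 16 ∧ s'.nat 20 = s.nat 20 ∧ s'.nat 26 = 0 ∧ s'.nat 27 = 0 ∧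
        s'.nat 22 = i ∧ s'.nat 23 = 1 + i * P.stride) ?_ ?_
        ⟨g1, hg, g2, g3, g4, g5, g6, by simp [g7]⟩).conseq le_rfl ?_
    · rintro i hi' st' s' ⟨a1, a2, a3, a4, a5, a6, a7, a8⟩
      refine ⟨by simp [a7, a1.rQ, hi'], ?_⟩
      have hi1 : i * P.stride + P.stride ≤ P.Q * P.stride := by
        have := Nat.mul_le_mul_right P.stride hi'
        simpa [Nat.succ_mul] using this
      refine (Sim.seq (X := ℕ) (R := fun x s2 => x ≤ P.R1 ∧ s2 = s'.setNat (.dir 28) x)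
        (B := 1) (B' := levelTime (hi - lo) + 8)
        (b := fun x => .pure (tryItem f P.L lo hi false 0 (st'.H[i * P.stride + x]?) st'))
        (Sim.rand (a := id) (m := P.R1) (by simpa using a1.rR1) ?_) ?_).conseq (by omega)
          (fun _ _ h => h)
      · exact fun i hi => ⟨hi, rfl⟩
      · rintro x s2 ⟨hx, rfl⟩
        refine (Sim.seq_det (R := fun _ s3 => Rep f P M lo hi cnt st' str s3 ∧
            s3.nat 16 = s.nat 16 ∧ s3.nat 20 = s.nat 20 ∧ s3.nat 26 = 0 ∧ s3.nat 27 = 0 ∧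
            s3.nat 22 = i + 1 ∧ s3.nat 23 = 1 + (i + 1) * P.stride ∧
            s3.item 0 = st'.H[i * P.stride + x]?) (B := 7)
          (B' := levelTime (hi - lo)) (Sim.eval (by simp [Straight]) ?_
            (by simp [psize])) ?_).conseq
          (by omega) (fun _ _ h => h)
        · generalize hs : evalP f _ _ = s3
          obtain ⟨rK, rα, rW, rQ, rR1, rstride, rD, rL, r1, r0, r2, r64, rpK, rlo, rhi, rm, rH, v1,
            rS, rN, nv, rtv, rc, rcnt, rIt, short, stream, hpk, hlen⟩ := a1
          simp [a3, a4, a5, a6, a7, a8, r1, rstride] at hs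
          have e1 : s'.item (x + (1 + i * P.stride)) = st'.H[i * P.stride + x]? := by
            rw [← rIt, show x + (1 + i * P.stride) = i * P.stride + x + 1 by ring]
          subst hs
          refine ⟨?_, by simp [a3], by simp [a4], by simp [a5], by simp [a6], by simp,
            by simp; ring,
            by simp [e1]⟩
          constructor <;> simp [*]
          omega
        · rintro s3 ⟨b1, b2, b3, b4, b5, b6, b7, b8⟩
          intro Z u K C g hg'
          refine levelLoop_sim (x := st'.H[i * P.stride + x]?) (pm := false) (inc := 0) hP hlo hhi
            (by norm_num) b1 b8 (by simp [b4]) b5 Z u K C (fun _ => g _) ?_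
          rintro _ s4 ⟨c1, -, c3, -⟩
          refine hg' _ s4 ⟨c1, a2.tryItem fun y hy => List.mem_of_getElem? hy, ?_⟩
          rw [c3 16 (by norm_num) (by norm_num), c3 20 (by norm_num) (by norm_num),
            c3 26 (by norm_num) (by norm_num), c3 27 (by norm_num) (by norm_num),
            c3 22 (by norm_num) (by norm_num), c3 23 (by norm_num) (by norm_num)]
          exact ⟨b2, b3, b4, b5, b6, b7⟩
    · rintro st' s' ⟨a1, a2, a3, a4, a5, a6, a7, a8⟩
      simp [a7, a1.rQ]
    · rintro st' s' ⟨a1, a2, a3, a4, -⟩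
      exact ⟨a1, a2, a3, a4⟩
  · refine le_of_eq ?_
    simp
    ring

end ShortlistSecretary

namespace ShortlistSecretary

open Code

variable {n : ℕ}

attribute [local simp] addr_even_ne addr_odd_ne addr_ne_even addr_ne_odd addr_even_ne_odd
  addr_odd_ne_even addr_next addr_odd evalP code detExec State.setNat State.setVal State.setSet
  State.setItem State.getNat State.getVal State.getSet State.getItem State.addr NatOp.eval
  Cond.Holds Function.update_apply

/-! ### Receiving the items of a window -/

/-- One arrival has the effect of `arrive`. -/
theorem itemBody_sim {f : Finset (Fin n) → ℝ} {P : Par} {M lo hi t : ℕ} {cnt : ℕ → ℕ}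
    {st : St n} {str : List (Fin n)} {s : State n} {pm : Bool} {x : Fin n}
    (hP : P.Bdd M n) (hlo : lo ≤ hi) (hhi : hi ≤ P.K)
    (h : Rep f P M lo hi cnt st (x :: str) s) (h25 : s.nat 25 = t + 1) (ht : t < n)
    (h26 : s.nat 26 = if pm then 1 else 0) (h27 : s.nat 27 = 1) :
    Sim f itemBody s (.pure ()) (levelTime (hi - lo) + 14) fun _ s' =>
      Rep f P M lo hi cnt (arrive f P.L lo hi pm x st) str s' ∧ s'.nat 25 = t ∧
      s'.nat 16 = s.nat 16 ∧ s'.nat 20 = s.nat 20 ∧ s'.nat 24 = s.nat 24 ∧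
      s'.nat 26 = s.nat 26 ∧ s'.nat 27 = 1 := by
  unfold itemBody
  have hn := hP.n
  have hK := hP.K
  have hlen' : st.H.length + (str.length + 1) ≤ n := h.len
  refine (Sim.seq_det (R := fun _ s' => Rep f P M lo hi cnt st str s' ∧ s'.item 0 = some x ∧
      Frame s s' ∧ s'.current = some x ∧ s'.nat 29 = 0) (B := 3)
    (B' := levelTime (hi - lo) + 10) (Sim.eval (by simp [Straight]) ?_ (by simp [psize])) ?_).conseq
    (by omega) (fun _ _ h => h)
  · generalize hs : evalP f _ s = s'
    obtain ⟨rK, rα, rW, rQ, rR1, rstride, rD, rL, r1, r0, r2, r64, rpK, rlo, rhi, rm,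
      rH, v1, rS, rN,
      nv, rtv, rc, rcnt, rIt, short, stream, hpk, hlen⟩ := h
    simp [stream] at hs
    subst hs
    refine ⟨?_, by simp, ?_, by simp, by simp⟩
    · constructor <;> try simp [*]
      omega
    · intro a ha ha'
      simp only [Function.update_apply]
      rw [if_neg (by omega)]
  · rintro s1 ⟨g1, g2, g3, g4, g5⟩
    refine (Sim.seq_det (levelLoop_sim (x := some x) (pm := pm) (inc := 1) hP hlo hhi le_rfl g1 g2
      (by rw [g3 26 (by norm_num) (by norm_num), h26])
      (by rw [g3 27 (by norm_num) (by norm_num), h27])) (B' := 9) ?_).conseq le_rfl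
      (fun _ _ h => h)
    rintro s2 ⟨a1, a2, a3, a4, a5, a6⟩
    have f16 : s2.nat 16 = s.nat 16 := by
      rw [a3 16 (by norm_num) (by norm_num), g3 16 (by norm_num) (by norm_num)]
    have f20 : s2.nat 20 = s.nat 20 := by
      rw [a3 20 (by norm_num) (by norm_num), g3 20 (by norm_num) (by norm_num)]
    have f24 : s2.nat 24 = s.nat 24 := by
      rw [a3 24 (by norm_num) (by norm_num), g3 24 (by norm_num) (by norm_num)]
    have f25 : s2.nat 25 = t + 1 := by
      rw [a3 25 (by norm_num) (by norm_num), g3 25 (by norm_num) (by norm_num), h25]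
    have f26 : s2.nat 26 = s.nat 26 := by
      rw [a3 26 (by norm_num) (by norm_num), g3 26 (by norm_num) (by norm_num)]
    have f27 : s2.nat 27 = 1 := by
      rw [a3 27 (by norm_num) (by norm_num), g3 27 (by norm_num) (by norm_num), h27]
    refine Sim.eval (by simp [Straight]) ?_ (by simp [psize])
    have f25' := a1.peak
    by_cases hex : ∃ ℓ, st.Acc f P.L lo hi pm (some x) ℓ
    · have f29 := a5 hex
      have hc := a4.trans g4
      have eA : arrive f P.L lo hi pm x st =
          { tryItem f P.L lo hi pm 1 (some x) st with H := st.H ++ [x] } := if_pos hex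
      have eH : (tryItem f P.L lo hi pm 1 (some x) st).H = st.H := rfl
      rw [eA]
      generalize tryItem f P.L lo hi pm 1 (some x) st = st2 at a1 eH ⊢
      obtain ⟨rK, rα, rW, rQ, rR1, rstride, rD, rL, r1, r0, r2, r64, rpK, rlo, rhi, rm,
          rH, v1, rS,
        rN, nv, rtv, rc, rcnt, rIt, short, stream, hpk, hlen⟩ := a1
      rw [eH] at rH rIt short hlen
      generalize hs : evalP f _ s2 = s3
      simp [r0, f29, hc, rH, r1, f25, a2] at hs
      subst hs
      refine ⟨?_, by simp, by simp [f16], by simp [f20], by simp [f24], by simp [f26],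
        by simp [f27]⟩
      constructor <;> simp [*]
      · intro h
        rcases lt_trichotomy h st.H.length with hlt | rfl | hlt
        · rw [if_neg hlt.ne, List.getElem?_append_left hlt]
        · simp
        · rw [if_neg hlt.ne', List.getElem?_eq_none hlt.le,
            List.getElem?_eq_none (by simp; omega)]
      · ext y
        simp [tokenSet, or_comm, eq_comm]
      · omega
      · omega
    · have hc := a4.trans g4
      have f29 := (a6 hex).trans g5
      have eA : arrive f P.L lo hi pm x st = tryItem f P.L lo hi pm 1 (some x) st := if_neg hex
      rw [eA]
      obtain ⟨rK, rα, rW, rQ, rR1, rstride, rD, rL, r1, r0, r2, r64, rpK, rlo, rhi, rm,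
          rH, v1, rS,
        rN, nv, rtv, rc, rcnt, rIt, short, stream, hpk, hlen⟩ := a1
      generalize hs : evalP f _ s2 = s3
      simp [r0, f29, r1, f25] at hs
      subst hs
      refine ⟨?_, by simp, by simp [f16], by simp [f20], by simp [f24], by simp [f26],
        by simp [f27]⟩
      constructor <;> simp [*]
      omega

/-- The arrivals with one label, taken from the front of the stream. -/
theorem dBody_sim {f : Finset (Fin n) → ℝ} {P : Par} {M lo hi lab d : ℕ} {cnt : ℕ → ℕ}
    {st : St n} {l str : List (Fin n)} {s : State n}
    (hP : P.Bdd M n) (hlo : lo ≤ hi) (hhi : hi ≤ P.K) (hlab : lab < P.m * P.D) (hd : d < P.D)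
    (h : Rep f P M lo hi cnt st (l ++ str) s) (hl : cnt lab = l.length)
    (h20 : s.nat 20 = 65 + 2 * lab) (h24 : s.nat 24 = d) (h27 : s.nat 27 = 1) :
    Sim f dBody s (.pure ()) (l.length * (levelTime (hi - lo) + 15) + 9) fun _ s' =>
      Rep f P M lo hi cnt (l.foldl (fun st x => arrive f P.L lo hi (decide (d = 0)) x st) st) str
        s' ∧ s'.nat 16 = s.nat 16 ∧ s'.nat 20 = 65 + 2 * (lab + 1) ∧ s'.nat 24 = d + 1 ∧
        s'.nat 27 = 1 := by
  unfold dBody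
  have hln : l.length ≤ n := by
    have := h.len
    rw [List.length_append] at this
    omega
  have hM := hP.lab
  have hMD := hP.D
  have hn := hP.n
  refine (Sim.seq_det (R := fun _ s' => Rep f P M lo hi cnt st (l ++ str) s' ∧
      s'.nat 16 = s.nat 16 ∧ s'.nat 20 = 65 + 2 * lab ∧ s'.nat 24 = d ∧
      s'.nat 26 = (if decide (d = 0) then 1 else 0) ∧ s'.nat 27 = 1 ∧ s'.nat 25 = l.length) (B := 3)
    (B' := l.length * (levelTime (hi - lo) + 15) + 5)
    (Sim.eval (by simp [Straight]) ?_ (by simp [psize])) ?_).conseq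
    (by omega) (fun _ _ h => h)
  · generalize hs : evalP f _ s = s'
    obtain ⟨rK, rα, rW, rQ, rR1, rstride, rD, rL, r1, r0, r2, r64, rpK, rlo, rhi, rm,
      rH, v1, rS, rN,
      nv, rtv, rc, rcnt, rIt, short, stream, hpk, hlen⟩ := h
    simp [h20, rcnt, r0, hl, r1, h24] at hs
    subst hs
    refine ⟨?_, by simp, by simp [h20], by simp [h24], ?_, by simp [h27], by simp⟩
    · constructor <;> simp [*]
      · omega
      · simpa using hlen
    · simp
      split_ifs <;> omega
  · rintro s1 ⟨g1, g2, g3, g4, g5, g6, g7⟩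
    refine (Sim.seq_det (Sim.loop_det (f := f) l.length (cost := fun _ => levelTime (hi - lo) + 14)
      (R := fun i s' => Rep f P M lo hi cnt
          ((l.take i).foldl (fun st x => arrive f P.L lo hi (decide (d = 0)) x st) st)
          (l.drop i ++ str) s' ∧
        s'.nat 16 = s.nat 16 ∧ s'.nat 20 = 65 + 2 * lab ∧ s'.nat 24 = d ∧
        s'.nat 26 = (if decide (d = 0) then 1 else 0) ∧ s'.nat 27 = 1 ∧
        s'.nat 25 = l.length - i) ?_ ?_ ⟨by simpa using g1, g2, g3, g4, g5, g6, by simpa using g7⟩)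
      (B' := 3) ?_).conseq ?_ (fun _ _ h => h)
    · rintro i hi' s2 ⟨a1, a2, a3, a4, a5, a6, a7⟩
      refine ⟨by simp [a7, a1.r0, hi'], ?_⟩
      rw [List.drop_eq_getElem_cons hi', List.cons_append] at a1
      refine (itemBody_sim (t := l.length - (i + 1)) (pm := decide (d = 0)) hP hlo hhi a1
        (by omega) (by omega) a5 a6).conseq le_rfl ?_
      rintro _ s3 ⟨b1, b2, b3, b4, b5, b6, b7⟩
      refine ⟨?_, b3.trans a2, b4.trans a3, b5.trans a4, b6.trans a5, b7, b2⟩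
      rw [List.take_succ_eq_append_getElem hi', List.foldl_append]
      exact b1
    · rintro s2 ⟨a1, a2, a3, a4, a5, a6, a7⟩
      simp [a7, a1.r0]
    · rintro s2 ⟨a1, a2, a3, a4, a5, a6, a7⟩
      refine Sim.eval (by simp [Straight]) ?_ (by simp [psize])
      simp only [List.take_length, List.drop_length, List.nil_append] at a1
      generalize List.foldl _ st l = st' at a1 ⊢
      generalize hs : evalP f _ s2 = s'
      obtain ⟨rK, rα, rW, rQ, rR1, rstride, rD, rL, r1, r0, r2, r64, rpK, rlo, rhi, rm,
          rH, v1, rS,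
        rN, nv, rtv, rc, rcnt, rIt, short, stream, hpk, hlen⟩ := a1
      simp [a3, a4, r1, r2] at hs
      subst hs
      refine ⟨?_, by simp [a2], by simp; ring, by simp, by simp [a6]⟩
      constructor <;> simp [*]
      omega
    · refine le_of_eq ?_
      simp

/-- The items with the labels `lab, …, lab + D - 1`, in order of arrival. -/
def segment (blk : ℕ → List (Fin n)) (lab : ℕ) : ℕ → List (Fin n)
  | 0 => []
  | D + 1 => blk lab ++ segment blk (lab + 1) D

theorem segment_add (blk : ℕ → List (Fin n)) (lab D E : ℕ) :
    segment blk lab (D + E) = segment blk lab D ++ segment blk (lab + D) E := by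
  induction D generalizing lab with
  | zero => simp [segment]
  | succ D ih =>
    rw [show D + 1 + E = D + E + 1 by ring, segment, segment, ih, List.append_assoc,
      show lab + 1 + D = lab + (D + 1) by ring]

theorem dLoop_sim {f : Finset (Fin n) → ℝ} {P : Par} {M lo hi lab : ℕ} {cnt : ℕ → ℕ}
    {st : St n} {blk : ℕ → List (Fin n)} {str : List (Fin n)} {s : State n}
    (hP : P.Bdd M n) (hlo : lo ≤ hi) (hhi : hi ≤ P.K) (hlab : lab + P.D ≤ P.m * P.D)
    (h : Rep f P M lo hi cnt st (segment blk lab P.D ++ str) s)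
    (hl : ∀ l < P.m * P.D, cnt l = (blk l).length) (h20 : s.nat 20 = 65 + 2 * lab) :
    Sim f dLoop s (.pure ())
      ((∑ d ∈ range P.D, (blk (lab + d)).length) * (levelTime (hi - lo) + 15) + 10 * P.D + 5)
      fun _ s' => Rep f P M lo hi cnt (scan f P.L lo hi blk lab P.D st) str s' ∧
        s'.nat 16 = s.nat 16 ∧ s'.nat 20 = 65 + 2 * (lab + P.D) := by
  unfold dLoop
  have hM := hP.lab
  refine (Sim.seq_det (R := fun _ s' => Rep f P M lo hi cnt st (segment blk lab P.D ++ str) s' ∧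
      s'.nat 16 = s.nat 16 ∧ s'.nat 20 = 65 + 2 * lab ∧ s'.nat 24 = 0 ∧ s'.nat 27 = 1) (B := 3)
    (B' := ∑ d ∈ range P.D, ((blk (lab + d)).length * (levelTime (hi - lo) + 15) + 9 + 1) + 1)
    (Sim.eval (by simp [Straight]) ?_ (by simp [psize])) ?_).conseq
    ?_ (fun _ _ h => h)
  · generalize hs : evalP f _ s = s'
    obtain ⟨rK, rα, rW, rQ, rR1, rstride, rD, rL, r1, r0, r2, r64, rpK, rlo, rhi, rm,
      rH, v1, rS, rN,
      nv, rtv, rc, rcnt, rIt, short, stream, hpk, hlen⟩ := h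
    simp at hs
    subst hs
    refine ⟨?_, by simp, by simp [h20], by simp, by simp⟩
    constructor <;> simp [*]
    · omega
    · simpa using hlen
  · rintro s1 ⟨g1, g2, g3, g4, g5⟩
    refine (Sim.loop_det (f := f) P.D
      (cost := fun d => (blk (lab + d)).length * (levelTime (hi - lo) + 15) + 9)
      (R := fun d s' => Rep f P M lo hi cnt (scan f P.L lo hi blk lab d st)
          (segment blk (lab + d) (P.D - d) ++ str) s' ∧
        s'.nat 16 = s.nat 16 ∧ s'.nat 20 = 65 + 2 * (lab + d) ∧ s'.nat 24 = d ∧ s'.nat 27 = 1)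
      ?_ ?_ ⟨g1, g2, g3, g4, g5⟩).conseq le_rfl ?_
    · rintro d hd s2 ⟨a1, a2, a3, a4, a5⟩
      refine ⟨by simp [a4, a1.rD, hd], ?_⟩
      rw [show P.D - d = (P.D - (d + 1)) + 1 by omega, segment, List.append_assoc] at a1
      refine (dBody_sim hP hlo hhi (by omega) hd a1 (hl _ (by omega)) a3 a4 a5).conseq le_rfl ?_
      rintro _ s3 ⟨b1, b2, b3, b4, b5⟩
      rw [scan_succ]
      exact ⟨b1, b2.trans a2, b3, b4, b5⟩
    · rintro s2 ⟨a1, a2, a3, a4, a5⟩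
      simp [a4, a1.rD]
    · rintro _ s2 ⟨a1, a2, a3, a4, a5⟩
      rw [Nat.sub_self, segment, List.nil_append] at a1
      exact ⟨a1, a2, a3⟩
  · refine le_of_eq ?_
    simp only [sum_add_distrib, sum_const, card_range, smul_eq_mul, ← sum_mul]
    ring

end ShortlistSecretary

namespace ShortlistSecretary

open Code

variable {n : ℕ}

attribute [local simp] addr_even_ne addr_odd_ne addr_ne_even addr_ne_odd addr_even_ne_odd
  addr_odd_ne_even addr_next addr_odd evalP code detExec State.setNat State.setVal State.setSet
  State.setItem State.getNat State.getVal State.getSet State.getItem State.addr NatOp.eval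
  Cond.Holds Function.update_apply

/-! ### Ending a window -/

open Classical in
/-- The data after the levels from `lo + 1` to `h` have been committed. -/
noncomputable def St.commit (f : Finset (Fin n) → ℝ) (lo h : ℕ) (st : St n) : St n where
  S := fun ℓ => if lo < ℓ ∧ ℓ ≤ h then st.N ℓ else st.S ℓ
  N := st.N
  tv := fun ℓ => if lo < ℓ ∧ ℓ ≤ h then f (st.N ℓ) else st.tv ℓ
  c := fun ℓ => if lo < ℓ ∧ ℓ ≤ h then 0 else st.c ℓ
  H := st.H

theorem St.Good.commit {f : Finset (Fin n) → ℝ} {L lo hi b : ℕ} {st : St n}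
    (h : st.Good f L lo hi b) : st.commit f lo hi = clean f st.N st.H := by
  obtain ⟨S, N, tv, c, H⟩ := st
  have h1 := h.out
  simp only [St.commit, clean, St.mk.injEq, true_and, and_true] at h1 ⊢
  refine ⟨?_, ?_, ?_⟩ <;> funext ℓ <;> split_ifs with hℓ
  · rfl
  · exact (h1 ℓ hℓ).1.symm
  · rfl
  · rw [(h1 ℓ hℓ).2.1, (h1 ℓ hℓ).1]
  · rfl
  · exact (h1 ℓ hℓ).2.2

theorem St.commit_self {f : Finset (Fin n) → ℝ} {lo : ℕ} {st : St n} : st.commit f lo lo = st := by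
  obtain ⟨S, N, tv, c, H⟩ := st
  have : ∀ ℓ, ¬(lo < ℓ ∧ ℓ ≤ lo) := fun ℓ => by omega
  simp [St.commit, this]

theorem commitLoop_sim {f : Finset (Fin n) → ℝ} {P : Par} {M lo hi b : ℕ} {cnt : ℕ → ℕ}
    {st : St n} {str : List (Fin n)} {s : State n}
    (hP : P.Bdd M n) (hlo : lo ≤ hi) (hhi : hi ≤ P.K)
    (h : Rep f P M lo hi cnt st str s) (hg : st.Good f P.L lo hi b) :
    Sim f commitLoop s (.pure ()) (12 * (hi - lo) + 3) fun _ s' =>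
      Rep f P M lo hi cnt (clean f st.N st.H) str s' ∧ s'.nat 16 = s.nat 16 ∧
        s'.nat 20 = s.nat 20 := by
  unfold commitLoop
  have hK := hP.K
  refine (Sim.seq_det (R := fun _ s' => Rep f P M lo hi cnt st str s' ∧ s'.nat 16 = s.nat 16 ∧
      s'.nat 20 = s.nat 20 ∧ s'.nat 30 = 64 + 2 * lo) (B := 1)
    (B' := ∑ i ∈ range (hi - lo), (11 + 1) + 1)
    (Sim.eval (by simp [Straight]) ?_ (by simp [psize])) ?_).conseq
    ?_ (fun _ _ h => h)
  · generalize hs : evalP f _ s = s'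
    obtain ⟨rK, rα, rW, rQ, rR1, rstride, rD, rL, r1, r0, r2, r64, rpK, rlo, rhi, rm,
      rH, v1, rS, rN,
      nv, rtv, rc, rcnt, rIt, short, stream, hpk, hlen⟩ := h
    simp [rlo, r0] at hs
    subst hs
    refine ⟨?_, by simp, by simp, by simp⟩
    constructor <;> simp [*]
    omega
  · rintro s1 ⟨g1, g2, g3, g4⟩
    refine (Sim.loop_det (f := f) (hi - lo) (cost := fun _ => 11)
      (R := fun i s' => Rep f P M lo hi cnt (st.commit f lo (lo + i)) str s' ∧
        s'.nat 16 = s.nat 16 ∧ s'.nat 20 = s.nat 20 ∧ s'.nat 30 = 64 + 2 * (lo + i))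
      ?_ ?_ ⟨by simpa [St.commit_self] using g1, g2, g3, g4⟩).conseq le_rfl ?_
    · rintro i hi' s2 ⟨a1, a2, a3, a4⟩
      refine ⟨by simp [a4, a1.rhi]; omega, ?_⟩
      refine Sim.eval (by simp [Straight, commitBody]) ?_ (by simp [psize, commitBody])
      generalize hs : evalP f _ s2 = s'
      have e1 : ∀ ℓ, (lo < ℓ ∧ ℓ ≤ lo + (i + 1)) ↔ (ℓ = lo + i + 1 ∨ (lo < ℓ ∧ ℓ ≤ lo + i)) :=
        fun ℓ => by omega
      obtain ⟨rK, rα, rW, rQ, rR1, rstride, rD, rL, r1, r0, r2, r64, rpK, rlo, rhi, rm,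
          rH, v1, rS,
        rN, nv, rtv, rc, rcnt, rIt, short, stream, hpk, hlen⟩ := a1
      simp [commitBody, a4, r1, r2, r0] at hs
      subst hs
      refine ⟨?_, by simp [a2], by simp [a3], by simp; omega⟩
      simp only [St.commit] at rH rS rN nv rtv rc rIt short hlen
      constructor <;> simp only [St.commit, e1] <;> simp [*]
      on_goal 4 => omega
      all_goals
        intro ℓ'
        by_cases hq : ℓ' = lo + i + 1
        · subst hq
          simp
        · simp [hq]
    · rintro s2 ⟨a1, a2, a3, a4⟩
      simp [a4, a1.rhi]
      omega
    · rintro _ s2 ⟨a1, a2, a3, a4⟩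
      rw [show lo + (hi - lo) = hi by omega, hg.commit] at a1
      exact ⟨a1, a2, a3⟩
  · simp
    omega

theorem mergeLoop_sim {f : Finset (Fin n) → ℝ} {P : Par} {M lo hi t : ℕ} {cnt : ℕ → ℕ}
    {S : ℕ → Finset (Fin n)} {H str : List (Fin n)} {s : State n}
    (hP : P.Bdd M n) (hlo : lo ≤ t) (ht : t ≤ P.K)
    (h : Rep f P M lo hi cnt (clean f S H) str s) (h33 : s.nat 33 = 64 + 2 * t) :
    Sim f mergeLoop s (.pure ()) (16 * (t - lo) + 1) fun _ s' =>
      Rep f P M t hi cnt (clean f (mergeUp f lo (t - lo) S) H) str s' ∧ s'.nat 16 = s.nat 16 ∧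
        s'.nat 20 = s.nat 20 ∧ s'.nat 34 = s.nat 34 := by
  unfold mergeLoop
  have hK := hP.K
  refine (Sim.loop_det (f := f) (t - lo) (cost := fun _ => 15)
    (R := fun i s' => Rep f P M (lo + i) hi cnt (clean f (mergeUp f lo i S) H) str s' ∧
      s'.nat 16 = s.nat 16 ∧ s'.nat 20 = s.nat 20 ∧ s'.nat 34 = s.nat 34 ∧
      s'.nat 33 = 64 + 2 * t)
    ?_ ?_ ⟨h, rfl, rfl, rfl, h33⟩).conseq ?_ ?_
  · rintro i hi' s2 ⟨a1, a2, a3, a4, a5⟩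
    refine ⟨by simp [a5, a1.rlo]; omega, ?_⟩
    refine Sim.eval (by simp [Straight, mergeBody]) ?_ (by simp [psize, mergeBody])
    generalize hs : evalP f _ s2 = s'
    have e0 : mergeUp f lo (i + 1) S = merge f (lo + i) (mergeUp f lo i S) := rfl
    rw [e0]
    generalize mergeUp f lo i S = S' at a1 ⊢
    obtain ⟨rK, rα, rW, rQ, rR1, rstride, rD, rL, r1, r0, r2, r64, rpK, rlo, rhi, rm,
          rH, v1, rS,
      rN, nv, rtv, rc, rcnt, rIt, short, stream, hpk, hlen⟩ := a1
    simp only [clean] at rH rS rN nv rtv rc rIt short hlen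
    by_cases hc : f (S' (lo + i + 1)) < f (S' (lo + i))
    · simp [mergeBody, r1, r2, r0, rlo, nv, rS, hc] at hs
      subst hs
      refine ⟨?_, by simp [a2], by simp [a3], by simp [a4], by simp [a5]⟩
      constructor <;> simp only [clean, merge, hc] <;> simp [*]
      all_goals first | omega | (intro ℓ'; split_ifs <;> simp_all)
    · have hm : merge f (lo + i) S' = S' := by
        funext ℓ
        simp [merge, hc]
      rw [hm]
      simp [mergeBody, r1, r2, r0, rlo, nv, hc] at hs
      subst hs
      refine ⟨?_, by simp [a2], by simp [a3], by simp [a4], by simp [a5]⟩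
      constructor <;> simp only [clean] <;> simp [*]
      all_goals omega
  · rintro s2 ⟨a1, a2, a3, a4, a5⟩
    simp [a5, a1.rlo]
    omega
  · simp
    omega
  · rintro _ s2 ⟨a1, a2, a3, a4, a5⟩
    rw [show lo + (t - lo) = t by omega] at a1
    exact ⟨a1, a2, a3, a4⟩

/-- The highest level is set as in `Par.hi`. -/
theorem setHi_sim {f : Finset (Fin n) → ℝ} {P : Par} {M lo hi v : ℕ} {cnt : ℕ → ℕ}
    {st : St n} {str : List (Fin n)} {s : State n} (hP : P.Bdd M n)
    (h : Rep f P M lo hi cnt st str s) (h34 : s.nat 34 = v) :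
    Sim f setHi s (.pure ()) 5 fun _ s' =>
      Rep f P M lo (min P.K v) cnt st str s' ∧ s'.nat 16 = s.nat 16 ∧ s'.nat 20 = s.nat 20 := by
  have hK := hP.K
  refine Sim.eval (by simp [Straight, setHi]) ?_ (by simp [psize, setHi])
  generalize hs : evalP f _ s = s'
  obtain ⟨rK, rα, rW, rQ, rR1, rstride, rD, rL, r1, r0, r2, r64, rpK, rlo, rhi, rm,
          rH, v1, rS,
    rN, nv, rtv, rc, rcnt, rIt, short, stream, hpk, hlen⟩ := h
  by_cases hv : v < P.K
  · simp [setHi, h34, rK, hv, r2, r64] at hs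
    subst hs
    refine ⟨?_, by simp, by simp⟩
    rw [min_eq_right hv.le]
    constructor <;> simp [*]
    all_goals omega
  · simp [setHi, h34, rK, hv, r0, rpK] at hs
    subst hs
    refine ⟨?_, by simp, by simp⟩
    rw [min_eq_left (by omega)]
    constructor <;> simp [*]
    all_goals omega

end ShortlistSecretary

namespace ShortlistSecretary

open Code

variable {n : ℕ}

attribute [local simp] addr_even_ne addr_odd_ne addr_ne_even addr_ne_odd addr_even_ne_odd
  addr_odd_ne_even addr_next addr_odd evalP code detExec State.setNat State.setVal State.setSet
  State.setItem State.getNat State.getVal State.getSet State.getItem State.addr NatOp.eval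
  Cond.Holds Function.update_apply

theorem Par.lo_le_hi {P : Par} {j : ℕ} (h : j / P.α ≤ P.K) : P.lo j ≤ P.hi j := by
  unfold Par.lo Par.hi
  generalize j / P.α = q at h ⊢
  exact le_min (by omega) (by omega)

theorem Par.lo_le_K {P : Par} {j : ℕ} (h : j / P.α ≤ P.K) : P.lo j ≤ P.K :=
  (Nat.sub_le _ _).trans h

theorem Par.lo_succ_le (P : Par) (h : 0 < P.α) (j : ℕ) : P.lo (j + 1) ≤ P.lo j + 1 := by
  have h1 : (j + 1) / P.α ≤ (j + P.α) / P.α := Nat.div_le_div_right (by omega)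
  rw [Nat.add_div_right j h] at h1
  unfold Par.lo
  omega

theorem Par.lo_le_lo_succ (P : Par) (j : ℕ) : P.lo j ≤ P.lo (j + 1) := by
  have h1 : j / P.α ≤ (j + 1) / P.α := Nat.div_le_div_right (by omega)
  unfold Par.lo
  omega

theorem Par.Bdd.div_le {P : Par} {M : ℕ} (hP : P.Bdd M n) {j : ℕ} (hj : j ≤ P.m) :
    j / P.α ≤ P.K := by
  have h1 := Nat.div_le_div_right (c := P.α) hj
  rwa [hP.mK, Nat.mul_div_cancel _ hP.α0] at h1

/-- Running time of a window with `t` arrivals. -/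
def windowTime (P : Par) (t : ℕ) : ℕ :=
  P.Q * (levelTime (2 * P.W + 1) + 11) + t * (levelTime (2 * P.W + 1) + 15) + 10 * P.D +
    12 * (2 * P.W + 1) + 70

theorem levelTime_mono {a b : ℕ} (h : a ≤ b) : levelTime a ≤ levelTime b := by
  unfold levelTime
  omega

/-- The body of the main loop has the law of `window`. -/
theorem windowBody_sim {f : Finset (Fin n) → ℝ} {P : Par} {M j b : ℕ} {cnt : ℕ → ℕ}
    {blk : ℕ → List (Fin n)} {x : Cf n} {str : List (Fin n)} {s : State n}
    (hP : P.Bdd M n) (hj : j < P.m)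
    (h : Rep f P M (P.lo j) (P.hi j) cnt (clean f x.1 x.2) (segment blk (j * P.D) P.D ++ str) s)
    (hx : x.Good b) (hl : ∀ l < P.m * P.D, cnt l = (blk l).length) (h16 : s.nat 16 = j)
    (h20 : s.nat 20 = 65 + 2 * (j * P.D)) :
    Sim f windowBody s (window f P blk j x)
      (windowTime P (∑ d ∈ range P.D, (blk (j * P.D + d)).length)) fun x' s' =>
        Rep f P M (P.lo (j + 1)) (P.hi (j + 1)) cnt (clean f x'.1 x'.2) str s' ∧
          x'.Good (b + (2 * P.W + 1) * P.L) ∧ s'.nat 16 = j + 1 ∧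
          s'.nat 20 = 65 + 2 * ((j + 1) * P.D) := by
  unfold windowBody
  have hjK := hP.div_le hj.le
  have hjK' := hP.div_le hj
  have hW := hP.W
  have hK := hP.K
  have hm := hP.m
  have hlo : P.lo j ≤ P.hi j := Par.lo_le_hi hjK
  have hhi : P.hi j ≤ P.K := min_le_left _ _
  have hw := levelTime_mono (P.hi_sub_lo j)
  have hl1 := P.lo_succ_le hP.α0 j
  have hl2 := P.lo_le_lo_succ j
  have hl3 := P.hi_sub_lo j
  have hD : j * P.D + P.D ≤ P.m * P.D := by
    have := Nat.mul_le_mul_right P.D hj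
    simpa [Nat.succ_mul] using this
  refine (Sim.seq (B' := (∑ d ∈ range P.D, (blk (j * P.D + d)).length) *
      (levelTime (2 * P.W + 1) + 15) + 10 * P.D + 12 * (2 * P.W + 1) + 60)
    (hLoop_sim hP hlo hhi h (hx.clean f P.L _ _)) ?_).conseq ?_ (fun _ _ h => h)
  · rintro st s1 ⟨a1, a2, a3, a4⟩
    intro Z u K C g hg
    refine Sim.conseq
      (Sim.seq_det (dLoop_sim hP hlo hhi hD a1 hl (a4.trans h20))
      (B' := 12 * (P.hi j - P.lo j) + 44) (R' := fun x' s' =>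
        Rep f P M (P.lo (j + 1)) (P.hi (j + 1)) cnt (clean f x'.1 x'.2) str s' ∧
          x' = finish f P blk j st ∧ s'.nat 16 = j + 1 ∧
          s'.nat 20 = 65 + 2 * ((j + 1) * P.D)) ?_) ?_ ?_ Z u K C g hg
    · rintro s2 ⟨b1, b2, b3⟩
      refine (Sim.seq_det (commitLoop_sim hP hlo hhi b1 (a2.scan _ _ _)) (B' := 40) ?_).conseq
        (by omega) (fun _ _ h => h)
      rintro s3 ⟨c1, c2, c3⟩
      have f16 : s3.nat 16 = j := by rw [c2, b2, a3, h16]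
      have f20 : s3.nat 20 = 65 + 2 * ((j + 1) * P.D) := by
        rw [c3, b3]
        ring
      generalize eN : scan f P.L (P.lo j) (P.hi j) blk (j * P.D) P.D st = st' at c1
      refine (Sim.seq_det (R := fun _ s' => Rep f P M (P.lo j) (P.hi j) cnt
          (clean f st'.N st'.H) str s' ∧ s'.nat 16 = j + 1 ∧
          s'.nat 20 = 65 + 2 * ((j + 1) * P.D) ∧ s'.nat 33 = 64 + 2 * P.lo (j + 1) ∧
          s'.nat 34 = (j + 1) / P.α + P.W + 1) (B := 13) (B' := 25)
        (Sim.eval (by simp [Straight]) ?_ (by simp [psize])) ?_).conseq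
        (by omega) (fun _ _ h => h)
      · generalize hs : evalP f _ s3 = s4
        obtain ⟨rK, rα, rW, rQ, rR1, rstride, rD, rL, r1, r0, r2, r64, rpK, rlo, rhi, rm, rH, v1,
          rS, rN, nv, rtv, rc, rcnt, rIt, short, stream, hpk, hlen⟩ := c1
        simp [f16, r1, rα, rW, r2, r64] at hs
        subst hs
        refine ⟨?_, by simp, by simp [f20], by simp [Par.lo]; ring, by simp⟩
        constructor <;> simp [*]
        change (j + 1) / P.α ≤ P.K at hjK'
        generalize (j + 1) / P.α = q at hjK' ⊢
        omega
      · rintro s4 ⟨d1, d2, d3, d4, d5⟩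
        refine (Sim.seq_det (mergeLoop_sim hP hl2 (Par.lo_le_K hjK') d1 d4)
          (B' := 5) ?_).conseq (by omega) (fun _ _ h => h)
        rintro s5 ⟨e1, e2, e3, e4⟩
        intro Z u K C g hg
        refine setHi_sim hP e1 (e4.trans d5) Z u K C (fun _ => g (finish f P blk j st)) ?_
        rintro _ s6 ⟨i1, i2, i3⟩
        refine hg _ s6 ⟨?_, rfl, by rw [i2, e2, d2], by rw [i3, e3, d3]⟩
        unfold finish
        simp only [eN]
        exact i1
    · have := Nat.mul_le_mul_left (∑ d ∈ range P.D, (blk (j * P.D + d)).length)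
        (Nat.add_le_add_right hw 15)
      omega
    · rintro x' s' ⟨b1, rfl, b3, b4⟩
      exact ⟨b1, a2.finish, b3, b4⟩
  · unfold windowTime
    have := Nat.mul_le_mul_left P.Q (Nat.add_le_add_right hw 11)
    omega

theorem length_segment (blk : ℕ → List (Fin n)) (lab D : ℕ) :
    (segment blk lab D).length = ∑ d ∈ range D, (blk (lab + d)).length := by
  induction D generalizing lab with
  | zero => rfl
  | succ D ih =>
    rw [segment, List.length_append, ih, sum_range_succ']
    simp [add_comm, add_left_comm]

theorem length_segment_mul (blk : ℕ → List (Fin n)) (m D : ℕ) :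
    (segment blk 0 (m * D)).length =
      ∑ j ∈ range m, ∑ d ∈ range D, (blk (j * D + d)).length := by
  induction m with
  | zero => simp [segment]
  | succ m ih =>
    rw [Nat.succ_mul, segment_add, List.length_append, ih, sum_range_succ, length_segment, zero_add]

/-! ### All windows -/

/-- The machine state `s` holds the result `x` of the algorithm. -/
structure Final (f : Finset (Fin n) → ℝ) (P : Par) (M b : ℕ) (x : Cf n) (s : State n) : Prop where
  good : x.Good b
  output : s.output = answer f P x
  short : s.shortlist = x.2.toFinset
  peak : s.peak ≤ M

/-- Running time of the main loop. -/
def mainTime (P : Par) (t : ℕ) : ℕ :=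
  P.m * (P.Q * (levelTime (2 * P.W + 1) + 11) + 10 * P.D + 12 * (2 * P.W + 1) + 71) +
    t * (levelTime (2 * P.W + 1) + 15) + 16 * P.K + 30

/-- The main loop has the law of `windows`, and leaves the answer in set cell `0`. -/
theorem mainLoop_sim {f : Finset (Fin n) → ℝ} {P : Par} {M b : ℕ} {cnt : ℕ → ℕ}
    {blk : ℕ → List (Fin n)} {H : List (Fin n)} {s : State n}
    (hP : P.Bdd M n)
    (h : Rep f P M 0 0 cnt (clean f (fun _ => ∅) H) (segment blk 0 (P.m * P.D)) s)
    (hH : H.length ≤ b) (hl : ∀ l < P.m * P.D, cnt l = (blk l).length)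
    (h20 : s.nat 20 = 65) :
    Sim f mainLoop s (windows f P blk H) (mainTime P (segment blk 0 (P.m * P.D)).length)
      (Final f P M (b + P.m * ((2 * P.W + 1) * P.L))) := by
  unfold mainLoop
  have hW := hP.W
  have hK := hP.K
  have hloK := hP.div_le le_rfl
  have hlo0 : P.lo 0 = 0 := by simp [Par.lo]
  have hhi0 : P.hi 0 = min P.K (P.W + 1) := by simp [Par.hi]
  refine (Sim.seq_det (R := fun _ s' => Rep f P M 0 0 cnt (clean f (fun _ => ∅) H)
      (segment blk 0 (P.m * P.D)) s' ∧ s'.nat 16 = 0 ∧ s'.nat 20 = 65 ∧ s'.nat 34 = P.W + 1)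
    (B := 3) (B' := mainTime P (segment blk 0 (P.m * P.D)).length - 4)
    (Sim.eval (by simp [Straight]) ?_ (by simp [psize])) ?_).conseq
    (by unfold mainTime; omega) (fun _ _ h => h)
  · generalize hs : evalP f _ s = s'
    obtain ⟨rK, rα, rW, rQ, rR1, rstride, rD, rL, r1, r0, r2, r64, rpK, rlo, rhi, rm,
      rH, v1, rS, rN,
      nv, rtv, rc, rcnt, rIt, short, stream, hpk, hlen⟩ := h
    simp [rW, r1] at hs
    subst hs
    refine ⟨?_, by simp, by simp [h20], by simp⟩
    constructor <;> try simp [*]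
    omega
  · rintro s1 ⟨g1, g2, g3, g4⟩
    refine (Sim.seq_det (setHi_sim hP g1 g4) (B' := mainTime P
      (segment blk 0 (P.m * P.D)).length - 10) ?_).conseq
      (by unfold mainTime; omega) (fun _ _ h => h)
    rintro s2 ⟨a1, a2, a3⟩
    have hloop := Sim.loop (f := f) (c := .natLt (.dir 16) (.dir 19)) (p := windowBody) P.m
      (body := window f P blk) (x := (fun _ => ∅, H)) (s := s2)
      (cost := fun j => windowTime P (∑ d ∈ range P.D, (blk (j * P.D + d)).length))
      (R := fun j x' s' => Rep f P M (P.lo j) (P.hi j) cnt (clean f x'.1 x'.2)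
          (segment blk (j * P.D) ((P.m - j) * P.D)) s' ∧
        x'.Good (b + j * ((2 * P.W + 1) * P.L)) ∧ s'.nat 16 = j ∧
        s'.nat 20 = 65 + 2 * (j * P.D)) ?_ ?_ ?_
    · refine Sim.conseq (B := (∑ j ∈ range P.m, (windowTime P (∑ d ∈ range P.D,
        (blk (j * P.D + d)).length) + 1) + 1) + (16 * P.K + 10) + 1) (R := Final f P M _) ?_ ?_
        (fun _ _ h => h)
      · have hb : windows f P blk H = (windows f P blk H).bind Rnd.pure := by
          have hb' : ∀ a : Rnd (Cf n), a = a.bind Rnd.pure := by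
            intro a
            induction a with
            | pure a => rfl
            | rand b k ih => exact congrArg _ (funext ih)
          exact hb' _
        rw [hb]
        refine Sim.seq hloop ?_
        rintro x' s3 ⟨b1, b2, b3, b4⟩
        refine (Sim.seq_det (R := fun _ s' => Rep f P M (P.lo P.m) (P.hi P.m) cnt
            (clean f x'.1 x'.2) [] s' ∧ s'.nat 33 = 64 + 2 * P.K) (B := 1)
          (B' := 16 * P.K + 4) (Sim.eval (by simp [Straight]) ?_ (by simp [psize])) ?_).conseq
          (by omega) (fun _ _ h => h)
        · rw [Nat.sub_self, zero_mul, segment] at b1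
          generalize hs : evalP f _ s3 = s4
          obtain ⟨rK, rα, rW, rQ, rR1, rstride, rD, rL, r1, r0, r2, r64, rpK, rlo, rhi, rm, rH, v1,
            rS, rN, nv, rtv, rc, rcnt, rIt, short, stream, hpk, hlen⟩ := b1
          simp [rpK, r0] at hs
          subst hs
          refine ⟨?_, by simp⟩
          constructor <;> simp [*]
          · omega
          · simpa using hlen
        · rintro s4 ⟨c1, c2⟩
          intro Z u Kc C g hg
          refine (Sim.seq_det (mergeLoop_sim hP (Par.lo_le_K hloK) le_rfl c1 c2) (B' := 1)
            (R' := fun y s' => Final f P M (b + P.m * ((2 * P.W + 1) * P.L)) x' s') (b := .pure ())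
            ?_).conseq ?_ (fun _ s' h => h) Z u Kc C (fun _ => g x') (fun _ => hg x')
          · rintro s5 ⟨d1, d2, d3, d4⟩
            refine Sim.eval (by simp [Straight]) ?_ (by simp [psize])
            refine ⟨b2, ?_, ?_, ?_⟩
            · simp [State.output, d1.rpK, d1.S, answer, clean]
            · simpa [clean] using d1.short
            · simpa using d1.peak
          · omega
      · unfold mainTime windowTime
        rw [length_segment_mul]
        simp only [sum_add_distrib, sum_const, card_range, smul_eq_mul, ← sum_mul]
        refine le_of_eq_of_le (b := P.m * (P.Q * (levelTime (2 * P.W + 1) + 11) + 10 * P.D +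
          12 * (2 * P.W + 1) + 71) + (∑ j ∈ range P.m, ∑ d ∈ range P.D,
          (blk (j * P.D + d)).length) * (levelTime (2 * P.W + 1) + 15) + 16 * P.K + 12) ?_ ?_
        · ring
        · omega
    · rintro j hj x' s3 ⟨b1, b2, b3, b4⟩
      refine ⟨by simp [b3, b1.rm, hj], ?_⟩
      rw [show P.m - j = 1 + (P.m - (j + 1)) by omega, add_mul, one_mul, segment_add,
        show j * P.D + P.D = (j + 1) * P.D by ring] at b1
      refine (windowBody_sim hP hj b1 b2 hl b3 b4).conseq le_rfl ?_
      rintro y s4 ⟨c1, c2, c3, c4⟩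
      refine ⟨c1, ?_, c3, c4⟩
      rwa [add_mul, one_mul, ← add_assoc]
    · rintro x' s3 ⟨b1, b2, b3, b4⟩
      simp [b3, b1.rm]
    · rw [hlo0, hhi0]
      refine ⟨by simpa using a1, ⟨by simp, by simp, by simpa using hH⟩, by rw [a2, g2], ?_⟩
      rw [a3, g3]
      simp

end ShortlistSecretary

namespace ShortlistSecretary

open Code

variable {n : ℕ}

attribute [local simp] addr_even_ne addr_odd_ne addr_ne_even addr_ne_odd addr_even_ne_odd
  addr_odd_ne_even addr_next addr_odd evalP code detExec State.setNat State.setVal State.setSet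
  State.setItem State.getNat State.getVal State.getSet State.getItem State.addr NatOp.eval
  Cond.Holds Function.update_apply

/-! ### Set-up -/

/-- Parameters of the algorithm when the items are to be selected while they arrive. -/
def streamPar (α W Q D L k : ℕ) : Par := ⟨k, α, W, Q, α * k - 1, α * k, D, L, α * k⟩

/-- Parameters of the algorithm when all items are put on the shortlist. -/
def keepPar (L k n : ℕ) : Par := ⟨min k n, 1, 0, n * L / min k n + 1, n - 1, 0, 0, L, min k n⟩

/-- Draw `N` labels from `{0, …, b}`. -/
def labels (b N : ℕ) : Rnd (List ℕ) :=
  Rnd.iter N (fun _ l => .rand b fun a => .pure (a.val :: l)) []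

/-- The block of the label `lab` if the items of `str` are cut into blocks whose lengths are the
frequencies of the labels in `l`. -/
def blocks (str : List (Fin n)) (l : List ℕ) (lab : ℕ) : List (Fin n) :=
  (str.drop (∑ i ∈ range lab, l.count i)).take (l.count lab)

theorem segment_blocks (str : List (Fin n)) (l : List ℕ) (N : ℕ) :
    segment (blocks str l) 0 N = str.take (∑ i ∈ range N, l.count i) := by
  induction N with
  | zero => simp [segment]
  | succ N ih =>
    rw [segment_add, ih, sum_range_succ, List.take_add, zero_add]
    simp [segment, blocks]

theorem sum_count_eq_length {l : List ℕ} {N : ℕ} (h : ∀ a ∈ l, a < N) :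
    ∑ i ∈ range N, l.count i = l.length := by
  induction l with
  | nil => simp
  | cons a l ih =>
    simp only [List.mem_cons, forall_eq_or_imp] at h
    simp only [List.count_cons, sum_add_distrib, ih h.2, List.length_cons, beq_iff_eq]
    rw [sum_ite_eq, if_pos (mem_range.2 h.1)]

theorem length_blocks {str : List (Fin n)} {l : List ℕ} {N lab : ℕ} (h : ∀ a ∈ l, a < N)
    (hstr : str.length = l.length) (hlab : lab < N) :
    (blocks str l lab).length = l.count lab := by
  have h1 : ∑ i ∈ range (lab + 1), l.count i ≤ ∑ i ∈ range N, l.count i :=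
    sum_le_sum_of_subset (range_subset_range.2 hlab)
  rw [sum_count_eq_length h, sum_range_succ] at h1
  simp only [blocks, List.length_take, List.length_drop]
  omega

/-- The machine after the first instructions of the program. -/
structure Ready (f : Finset (Fin n) → ℝ) (α W Q D L k M : ℕ) (str : List (Fin n)) (s : State n) :
    Prop where
  n0 : s.nat 0 = n
  n1 : s.nat 1 = k
  rα : s.nat 3 = α
  rW : s.nat 4 = W
  rQ : s.nat 5 = Q
  rD : s.nat 8 = D
  rL : s.nat 9 = L
  r1 : s.nat 10 = 1
  r0 : s.nat 11 = 0
  r2 : s.nat 12 = 2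
  r64 : s.nat 13 = 64
  r20 : s.nat 20 = 65
  r21 : s.nat 21 = 1
  r33 : s.nat 33 = α * k
  r34 : s.nat 34 = α * k * Q
  v1 : s.val 1 = f ∅
  even : ∀ ℓ, s.nat (64 + 2 * ℓ) = 0
  odd : ∀ ℓ, s.nat (65 + 2 * ℓ) = 0
  veven : ∀ ℓ, s.val (64 + 2 * ℓ) = 0
  vodd : ∀ ℓ, s.val (65 + 2 * ℓ) = 0
  set : ∀ a, s.set a = ∅
  item : ∀ a, s.item a = none
  short : s.shortlist = ∅
  stream : s.stream = str
  peak : s.peak ≤ M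

/-- The set-up draws `n` labels and counts how often each occurs; the next items of the stream get
the labels in increasing order. -/
theorem streamSetup_sim {f : Finset (Fin n) → ℝ} {α W Q D L k M : ℕ} {str : List (Fin n)}
    {s : State n} (hP : (streamPar α W Q D L k).Bdd M n) (hm : 0 < α * k * D)
    (hs : str.length = n) (h : Ready f α W Q D L k M str s) :
    Sim f streamSetup s (labels (α * k * D - 1) n) (14 * n + 30) fun l s' =>
      Rep f (streamPar α W Q D L k) M 0 0 (fun a => l.count a) (clean f (fun _ => ∅) []) str s' ∧
        s'.nat 20 = 65 ∧ l.length = n ∧ ∀ a ∈ l, a < α * k * D := by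
  unfold streamSetup
  have hB := hP
  obtain ⟨bK, bW, bα, bQ, bH, bD, blab, bL, bm, bn, bmK, bα0⟩ := hB
  simp only [streamPar] at bK bW bα bQ bH bD blab bL bm bn
  clear bmK
  refine (Sim.seq_det (R := fun _ s' => Rep f (streamPar α W Q D L k) M 0 0 (fun a => 0)
      (clean f (fun _ => ∅) []) str s' ∧ s'.nat 0 = n ∧ s'.nat 20 = 65 ∧
      s'.nat 33 = α * k * D - 1 ∧ s'.nat 24 = 0) (B := 21)
      (B' := ∑ i ∈ range n, (12 + 1) + 1)
    (Sim.eval (by simp [Straight]) ?_ (by simp [psize])) ?_).conseq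
    (by simp; omega) (fun _ _ h => h)
  · generalize hs : evalP f _ s = s'
    obtain ⟨n0, n1, rα, rW, rQ, rD, rL, r1, r0, r2, r64, r20, r21, r33, r34, v1, even, odd, veven,
      vodd, set, item, short, stream, peak⟩ := h
    simp [n1, r0, r2, r64, r33, r1, rD] at hs
    subst hs
    refine ⟨?_, by simp [n0], by simp [r20], by simp, by simp⟩
    constructor <;> simp [*, streamPar, clean]
    all_goals omega
  · rintro s1 ⟨g1, g2, g3, g4, g5⟩
    refine (Sim.loop (f := f) n (cost := fun _ => 12)
      (R := fun i l s' => Rep f (streamPar α W Q D L k) M 0 0 (fun a => l.count a)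
        (clean f (fun _ => ∅) []) str s' ∧ s'.nat 0 = n ∧ s'.nat 20 = 65 ∧
        s'.nat 33 = α * k * D - 1 ∧ s'.nat 24 = i ∧ l.length = i ∧ ∀ a ∈ l, a < α * k * D)
      ?_ ?_ ⟨by simpa using g1, g2, g3, g4, g5, rfl, by simp⟩).conseq le_rfl ?_
    · rintro i hi l s2 ⟨a1, a2, a3, a4, a5, a6, a7⟩
      refine ⟨by simp [a5, a2, hi], ?_⟩
      refine (Sim.seq (X := ℕ) (R := fun x s3 => x ≤ α * k * D - 1 ∧ s3 = s2.setNat (.dir 28) x)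
        (B := 1) (B' := 9) (b := fun x => .pure (x :: l))
        (Sim.rand (a := id) (m := α * k * D - 1) (by simpa using a4) ?_) ?_).conseq
        (by omega) (fun _ _ h => h)
      · exact fun i hi => ⟨hi, rfl⟩
      · rintro x s3 ⟨hx, rfl⟩
        refine Sim.eval (by simp [Straight]) ?_ (by simp [psize])
        generalize hs : evalP f _ _ = s4
        have hcl : l.count x ≤ n := (List.count_le_length).trans (by omega)
        obtain ⟨rK, rα, rW, rQ, rR1, rstride, rD, rL, r1, r0, r2, r64, rpK, rlo, rhi, rm,
          rH, v1, rS,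
          rN, nv, rtv, rc, rcnt, rIt, short, stream, hpk, hlen⟩ := a1
        have e1 : 1 + (x * 2 + 64) = 65 + 2 * x := by ring
        have e2 : x * 2 + 64 + 1 = 65 + 2 * x := by ring
        simp [r2, r64, r1, a5, e1, e2, rcnt] at hs
        subst hs
        refine ⟨?_, by simp [a2], by simp [a3], by simp [a4], by simp, by simp [a6], ?_⟩
        · constructor <;> simp [*]
          · intro l'
            by_cases hq : l' = x
            · subst hq; simp
            · rw [if_neg hq, List.count_cons_of_ne (Ne.symm hq)]
          · omega
          · rfl
        · intro a ha
          rcases List.mem_cons.1 ha with rfl | ha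
          · omega
          · exact a7 a ha
    · rintro l s2 ⟨a1, a2, a3, a4, a5, a6, a7⟩
      simp [a5, a2]
    · rintro l s2 ⟨a1, a2, a3, a4, a5, a6, a7⟩
      exact ⟨a1, a3, a6, a7⟩

set_option maxHeartbeats 2000000 in
theorem keepSetup_sim {f : Finset (Fin n) → ℝ} {α W Q D L k M : ℕ} {str : List (Fin n)}
    {s : State n} (hP : (keepPar L k n).Bdd M n) (hk : 0 < k) (hn : 0 < n) (hM : n * L ≤ M)
    (hs : str.length = n) (h : Ready f α W Q D L k M str s) :
    Sim f keepSetup s (.pure ()) (10 * n + 40) fun _ s' =>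
      Rep f (keepPar L k n) M 0 0 (fun _ => 0) (clean f (fun _ => ∅) str) [] s' ∧
        s'.nat 20 = 65 := by
  unfold keepSetup
  have hB := hP
  obtain ⟨bK, bW, bα, bQ, bH, bD, blab, bL, bm, bn, bmK, bα0⟩ := hB
  simp only [keepPar] at bK bW bα bQ bH bD blab bL bm bn
  clear bmK
  have hmin : 0 < min k n := lt_min hk hn
  refine (Sim.seq_det (R := fun _ s' => Rep f (keepPar L k n) M 0 0 (fun _ => 0)
      (clean f (fun _ => ∅) []) str s' ∧ s'.nat 0 = n ∧ s'.nat 20 = 65 ∧ s'.nat 24 = 0) (B := 31)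
      (B' := ∑ i ∈ range n, (9 + 1) + 1)
    (Sim.eval (by simp [Straight]) ?_ (by simp [psize])) ?_).conseq
    (by simp; omega) (fun _ _ h => h)
  · generalize hs : evalP f _ s = s'
    obtain ⟨n0, n1, rα, rW, rQ, rD, rL, r1, r0, r2, r64, r20, r21, r33, r34, v1, even, odd, veven,
      vodd, set, item, short, stream, peak⟩ := h
    by_cases hkn : k < n
    · rw [min_eq_left hkn.le] at *
      simp [n0, n1, r0, r1, r2, r64, rL, hkn] at hs
      subst hs
      refine ⟨?_, by simp [n0], by simp [r20], by simp⟩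
      constructor <;> simp [*, keepPar, clean, min_eq_left hkn.le]
      all_goals omega
    · have hL' : n * L / n = L := Nat.mul_div_cancel_left L hn
      rw [min_eq_right (not_lt.1 hkn)] at *
      simp [n0, n1, r0, r1, r2, r64, rL, hkn] at hs
      subst hs
      refine ⟨?_, by simp [n0], by simp [r20], by simp⟩
      constructor <;> simp [*, keepPar, clean, min_eq_right (not_lt.1 hkn)]
      all_goals omega
  · rintro s1 ⟨g1, g2, g3, g4⟩
    refine (Sim.loop_det (f := f) n (cost := fun _ => 9)
      (R := fun i s' => Rep f (keepPar L k n) M 0 0 (fun _ => 0)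
        (clean f (fun _ => ∅) (str.take i)) (str.drop i) s' ∧ s'.nat 0 = n ∧ s'.nat 20 = 65 ∧
        s'.nat 24 = i)
      ?_ ?_ ⟨by simpa using g1, g2, g3, g4⟩).conseq le_rfl ?_
    · rintro i hi s2 ⟨a1, a2, a3, a4⟩
      refine ⟨by simp [a4, a2, hi], ?_⟩
      refine Sim.eval (by simp [Straight, receiveBody]) ?_ (by simp [psize, receiveBody])
      have hs' := hs
      clear hs
      generalize hs : evalP f _ _ = s4
      have hi' : i < str.length := by omega
      obtain ⟨rK, rα, rW, rQ, rR1, rstride, rD, rL, r1, r0, r2, r64, rpK, rlo, rhi, rm,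
          rH, v1, rS,
        rN, nv, rtv, rc, rcnt, rIt, short, stream, hpk, hlen⟩ := a1
      have hH : (clean f (fun _ => ∅) (str.take i)).H = str.take i := rfl
      rw [hH] at rH rIt short hlen
      rw [List.length_take, min_eq_left hi'.le] at rH
      have hT : str.take (i + 1) = str.take i ++ [str[i]] := List.take_succ_eq_append_getElem hi'
      have hln : (str.take i).length = i := by simp; omega
      have hdl : (str.drop (i + 1)).length = n - (i + 1) := by simp [hs']
      rw [List.drop_eq_getElem_cons hi'] at stream
      rw [hT]
      simp only [clean] at rS rN nv rtv rc
      clear hH hP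
      generalize str.take i = l at *
      generalize str[i] = y at *
      generalize str.drop (i + 1) = rest at *
      simp [receiveBody, stream, rH, r1, a4] at hs
      subst hs
      refine ⟨?_, by simp [a2], by simp [a3], by simp⟩
      constructor <;> simp only [clean] <;> try simp [*]
      · intro h
        rcases lt_trichotomy h i with hlt | rfl | hlt
        · rw [if_neg hlt.ne, List.getElem?_append_left (by omega)]
        · rw [if_pos rfl, List.getElem?_append_right (by omega)]
          simp [hln]
        · rw [if_neg hlt.ne', List.getElem?_eq_none (by omega),
            List.getElem?_eq_none (by simp; omega)]
      · ext z
        simp [tokenSet, or_comm, eq_comm]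
      · omega
    · rintro s2 ⟨a1, a2, a3, a4⟩
      simp [a4, a2]
    · rintro _ s2 ⟨a1, a2, a3, a4⟩
      rw [List.take_of_length_le hs.le, List.drop_of_length_le hs.le] at a1
      exact ⟨a1, a3⟩

end ShortlistSecretary

namespace ShortlistSecretary

open Code

variable {n : ℕ}

attribute [local simp] addr_even_ne addr_odd_ne addr_ne_even addr_ne_odd addr_even_ne_odd
  addr_odd_ne_even addr_next addr_odd evalP code detExec State.setNat State.setVal State.setSet
  State.setItem State.getNat State.getVal State.getSet State.getItem State.addr NatOp.eval
  Cond.Holds Function.update_apply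

/-- The first instructions of the program. -/
theorem ready_sim {f : Finset (Fin n) → ℝ} {α W Q D L k M : ℕ} {Pr : Prog}
    (hM : α ≤ M ∧ W ≤ M ∧ Q ≤ M ∧ D ≤ M ∧ L ≤ M ∧ 65 ≤ M ∧ α * k ≤ M ∧ α * k * Q ≤ M)
    (σ : Equiv.Perm (Fin n)) :
    Sim f (code [.const (.dir 10) 1, .const (.dir 12) 2, .const (.dir 13) 64, .const (.dir 3) α,
      .const (.dir 4) W, .const (.dir 9) L, .const (.dir 8) D, .const (.dir 5) Q,
      mul (.dir 33) (.dir 3) (.dir 1), mul (.dir 34) (.dir 33) (.dir 5), .query (.dir 1) (.dir 0),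
      .const (.dir 21) 1, .const (.dir 20) 65]) (initial Pr n k σ) (.pure ()) 25
      fun _ s' => Ready f α W Q D L k M (List.ofFn σ) s' := by
  refine Sim.eval (by simp [Straight]) ?_ (by simp [psize])
  generalize hs : evalP f _ _ = s'
  simp [initial] at hs
  subst hs
  constructor <;> simp [*]

theorem program_sim_stream {f : Finset (Fin n) → ℝ} {α W Q D L k M : ℕ} {Pr : Prog}
    (hP : (streamPar α W Q D L k).Bdd M n) (hm : 0 < α * k * D) (hn : α * k * Q ≤ n)
    (σ : Equiv.Perm (Fin n)) :
    Sim f (program α W Q D L) (initial Pr n k σ)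
      ((labels (α * k * D - 1) n).bind fun l =>
        windows f (streamPar α W Q D L k) (blocks (List.ofFn σ) l) [])
      (mainTime (streamPar α W Q D L k) n + 14 * n + 100)
      (Final f (streamPar α W Q D L k) M (α * k * ((2 * W + 1) * L))) := by
  have hB := hP
  obtain ⟨bK, bW, bα, bQ, bH, bD, blab, bL, bm, bn, bmK, bα0⟩ := hB
  simp only [streamPar] at bK bW bα bQ bH bD blab bL bm bn
  unfold program
  refine (Sim.seq_det (ready_sim (M := M) ⟨by omega, by omega, by omega, by omega, by omega,
    by omega, by omega, by omega⟩ σ)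
    (B' := mainTime (streamPar α W Q D L k) n + 14 * n + 50) ?_).conseq
    (by omega) (fun _ _ h => h)
  intro s1 h1
  refine (Sim.seq (B' := mainTime (streamPar α W Q D L k) n) (Sim.ite (B := 14 * n + 30)
    (fun hc => ?_) (fun hc => streamSetup_sim hP hm (by simp) h1)) ?_).conseq
    (by omega) (fun _ _ h => h)
  · exfalso
    simp [h1.n0, h1.r34] at hc
    omega
  · rintro l s2 ⟨a1, a2, a3, a4⟩
    have hseg : segment (blocks (List.ofFn σ) l) 0 (α * k * D) = List.ofFn σ := by
      rw [segment_blocks, sum_count_eq_length a4, a3]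
      exact List.take_of_length_le (by simp)
    have hmn : (streamPar α W Q D L k).m * (streamPar α W Q D L k).D = α * k * D := rfl
    have h2 := mainLoop_sim (blk := blocks (List.ofFn σ) l) (b := 0) (H := []) hP
      (by rw [hmn, hseg]; exact a1) (by simp)
      (fun i hi => (length_blocks a4 (by simp [a3]) hi).symm) a2
    rw [hmn, hseg, List.length_ofFn, zero_add] at h2
    exact h2

theorem program_sim_keep {f : Finset (Fin n) → ℝ} {α W Q D L k M : ℕ} {Pr : Prog}
    (hP : (keepPar L k n).Bdd M n) (hk : 0 < k) (h0 : 0 < n) (hn : n < α * k * Q)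
    (hM : α ≤ M ∧ W ≤ M ∧ Q ≤ M ∧ D ≤ M ∧ L ≤ M ∧ 65 ≤ M ∧ α * k ≤ M ∧ α * k * Q ≤ M)
    (hL : n * L ≤ M) (σ : Equiv.Perm (Fin n)) :
    Sim f (program α W Q D L) (initial Pr n k σ)
      (windows f (keepPar L k n) (fun _ => []) (List.ofFn σ))
      (mainTime (keepPar L k n) 0 + 10 * n + 100)
      (Final f (keepPar L k n) M (n + min k n * L)) := by
  unfold program
  refine (Sim.seq_det (ready_sim hM σ)
    (B' := mainTime (keepPar L k n) 0 + 10 * n + 50) ?_).conseq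
    (by omega) (fun _ _ h => h)
  intro s1 h1
  refine (Sim.seq_det (B' := mainTime (keepPar L k n) 0) (Sim.ite (B := 10 * n + 40)
    (fun hc => keepSetup_sim hP hk h0 hL (by simp) h1) (fun hc => ?_)) ?_).conseq
    (by omega) (fun _ _ h => h)
  · exfalso
    simp [h1.n0, h1.r34] at hc
    omega
  · rintro s2 ⟨a1, a2⟩
    have h2 := mainLoop_sim (P := keepPar L k n) (blk := fun _ => []) (b := n)
      (H := List.ofFn σ) hP a1 (by simp)
      (fun i hi => by simp) a2
    simpa [keepPar, segment] using h2

theorem Res.of_halted {f : Finset (Fin n) → ℝ} {Z : State n → Prop} {u : State n → ℝ}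
    {s : State n} (h : Z (s.withTodo [])) {e : ℝ} (he : e ≤ u (s.withTodo [])) :
    Res f Z u (s.withTodo []) 0 e := by
  rintro N -
  have h1 : steps f N (s.withTodo []) = PMF.pure (s.withTodo []) := by
    induction N with
    | zero => rfl
    | succ N ih =>
      rw [steps]
      change (PMF.pure (s.withTodo [])).bind (steps f N) = _
      rw [PMF.pure_bind, ih]
  rw [h1]
  refine ⟨fun x hx => ?_, by rwa [expectation_pure]⟩
  rw [PMF.support_pure, Set.mem_singleton_iff] at hx
  subst hx
  exact ⟨rfl, h⟩

/-- What a verified program achieves when started in the initial state. -/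
theorem Sim.res {f : Finset (Fin n) → ℝ} {P : Par} {M b k T : ℕ} {Pr : Prog} {a : Rnd (Cf n)}
    {σ : Equiv.Perm (Fin n)} (h : Sim f Pr (initial Pr n k σ) a T (Final f P M b)) :
    Res f (fun s => ∃ x, Final f P M b x s) (fun s => f s.output) (initial Pr n k σ) T
      (a.E fun x => f (answer f P x)) := by
  refine h _ _ [] 0 _ fun x s' hx => ?_
  refine Res.of_halted ⟨x, hx.1, hx.2, hx.3, hx.4⟩ ?_
  have : (s'.withTodo []).output = answer f P x := hx.2
  rw [this]

theorem answer_good {f : Finset (Fin n) → ℝ} {P : Par} {b : ℕ} {x : Cf n} (hx : x.Good b) :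
    (answer f P x).card ≤ P.K ∧ answer f P x ⊆ x.2.toFinset := by
  have h := mergeUp_good (f := f) (P.lo P.m) (P.K - P.lo P.m) hx
  exact ⟨h.card _, h.sub _⟩

end ShortlistSecretary

namespace ShortlistSecretary

variable {n : ℕ}

/-! ### Random order and random labels -/

theorem E_iter_rand {X : Type} (N b : ℕ) (u : ℕ → ℕ → X → X) (x : X) (g : X → ℝ) :
    (Rnd.iter N (fun i x => .rand b fun h => .pure (u i h x)) x).E g =
      (∑ s : Fin N → Fin (b + 1),
        g ((List.ofFn fun i : Fin N => u i (s i)).foldl (fun x φ => φ x) x)) / (b + 1) ^ N := by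
  induction N generalizing u x with
  | zero => simp [Rnd.iter]
  | succ N ih =>
    have h1 : ∀ y, (Rnd.iter N (fun i x => .rand b fun h => .pure (u (i + 1) h x)) y).E g = _ :=
      fun y => ih (fun i => u (i + 1)) y
    rw [Rnd.iter, Rnd.E_bind]
    simp only [Rnd.E_rand, Rnd.E_pure, h1]
    rw [← (Fin.consEquiv fun _ => Fin (b + 1)).sum_comp, Fintype.sum_prod_type, ← Finset.sum_div,
      div_div, pow_succ]
    simp [List.ofFn_succ, Fin.consEquiv]

theorem E_labels (b N : ℕ) (g : List ℕ → ℝ) :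
    (labels b N).E g =
      (∑ s : Fin N → Fin (b + 1), g (List.ofFn fun i => (s i : ℕ)).reverse) / (b + 1) ^ N := by
  have h := E_iter_rand N b (fun _ h l => h :: l) [] g
  have h2 : ∀ (l : List ℕ) (a : List ℕ), (l.map fun h l => h :: l).foldl (fun x φ => φ x) a =
      l.reverse ++ a := by
    intro l
    induction l with
    | nil => simp
    | cons h l ih => simp [ih]
  unfold labels
  rw [h]
  congr 1
  refine sum_congr rfl fun s _ => ?_
  congr 1
  have h3 := h2 (List.ofFn fun i => (s i : ℕ)) []
  rw [List.append_nil, List.map_ofFn] at h3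
  exact h3

theorem segment_map {n' : ℕ} (ρ : Fin n → Fin n') (b : ℕ → List (Fin n)) (lab N : ℕ) :
    (segment b lab N).map ρ = segment (fun i => (b i).map ρ) lab N := by
  induction N generalizing lab with
  | zero => rfl
  | succ N ih => simp [segment, ih]

theorem blocks_segment {b : ℕ → List (Fin n)} {l : List ℕ} {N lab : ℕ}
    (h : ∀ i < N, (b i).length = l.count i) (hlab : lab < N) :
    blocks (segment b 0 N) l lab = b lab := by
  have h1 : (segment b 0 lab).length = ∑ i ∈ range lab, l.count i := by
    rw [length_segment]
    refine sum_congr rfl fun i hi => ?_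
    rw [zero_add, h i ((mem_range.1 hi).trans hlab)]
  obtain ⟨t, rfl⟩ : ∃ t, N = lab + (t + 1) := ⟨N - lab - 1, by omega⟩
  rw [segment_add, zero_add, segment, blocks, ← h1, List.drop_left, ← h lab hlab, List.take_left]

theorem exists_perm_ofFn {l : List (Fin n)} (hl : l.length = n) (hd : l.Nodup) :
    ∃ π : Equiv.Perm (Fin n), List.ofFn π = l := by
  have hinj : Function.Injective fun i : Fin n => l.get (i.cast hl.symm) :=
    hd.injective_get.comp (Fin.cast_injective _)
  refine ⟨Equiv.ofBijective _ (Finite.injective_iff_bijective.1 hinj), ?_⟩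
  refine List.ext_get (by simp [hl]) fun i h1 h2 => ?_
  simp

theorem count_segment (b : ℕ → List (Fin n)) (lab N : ℕ) (e : Fin n) :
    (segment b lab N).count e = ∑ i ∈ range N, (b (lab + i)).count e := by
  induction N generalizing lab with
  | zero => rfl
  | succ N ih =>
    rw [segment, List.count_append, ih, sum_range_succ']
    simp [add_comm, add_left_comm]

/-- Cutting the randomly ordered items into blocks with random lengths is the same as giving random
labels to the items. -/
theorem sum_perm_blocks (B : ℕ) (G : (ℕ → List (Fin n)) → ℝ) :
    ∑ σ : Equiv.Perm (Fin n), ∑ w : Fin n → Fin B,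
        G (blocks (List.ofFn σ) (List.ofFn fun i => (w i : ℕ)).reverse) =
      ∑ ρ : Equiv.Perm (Fin n), ∑ w : Fin n → Fin B,
        G fun lab => (List.ofFn ρ).filter fun e => decide ((w e : ℕ) = lab) := by
  -- `π` sorts the positions by their labels
  have key : ∀ w : Fin n → Fin B, ∃ π : Equiv.Perm (Fin n), ∀ ρ : Equiv.Perm (Fin n),
      blocks (List.ofFn (ρ * π : Equiv.Perm (Fin n))) (List.ofFn fun i => (w i : ℕ)).reverse =
        fun lab => (List.ofFn ρ).filter fun e => decide ((w (ρ.symm e) : ℕ) = lab) := by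
    intro w
    let b : ℕ → List (Fin n) := fun lab =>
      (List.finRange n).filter fun i => decide ((w i : ℕ) = lab)
    have hb : ∀ lab, (b lab).length = (List.ofFn fun i => (w i : ℕ)).reverse.count lab := by
      intro lab
      rw [List.count_reverse, List.ofFn_eq_map, List.count_eq_countP, List.countP_map,
        List.countP_eq_length_filter]
      congr 2
    have hlen : (segment b 0 B).length = n := by
      rw [length_segment]
      simp only [hb, zero_add]
      rw [sum_count_eq_length]
      · simp
      · intro a ha
        simp only [List.mem_reverse, List.mem_ofFn] at ha
        obtain ⟨i, rfl⟩ := ha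
        exact (w i).isLt
    have hnd : (segment b 0 B).Nodup := by
      rw [List.nodup_iff_count_le_one]
      intro e
      rw [count_segment]
      have h1 : ∀ i, (b (0 + i)).count e = if (w e : ℕ) = i then 1 else 0 := by
        intro i
        rw [zero_add]
        split_ifs with h
        · rw [List.count_filter (by simpa using h)]
          exact List.count_eq_one_of_mem (List.nodup_finRange n) (List.mem_finRange e)
        · rw [List.count_eq_zero]
          simp [b, h]
      simp only [h1, sum_ite_eq]
      split_ifs <;> omega
    obtain ⟨π, hπ⟩ := exists_perm_ofFn hlen hnd
    refine ⟨π, fun ρ => ?_⟩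
    have h1 : List.ofFn (ρ * π : Equiv.Perm (Fin n)) = segment (fun i => (b i).map ρ) 0 B := by
      rw [← segment_map, ← hπ, List.map_ofFn]
      rfl
    have h2 : ∀ lab, (b lab).map ρ =
        (List.ofFn ρ).filter fun e => decide ((w (ρ.symm e) : ℕ) = lab) := by
      intro lab
      rw [List.ofFn_eq_map, List.filter_map]
      simp [b, Function.comp_def]
    funext lab
    rw [h1]
    by_cases hlab : lab < B
    · rw [blocks_segment (fun i _ => by rw [List.length_map, hb]) hlab, h2]
    · rw [← h2, blocks, ← hb]
      have : b lab = [] := by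
        rw [List.filter_eq_nil_iff]
        intro i _
        have := (w i).isLt
        simp
        omega
      simp [this]
  choose π hπ using key
  rw [sum_comm]
  have h1 : ∀ w : Fin n → Fin B, ∑ σ : Equiv.Perm (Fin n),
      G (blocks (List.ofFn σ) (List.ofFn fun i => (w i : ℕ)).reverse) =
      ∑ ρ : Equiv.Perm (Fin n),
        G fun lab => (List.ofFn ρ).filter fun e => decide ((w (ρ.symm e) : ℕ) = lab) := by
    intro w
    rw [← Equiv.sum_comp (Equiv.mulRight (π w))]
    refine sum_congr rfl fun ρ _ => ?_
    rw [Equiv.coe_mulRight, hπ w ρ]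
  simp only [h1]
  rw [sum_comm]
  refine sum_congr rfl fun ρ _ => ?_
  exact Equiv.sum_comp (ρ.arrowCongr (Equiv.refl (Fin B))) fun w : Fin n → Fin B =>
    G fun lab => (List.ofFn ρ).filter fun e => decide ((w e : ℕ) = lab)

theorem sum_fin_eq_sum_piFinset {ι : Type} [Fintype ι] [DecidableEq ι] (B : ℕ)
    (F : (ι → ℕ) → ℝ) :
    ∑ w : ι → Fin B, F (fun e => w e) = ∑ W ∈ Fintype.piFinset fun _ : ι => range B, F W := by
  refine sum_bij' (fun w _ e => (w e : ℕ))
    (fun W hW e => ⟨W e, mem_range.1 (Fintype.mem_piFinset.1 hW e)⟩) ?_ ?_ ?_ ?_ ?_ <;> simp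

end ShortlistSecretary

namespace ShortlistSecretary

variable {n : ℕ}

/-! ### Sums over product sets -/

section Product

variable {ι : Type} [Fintype ι] [DecidableEq ι]

/-- Resampling one coordinate of a random element of a product set. -/
theorem card_mul_sum_piFinset (A : ι → Finset ℕ) (e : ι) (F : (ι → ℕ) → ℝ) :
    (A e).card * ∑ W ∈ Fintype.piFinset A, F W =
      ∑ W ∈ Fintype.piFinset A, ∑ a ∈ A e, F (Function.update W e a) := by
  have h1 : ((A e).card : ℝ) * ∑ W ∈ Fintype.piFinset A, F W =
      ∑ p ∈ Fintype.piFinset A ×ˢ A e, F p.1 := by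
    rw [sum_product]
    simp [mul_sum]
  rw [h1, ← sum_product (f := fun p : (ι → ℕ) × ℕ => F (Function.update p.1 e p.2))]
  refine sum_nbij' (fun p => (Function.update p.1 e p.2, p.1 e))
    (fun p => (Function.update p.1 e p.2, p.1 e)) ?_ ?_ ?_ ?_ ?_
  · rintro ⟨W, a⟩ h
    rw [mem_product, Fintype.mem_piFinset] at h
    rw [mem_product, Fintype.mem_piFinset]
    refine ⟨fun i => ?_, h.1 e⟩
    by_cases hi : i = e
    · subst hi
      simpa using h.2
    · simpa [hi] using h.1 i
  · rintro ⟨W, a⟩ h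
    rw [mem_product, Fintype.mem_piFinset] at h
    rw [mem_product, Fintype.mem_piFinset]
    refine ⟨fun i => ?_, h.1 e⟩
    by_cases hi : i = e
    · subst hi
      simpa using h.2
    · simpa [hi] using h.1 i
  · rintro ⟨W, a⟩ _
    simp
  · rintro ⟨W, a⟩ _
    simp
  · rintro ⟨W, a⟩ _
    simp

open Classical in
theorem card_mul_sum_mem (A : ι → Finset ℕ) (e : ι) {J : Finset ℕ} (hJ : J ⊆ A e)
    {F : (ι → ℕ) → ℝ} (hF : ∀ W a, F (Function.update W e a) = F W) :
    (A e).card * ∑ W ∈ Fintype.piFinset A, (if W e ∈ J then F W else 0) =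
      J.card * ∑ W ∈ Fintype.piFinset A, F W := by
  rw [card_mul_sum_piFinset, mul_sum]
  refine sum_congr rfl fun W _ => ?_
  simp only [Function.update_self, hF]
  rw [← sum_filter, filter_mem_eq_inter, inter_eq_right.2 hJ, sum_const, nsmul_eq_mul]

open Classical in
theorem card_mul_card_mul_sum_mem (A : ι → Finset ℕ) {e e' : ι} (he : e ≠ e') {J J' : Finset ℕ}
    (hJ : J ⊆ A e) (hJ' : J' ⊆ A e') :
    (A e).card * ((A e').card * ∑ W ∈ Fintype.piFinset A,
      (if W e ∈ J then (1 : ℝ) else 0) * (if W e' ∈ J' then 1 else 0)) =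
      J.card * (J'.card * (Fintype.piFinset A).card) := by
  have h1 := card_mul_sum_mem A e hJ (F := fun W => if W e' ∈ J' then 1 else 0)
    (fun W a => by simp [he.symm])
  have h2 := card_mul_sum_mem A e' hJ' (F := fun _ => 1) (fun _ _ => rfl)
  simp only [sum_const, nsmul_eq_mul, mul_one] at h2
  simp only [ite_mul, one_mul, zero_mul]
  rw [mul_left_comm, h1, mul_left_comm, h2]

end Product

/-! ### The random labels of a window -/

/-- The item `e ≠ o` has a label in the window with the labels `lab, …, lab + D - 1`. -/
def Live (lab D : ℕ) (o : Fin n) (W : Fin n → ℕ) (e : Fin n) : Prop :=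
  e ≠ o ∧ lab ≤ W e ∧ W e < lab + D

/-- The item of highest rank in the window, apart from `o`, is only observed. -/
def BadTop (lab D : ℕ) (r : Fin n → ℕ) (o : Fin n) (W : Fin n → ℕ) : Prop :=
  ∃ e, Live lab D o W e ∧ W e = lab ∧ ∀ e', Live lab D o W e' → r e' ≤ r e

open Classical in
/-- The number of items in `T`, apart from `o`, that are in the window, are not only observed, and
have no larger label than the items of higher rank in the window. -/
noncomputable def recs (lab D : ℕ) (r : Fin n → ℕ) (o : Fin n) (T : Finset (Fin n))
    (W : Fin n → ℕ) : ℕ :=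
  (T.filter fun e => Live lab D o W e ∧ lab < W e ∧
    ∀ e' ∈ T, Live lab D o W e' → r e < r e' → W e ≤ W e').card

open Classical in
/-- The smallest label, counted from `lab`, of the items of `T` in the window. -/
noncomputable def minLab (lab D : ℕ) (o : Fin n) (T : Finset (Fin n)) (W : Fin n → ℕ) : ℕ :=
  (T.filter (Live lab D o W)).fold min (D - 1) fun e => W e - lab

theorem live_update {lab D : ℕ} {o e e' : Fin n} {W : Fin n → ℕ} {a : ℕ} (h : e' ≠ e) :
    Live lab D o (Function.update W e a) e' ↔ Live lab D o W e' := by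
  simp [Live, h]

open Classical in
theorem recs_congr {lab D : ℕ} {r : Fin n → ℕ} {o : Fin n} {T : Finset (Fin n)}
    {W W' : Fin n → ℕ} (h : ∀ e ∈ T, e ≠ o → W e = W' e) :
    recs lab D r o T W = recs lab D r o T W' := by
  have hl : ∀ e ∈ T, (Live lab D o W e ↔ Live lab D o W' e) := by
    intro e he
    by_cases ho : e = o
    · simp [Live, ho]
    · simp [Live, h e he ho]
  unfold recs
  congr 1
  refine filter_congr fun e he => ?_
  by_cases ho : e = o
  · simp [Live, ho]
  rw [hl e he, h e he ho]
  refine and_congr_right fun _ => and_congr_right fun _ => forall₂_congr fun e' he' => ?_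
  by_cases ho' : e' = o
  · simp [Live, ho']
  rw [hl e' he', h e' he' ho']

open Classical in
theorem minLab_congr {lab D : ℕ} {o : Fin n} {T : Finset (Fin n)}
    {W W' : Fin n → ℕ} (h : ∀ e ∈ T, e ≠ o → W e = W' e) :
    minLab lab D o T W = minLab lab D o T W' := by
  have hl : T.filter (Live lab D o W) = T.filter (Live lab D o W') := by
    refine filter_congr fun e he => ?_
    by_cases ho : e = o
    · simp [Live, ho]
    · simp [Live, h e he ho]
  unfold minLab
  rw [hl]
  refine fold_congr fun e he => ?_
  rw [mem_filter] at he
  rw [h e he.1 he.2.1]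

section Chain

variable {lab D : ℕ} {r : Fin n → ℕ} {o a : Fin n} {T : Finset (Fin n)} {W : Fin n → ℕ}

open Classical in
theorem recs_insert_of_not_live (h : ¬Live lab D o W a) :
    recs lab D r o (insert a T) W = recs lab D r o T W := by
  unfold recs
  rw [filter_insert, if_neg (fun h' => h h'.1)]
  congr 1
  refine filter_congr fun e _ => ?_
  simp [h]

open Classical in
theorem minLab_insert_of_not_live (h : ¬Live lab D o W a) :
    minLab lab D o (insert a T) W = minLab lab D o T W := by
  unfold minLab
  rw [filter_insert, if_neg h]

open Classical in
theorem minLab_insert (h : Live lab D o W a) (ha : a ∉ T) :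
    minLab lab D o (insert a T) W = min (W a - lab) (minLab lab D o T W) := by
  unfold minLab
  rw [filter_insert, if_pos h, fold_insert (by simp [ha])]

open Classical in
theorem recs_insert (hr : Function.Injective r) (h : Live lab D o W a) (ha : a ∉ T)
    (hT : ∀ x ∈ T, r a ≤ r x) :
    recs lab D r o (insert a T) W = recs lab D r o T W +
      if 1 ≤ W a - lab ∧ W a - lab ≤ minLab lab D o T W then 1 else 0 := by
  have h1 : (lab < W a ∧ ∀ e' ∈ insert a T, Live lab D o W e' → r a < r e' → W a ≤ W e') ↔
      1 ≤ W a - lab ∧ W a - lab ≤ minLab lab D o T W := by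
    have h2 := h.2.1
    have h3 := h.2.2
    unfold minLab
    rw [le_fold_min]
    refine and_congr (by omega) ⟨fun H => ⟨by omega, fun e he => ?_⟩, fun H e he hl hre => ?_⟩
    · rw [mem_filter] at he
      have h4 := H e (mem_insert_of_mem he.1) he.2
        (lt_of_le_of_ne (hT e he.1) fun h5 => ha (hr h5 ▸ he.1))
      omega
    · rcases mem_insert.1 he with rfl | he
      · omega
      · have h4 := H.2 e (mem_filter.2 ⟨he, hl⟩)
        have h5 := hl.2.1
        omega
  have h2 : T.filter (fun e => Live lab D o W e ∧ lab < W e ∧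
      ∀ e' ∈ insert a T, Live lab D o W e' → r e < r e' → W e ≤ W e') =
      T.filter (fun e => Live lab D o W e ∧ lab < W e ∧
      ∀ e' ∈ T, Live lab D o W e' → r e < r e' → W e ≤ W e') := by
    refine filter_congr fun e he => ?_
    have : ¬r a < r a := lt_irrefl _
    refine and_congr_right fun _ => and_congr_right fun _ => ⟨fun H e' he' => H e'
      (mem_insert_of_mem he'), fun H e' he' hl hre => ?_⟩
    rcases mem_insert.1 he' with rfl | he'
    · exact absurd (hT e he) (not_le.2 hre)
    · exact H e' he' hl hre
  unfold recs
  rw [filter_insert]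
  simp only [h, true_and, h1, h2]
  split_ifs with h3
  · rw [card_insert_of_notMem (by simp [ha])]
  · rfl

theorem minLab_le : minLab lab D o T W ≤ D - 1 := by
  classical
  unfold minLab
  rw [fold_min_le]
  exact Or.inl le_rfl

/-- With `t + 1` the weight of a smallest label `t`, and a factor `3 / 2` for every record (a label
`d ≥ 1` that is at most the smallest label so far), a uniformly random label does not increase the
weight on average. -/
theorem sum_record_weights (t D : ℕ) (h : t + 1 ≤ D) :
    ∑ d ∈ range D, (3 / 2 : ℝ) ^ (if 1 ≤ d ∧ d ≤ t then 1 else 0) * (((min d t : ℕ) : ℝ) + 1) ≤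
      (D : ℝ) * (t + 1) := by
  have h1 : ∀ t : ℕ, ∑ d ∈ range (t + 1), (3 / 2 : ℝ) ^ (if 1 ≤ d then 1 else 0) * ((d : ℝ) + 1) =
      1 + 3 / 4 * ((t : ℝ) * (t + 3)) := by
    intro t
    induction t with
    | zero => simp
    | succ t ih =>
      rw [sum_range_succ, ih]
      simp
      ring
  obtain ⟨s, rfl⟩ := Nat.exists_eq_add_of_le h
  have h2 : ∑ d ∈ range (t + 1), (3 / 2 : ℝ) ^ (if 1 ≤ d ∧ d ≤ t then 1 else 0) *
      (((min d t : ℕ) : ℝ) + 1) = 1 + 3 / 4 * ((t : ℝ) * (t + 3)) := by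
    rw [← h1]
    refine sum_congr rfl fun d hd => ?_
    have hd' : d ≤ t := Nat.lt_succ_iff.1 (mem_range.1 hd)
    simp [hd']
  have h3 : ∀ i, (3 / 2 : ℝ) ^ (if 1 ≤ t + 1 + i ∧ t + 1 + i ≤ t then 1 else 0) *
      (((min (t + 1 + i) t : ℕ) : ℝ) + 1) = t + 1 := by
    intro i
    rw [if_neg (by omega), min_eq_right (by omega)]
    simp
  rw [sum_range_add, h2]
  simp only [h3, sum_const, card_range, nsmul_eq_mul]
  push_cast
  have h4 : (t : ℝ) ≤ t ^ 2 := by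
    rcases Nat.eq_zero_or_pos t with rfl | ht
    · simp
    · have : (1 : ℝ) ≤ t := by exact_mod_cast ht
      nlinarith
  nlinarith

end Chain

section Window

variable {lab D : ℕ} {r : Fin n → ℕ} {A : Fin n → Finset ℕ}

/-- The weight of `sum_record_weights` is a supermartingale when the items are added in the order of
decreasing rank.  So many records are exponentially unlikely. -/
theorem sum_recs_le (hD : 0 < D) (hr : Function.Injective r)
    (hA : ∀ e, Ico lab (lab + D) ⊆ A e ∨ Disjoint (Ico lab (lab + D)) (A e)) (o : Fin n)
    (T : Finset (Fin n)) :
    ∑ W ∈ Fintype.piFinset A, (3 / 2 : ℝ) ^ recs lab D r o T W * (minLab lab D o T W + 1) ≤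
      D * (Fintype.piFinset A).card := by
  classical
  -- the item added last has the lowest rank, so it does not affect the records of the others
  induction T using Finset.induction_on_min_value r with
  | empty =>
    have h1 : ∀ W : Fin n → ℕ, (3 / 2 : ℝ) ^ recs lab D r o ∅ W * (minLab lab D o ∅ W + 1) = D := by
      intro W
      simp [recs, minLab, Nat.cast_sub (show 1 ≤ D from hD)]
    simp only [h1, sum_const, nsmul_eq_mul]
    rw [mul_comm]
  | insert a T ha hT ih =>
    refine le_trans ?_ ih
    by_cases hlive : a ≠ o ∧ Ico lab (lab + D) ⊆ A a
    · obtain ⟨hao, hI⟩ := hlive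
      have hne : (0 : ℝ) < (A a).card := by
        have : lab ∈ A a := hI (by simp [hD])
        exact_mod_cast card_pos.2 ⟨lab, this⟩
      refine le_of_mul_le_mul_left ?_ hne
      rw [card_mul_sum_piFinset, mul_sum]
      refine sum_le_sum fun W _ => ?_
      have hup : ∀ v, ∀ e ∈ T, e ≠ o → (Function.update W a v) e = W e := by
        intro v e he _
        exact Function.update_of_ne (ne_of_mem_of_not_mem he ha) _ _
      -- a label outside the window changes nothing
      have hout : ∀ v ∈ A a \ Ico lab (lab + D),
          (3 / 2 : ℝ) ^ recs lab D r o (insert a T) (Function.update W a v) *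
            (minLab lab D o (insert a T) (Function.update W a v) + 1) =
          (3 / 2 : ℝ) ^ recs lab D r o T W * (minLab lab D o T W + 1) := by
        intro v hv
        have hnl : ¬Live lab D o (Function.update W a v) a := by
          rintro ⟨-, h1, h2⟩
          rw [Function.update_self] at h1 h2
          exact (mem_sdiff.1 hv).2 (mem_Ico.2 ⟨h1, h2⟩)
        rw [recs_insert_of_not_live hnl, minLab_insert_of_not_live hnl, recs_congr (hup v),
          minLab_congr (hup v)]
      have hin : ∀ d ∈ range D,
          (3 / 2 : ℝ) ^ recs lab D r o (insert a T) (Function.update W a (lab + d)) *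
            (minLab lab D o (insert a T) (Function.update W a (lab + d)) + 1) =
          (3 / 2 : ℝ) ^ recs lab D r o T W *
            ((3 / 2 : ℝ) ^ (if 1 ≤ d ∧ d ≤ minLab lab D o T W then 1 else 0) *
              (((min d (minLab lab D o T W) : ℕ) : ℝ) + 1)) := by
        intro d hd
        have hl : Live lab D o (Function.update W a (lab + d)) a := by
          refine ⟨hao, ?_, ?_⟩ <;> rw [Function.update_self]
          · omega
          · have := mem_range.1 hd
            omega
        rw [recs_insert hr hl ha hT, minLab_insert hl ha, recs_congr (hup _), minLab_congr (hup _),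
          Function.update_self, Nat.add_sub_cancel_left, pow_add, mul_assoc]
      have hle : minLab lab D o T W + 1 ≤ D := by
        have := minLab_le (lab := lab) (D := D) (o := o) (T := T) (W := W)
        omega
      rw [← sum_sdiff hI, sum_congr rfl hout, sum_Ico_eq_sum_range, Nat.add_sub_cancel_left,
        sum_congr rfl hin, sum_const, nsmul_eq_mul]
      have h1 := sum_record_weights _ _ hle
      have h2 : ((A a).card : ℝ) = (A a \ Ico lab (lab + D)).card + D := by
        have := card_sdiff_add_card_eq_card hI
        rw [Nat.card_Ico, Nat.add_sub_cancel_left] at this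
        exact_mod_cast this.symm
      have h3 : (0 : ℝ) ≤ (3 / 2 : ℝ) ^ recs lab D r o T W := by positivity
      rw [h2, add_mul]
      have h4 := mul_le_mul_of_nonneg_left h1 h3
      rw [mul_sum] at h4
      refine add_le_add le_rfl (h4.trans (le_of_eq ?_))
      ring
    · refine le_of_eq (sum_congr rfl fun W hW => ?_)
      have hnl : ¬Live lab D o W a := by
        rintro ⟨h1, h2, h3⟩
        rcases hA a with h4 | h4
        · exact hlive ⟨h1, h4⟩
        · exact disjoint_left.1 h4 (mem_Ico.2 ⟨h2, h3⟩) (Fintype.mem_piFinset.1 hW a)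
      rw [recs_insert_of_not_live hnl, minLab_insert_of_not_live hnl]

open Classical in
/-- Given that an item is the top item of the window, its label is uniformly random in the window;
so it is only observed with probability `1 / D`. -/
theorem sum_badTop_le (hr : Function.Injective r)
    (hA : ∀ e, Ico lab (lab + D) ⊆ A e ∨ Disjoint (Ico lab (lab + D)) (A e)) (o : Fin n) :
    D * ∑ W ∈ Fintype.piFinset A, (if BadTop lab D r o W then (1 : ℝ) else 0) ≤
      (Fintype.piFinset A).card := by
  rcases Nat.eq_zero_or_pos D with rfl | hD
  · rw [Nat.cast_zero, zero_mul]
    positivity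
  -- `top e W` says that no item other than `e` in the window has higher rank than `e`
  let top : Fin n → (Fin n → ℕ) → ℝ := fun e W =>
    if e ≠ o ∧ ∀ e', e' ≠ e → Live lab D o W e' → r e' ≤ r e then 1 else 0
  have htop : ∀ e W a, top e (Function.update W e a) = top e W := by
    intro e W a
    have h1 : (e ≠ o ∧ ∀ e', e' ≠ e → Live lab D o (Function.update W e a) e' → r e' ≤ r e) ↔
        (e ≠ o ∧ ∀ e', e' ≠ e → Live lab D o W e' → r e' ≤ r e) :=
      and_congr_right fun _ => forall₂_congr fun e' he' => by rw [live_update he']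
    exact if_congr h1 rfl rfl
  have h0 : ∀ e W, 0 ≤ top e W := fun e W => by
    simp only [top]
    split_ifs <;> norm_num
  have key : ∀ e, D * ∑ W ∈ Fintype.piFinset A, (if W e ∈ ({lab} : Finset ℕ) then top e W else 0) =
      ∑ W ∈ Fintype.piFinset A, (if W e ∈ Ico lab (lab + D) then top e W else 0) := by
    intro e
    rcases hA e with hI | hI
    · have hlab : lab ∈ A e := hI (by simp [hD])
      have hne : ((A e).card : ℝ) ≠ 0 := by
        have := card_pos.2 ⟨lab, hlab⟩
        positivity
      have h1 := card_mul_sum_mem A e (singleton_subset_iff.2 hlab) (htop e)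
      have h2 := card_mul_sum_mem A e hI (htop e)
      rw [card_singleton, Nat.cast_one, one_mul] at h1
      rw [Nat.card_Ico, Nat.add_sub_cancel_left, ← h1] at h2
      refine mul_left_cancel₀ hne ?_
      rw [h2]
      ring
    · have h1 : ∀ W ∈ Fintype.piFinset A, W e ∉ Ico lab (lab + D) := fun W hW h =>
        disjoint_left.1 hI h (Fintype.mem_piFinset.1 hW e)
      rw [sum_eq_zero, sum_eq_zero, mul_zero]
      · intro W hW
        rw [if_neg (h1 W hW)]
      · intro W hW
        rw [if_neg]
        intro h
        rw [mem_singleton] at h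
        exact h1 W hW (by simp [h, hD])
  have h1 : ∑ W ∈ Fintype.piFinset A, (if BadTop lab D r o W then (1 : ℝ) else 0) ≤
      ∑ e, ∑ W ∈ Fintype.piFinset A, (if W e ∈ ({lab} : Finset ℕ) then top e W else 0) := by
    rw [sum_comm]
    refine sum_le_sum fun W _ => ?_
    have h2 : ∀ e ∈ univ, 0 ≤ if W e ∈ ({lab} : Finset ℕ) then top e W else 0 := fun e _ => by
      split_ifs
      · exact h0 e W
      · exact le_rfl
    split_ifs with hb
    · obtain ⟨e, h3, h4, h5⟩ := hb
      refine le_trans ?_ (single_le_sum h2 (mem_univ e))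
      rw [if_pos (by simp [h4])]
      simp only [top]
      rw [if_pos ⟨h3.1, fun e' _ h => h5 e' h⟩]
    · exact sum_nonneg h2
  have h2 : ∑ e, ∑ W ∈ Fintype.piFinset A, (if W e ∈ Ico lab (lab + D) then top e W else 0) ≤
      (Fintype.piFinset A).card := by
    rw [sum_comm, card_eq_sum_ones, Nat.cast_sum]
    refine sum_le_sum fun W _ => ?_
    -- at most one item is the top item of the window
    have huniq : ∀ e e', (if W e ∈ Ico lab (lab + D) then top e W else 0) ≠ 0 →
        (if W e' ∈ Ico lab (lab + D) then top e' W else 0) ≠ 0 → e = e' := by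
      intro e e' h h'
      simp only [top, ne_eq, ite_eq_right_iff, Classical.not_imp, mem_Ico] at h h'
      obtain ⟨h1, ⟨h2, h3⟩, -⟩ := h
      obtain ⟨h1', ⟨h2', h3'⟩, -⟩ := h'
      by_contra hne
      exact hne (hr (le_antisymm (h3' e hne ⟨h2, h1⟩) (h3 e' (Ne.symm hne) ⟨h2', h1'⟩)))
    by_cases hex : ∃ e, (if W e ∈ Ico lab (lab + D) then top e W else 0) ≠ 0
    · obtain ⟨e, he⟩ := hex
      rw [sum_eq_single e (fun e' _ hne => by
        by_contra h
        exact hne (huniq e' e h he)) (by simp)]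
      simp only [top]
      split_ifs <;> norm_num
    · push Not at hex
      rw [sum_eq_zero fun e _ => hex e]
      norm_num
  calc (D : ℝ) * ∑ W ∈ Fintype.piFinset A, (if BadTop lab D r o W then (1 : ℝ) else 0)
      ≤ D * ∑ e, ∑ W ∈ Fintype.piFinset A, (if W e ∈ ({lab} : Finset ℕ) then top e W else 0) := by
        gcongr
    _ = ∑ e, ∑ W ∈ Fintype.piFinset A, (if W e ∈ Ico lab (lab + D) then top e W else 0) := by
        rw [mul_sum]
        exact sum_congr rfl fun e _ => key e
    _ ≤ _ := h2

/-- The labels are unfavourable for the item `o`: the best of the other items of the window is only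
observed, or the other items may use up the improvements that are allowed.  The `2` leaves room for
`o` itself and for one item that ties with the best one observed. -/
def Bad (lab D L : ℕ) (r : Fin n → ℕ) (o : Fin n) (W : Fin n → ℕ) : Prop :=
  BadTop lab D r o W ∨ L ≤ recs lab D r o univ W + 2

theorem bad_update {L : ℕ} {o : Fin n} {W : Fin n → ℕ} {a : ℕ} :
    Bad lab D L r o (Function.update W o a) ↔ Bad lab D L r o W := by
  have h1 : ∀ e, Live lab D o (Function.update W o a) e ↔ Live lab D o W e := by
    intro e
    by_cases h : e = o
    · simp [Live, h]
    · exact live_update h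
  refine or_congr (exists_congr fun e => ?_) ?_
  · simp only [h1]
    refine and_congr_right fun h => ?_
    rw [Function.update_of_ne h.1]
  · rw [recs_congr fun e _ he => Function.update_of_ne he _ _]

open Classical in
theorem sum_bad_le {L : ℕ} (hD : 0 < D) (hL : (D : ℝ) ^ 2 ≤ (3 / 2) ^ (L - 2))
    (hr : Function.Injective r)
    (hA : ∀ e, Ico lab (lab + D) ⊆ A e ∨ Disjoint (Ico lab (lab + D)) (A e)) (o : Fin n) :
    D * ∑ W ∈ Fintype.piFinset A, (if Bad lab D L r o W then (1 : ℝ) else 0) ≤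
      2 * (Fintype.piFinset A).card := by
  have hD' : (0 : ℝ) < D := by exact_mod_cast hD
  have h1 := sum_badTop_le hr hA o
  have h2 := sum_recs_le hD hr hA o univ
  -- Markov's inequality
  have h3 : (D : ℝ) ^ 2 * ∑ W ∈ Fintype.piFinset A,
      (if L ≤ recs lab D r o univ W + 2 then (1 : ℝ) else 0) ≤ D * (Fintype.piFinset A).card := by
    refine le_trans ?_ h2
    rw [mul_sum]
    refine sum_le_sum fun W _ => ?_
    have h4 : (1 : ℝ) ≤ minLab lab D o univ W + 1 := by
      have : (0 : ℝ) ≤ minLab lab D o univ W := Nat.cast_nonneg _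
      linarith
    split_ifs with h
    · have h5 : (3 / 2 : ℝ) ^ (L - 2) ≤ (3 / 2) ^ recs lab D r o univ W :=
        pow_le_pow_right₀ (by norm_num) (by omega)
      have h6 : (0 : ℝ) ≤ (3 / 2) ^ recs lab D r o univ W := by positivity
      nlinarith
    · rw [mul_zero]
      positivity
  have h5 : D * ∑ W ∈ Fintype.piFinset A,
      (if L ≤ recs lab D r o univ W + 2 then (1 : ℝ) else 0) ≤ (Fintype.piFinset A).card := by
    refine le_of_mul_le_mul_left ?_ hD'
    linarith
  have h6 : ∑ W ∈ Fintype.piFinset A, (if Bad lab D L r o W then (1 : ℝ) else 0) ≤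
      ∑ W ∈ Fintype.piFinset A, (if BadTop lab D r o W then (1 : ℝ) else 0) +
      ∑ W ∈ Fintype.piFinset A, (if L ≤ recs lab D r o univ W + 2 then (1 : ℝ) else 0) := by
    rw [← sum_add_distrib]
    refine sum_le_sum fun W _ => ?_
    by_cases ha : BadTop lab D r o W <;> by_cases hb : L ≤ recs lab D r o univ W + 2 <;>
      simp [Bad, ha, hb]
  have := mul_le_mul_of_nonneg_left h6 hD'.le
  linarith

open Classical in
/-- The probability that the item `o` is in the window, is not only observed, and the other labels
are favourable. -/
theorem le_sum_not_bad {L : ℕ} (hD : 0 < D) (hL : (D : ℝ) ^ 2 ≤ (3 / 2) ^ (L - 2))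
    (hr : Function.Injective r)
    (hA : ∀ e, Ico lab (lab + D) ⊆ A e ∨ Disjoint (Ico lab (lab + D)) (A e)) {o : Fin n}
    (ho : Ico lab (lab + D) ⊆ A o) :
    (D - 3) * (Fintype.piFinset A).card ≤ (A o).card * ∑ W ∈ Fintype.piFinset A,
      (if W o ∈ Ioo lab (lab + D) ∧ ¬Bad lab D L r o W then (1 : ℝ) else 0) := by
  have h1 := card_mul_sum_mem A o (J := Ioo lab (lab + D))
    (F := fun W => if ¬Bad lab D L r o W then 1 else 0)
    (fun x hx => ho (mem_Ico.2 ⟨(mem_Ioo.1 hx).1.le, (mem_Ioo.1 hx).2⟩))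
    (fun W a => if_congr (not_congr bad_update) rfl rfl)
  have h2 := sum_bad_le hD hL hr hA o
  have h3 : ∑ W ∈ Fintype.piFinset A, (if ¬Bad lab D L r o W then (1 : ℝ) else 0) =
      (Fintype.piFinset A).card -
        ∑ W ∈ Fintype.piFinset A, (if Bad lab D L r o W then (1 : ℝ) else 0) := by
    rw [card_eq_sum_ones, Nat.cast_sum, ← sum_sub_distrib]
    refine sum_congr rfl fun W _ => ?_
    by_cases hb : Bad lab D L r o W <;> simp [hb]
  have h4 : ((Ioo lab (lab + D)).card : ℝ) = D - 1 := by
    rw [Nat.card_Ioo, Nat.add_sub_cancel_left, Nat.cast_sub hD, Nat.cast_one]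
  have h5 : 0 ≤ ∑ W ∈ Fintype.piFinset A, (if Bad lab D L r o W then (1 : ℝ) else 0) :=
    sum_nonneg fun W _ => by split_ifs <;> norm_num
  simp only [ite_and]
  rw [h1, h3, h4]
  nlinarith

end Window

end ShortlistSecretary

namespace ShortlistSecretary

variable {n : ℕ}

/-! ### One level during a window -/

open Classical in
/-- The arrivals of a window, where `ps` lists the pairs of a label and an item in the order in
which they are considered; the item arrives if it has that label. -/
noncomputable def scanPairs (f : Finset (Fin n) → ℝ) (L lo hi lab : ℕ) (W : Fin n → ℕ)
    (ps : List (ℕ × Fin n)) (st : St n) : St n :=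
  ps.foldl (fun st p =>
    if W p.2 = p.1 then arrive f L lo hi (decide (p.1 = lab)) p.2 st else st) st

/-- The pairs of a label and an item in the window with the labels `lab, …, lab + D - 1`. -/
def pairs (π : List (Fin n)) (lab D : ℕ) : List (ℕ × Fin n) :=
  (List.range D).flatMap fun d => π.map fun e => (lab + d, e)

theorem scan_eq_scanPairs (f : Finset (Fin n) → ℝ) (L lo hi lab D : ℕ) (W : Fin n → ℕ)
    (π : List (Fin n)) (st : St n) :
    scan f L lo hi (fun l => π.filter fun e => decide (W e = l)) lab D st =
      scanPairs f L lo hi lab W (pairs π lab D) st := by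
  unfold scan scanPairs pairs
  rw [List.foldl_flatMap]
  congr 1
  funext st d
  rw [List.foldl_map, List.foldl_filter]
  simp

theorem mem_pairs {π : List (Fin n)} {lab D : ℕ} {p : ℕ × Fin n} :
    p ∈ pairs π lab D ↔ lab ≤ p.1 ∧ p.1 < lab + D ∧ p.2 ∈ π := by
  obtain ⟨l, e⟩ := p
  simp only [pairs, List.mem_flatMap, List.mem_range, List.mem_map, Prod.mk.injEq]
  constructor
  · rintro ⟨d, hd, e', he', rfl, rfl⟩
    exact ⟨by omega, by omega, he'⟩
  · rintro ⟨h1, h2, h3⟩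
    exact ⟨l - lab, by omega, e, h3, by omega, rfl⟩

theorem pairs_succ (π : List (Fin n)) (lab D : ℕ) :
    pairs π lab (D + 1) = pairs π lab D ++ π.map fun e => (lab + D, e) := by
  simp [pairs, List.range_succ]

theorem pairs_sorted (π : List (Fin n)) (lab D : ℕ) :
    (pairs π lab D).Pairwise fun p q => p.1 ≤ q.1 := by
  induction D with
  | zero => simp [pairs]
  | succ D ih =>
    rw [pairs_succ, List.pairwise_append]
    refine ⟨ih, ?_, fun p hp q hq => ?_⟩
    · rw [List.pairwise_map]
      exact List.pairwise_of_forall fun _ _ => le_rfl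
    · obtain ⟨e, -, rfl⟩ := List.mem_map.1 hq
      have := (mem_pairs.1 hp).2.1
      simp only
      omega

theorem pairs_nodup {π : List (Fin n)} (hπ : π.Nodup) (lab D : ℕ) : (pairs π lab D).Nodup := by
  induction D with
  | zero => simp [pairs]
  | succ D ih =>
    rw [pairs_succ, List.nodup_append]
    refine ⟨ih, hπ.map fun a b h => by simpa using h, fun p hp q hq => ?_⟩
    obtain ⟨e, -, rfl⟩ := List.mem_map.1 hq
    rintro rfl
    have := (mem_pairs.1 hp).2.1
    simp at this

section Level

variable {f : Finset (Fin n) → ℝ} {L lo hi lab : ℕ} {st : St n} {l : ℕ} {x : Fin n}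

theorem arrive_level_prefix (hl : lo < l ∧ l ≤ hi) :
    (arrive f L lo hi true x st).N l = st.N l ∧
      (arrive f L lo hi true x st).tv l = max (st.tv l) (f (st.cand (some x) l)) ∧
      (arrive f L lo hi true x st).c l = st.c l := by
  have h1 : ¬st.Acc f L lo hi true (some x) l := fun h => by simpa using h.2.2.1
  rw [arrive_N, arrive_tv, arrive_c]
  simp only [tryItem, h1, if_false, false_or, hl, true_and, and_true]
  split_ifs with h
  · exact (max_eq_right h.le).symm
  · exact (max_eq_left (not_lt.1 h)).symm

theorem arrive_level_acc (h : st.Acc f L lo hi false (some x) l) :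
    (arrive f L lo hi false x st).N l = st.cand (some x) l ∧
      (arrive f L lo hi false x st).tv l = f (st.cand (some x) l) ∧
      (arrive f L lo hi false x st).c l = st.c l + 1 := by
  rw [arrive_N, arrive_tv, arrive_c]
  simp [tryItem, h]

theorem arrive_level_rej (h : ¬st.Acc f L lo hi false (some x) l) :
    (arrive f L lo hi false x st).N l = st.N l ∧
      (arrive f L lo hi false x st).tv l = st.tv l ∧
      (arrive f L lo hi false x st).c l = st.c l := by
  rw [arrive_N, arrive_tv, arrive_c]
  simp [tryItem, h]

open Classical in
/-- Invariants of one level during a window, after the pairs in `pre`; `g e` is the value of the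
candidate obtained from the item `e`, and `R` is a set of items. -/
structure LevelInv (f : Finset (Fin n) → ℝ) (lab l : ℕ) (W : Fin n → ℕ) (g : Fin n → ℝ)
    (R : Finset (Fin n)) (o : Fin n) (pre : List (ℕ × Fin n)) (st : St n) : Prop where
  low : f (st.N l) ≤ st.tv l
  seen : ∀ u, (W u, u) ∈ pre → g u ≤ st.tv l
  post : ∀ u, (W u, u) ∈ pre → W u ≠ lab → g u ≤ f (st.N l) ∨ g u < st.tv l
  thr : st.tv l = f (st.N l) ∨ ∃ z, (W z, z) ∈ pre ∧ W z = lab ∧ st.tv l = g z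
  start : (∀ u, (W u, u) ∈ pre → W u = lab) → st.c l = 0
  count : st.c l ≤ (R.filter fun e => (W e, e) ∈ pre).card + (if (W o, o) ∈ pre then 1 else 0) +
    (if ∀ z, (W z, z) ∈ pre → W z = lab → g z ≤ f (st.N l) then 1 else 0)

open Classical in
/-- The invariants hold throughout the window.  An accepted item other than `o` is a record: an
earlier item of higher rank rules it out, unless that item was only observed and ties with it; the
latter happens only once. -/
theorem levelInv_scanPairs {D : ℕ} {W : Fin n → ℕ} {g : Fin n → ℝ} {r : Fin n → ℕ} {o : Fin n}
    {π : List (Fin n)} {S : ℕ → Finset (Fin n)} {full pre post : List (ℕ × Fin n)}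
    (hl : lo < l ∧ l ≤ hi)
    (hg : ∀ e, g e = f (S (l - 1) ∪ {e})) (hr : ∀ e e', r e ≤ r e' → g e ≤ g e')
    (hπ : π.Nodup) (hall : ∀ e, e ∈ π) (hL : recs lab D r o univ W + 2 < L)
    (hfull : full = pairs π lab D) (hpre : full = pre ++ post)
    (hS : st.S = S) (hv : st.tv l = f (st.N l)) (hc : st.c l = 0) :
    (scanPairs f L lo hi lab W pre st).S = S ∧
    LevelInv f lab l W g (univ.filter fun e => Live lab D o W e ∧ lab < W e ∧
      ∀ e' ∈ univ, Live lab D o W e' → r e < r e' → W e ≤ W e') o pre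
      (scanPairs f L lo hi lab W pre st) := by
  set R := univ.filter fun e => Live lab D o W e ∧ lab < W e ∧
      ∀ e' ∈ univ, Live lab D o W e' → r e < r e' → W e ≤ W e' with hR
  have hRL : R.card + 2 < L := hL
  induction pre using List.reverseRecOn generalizing post with
  | nil => exact ⟨hS, by constructor <;> simp [scanPairs, hv, hc]⟩
  | append_singleton pre p ih =>
    rw [List.append_assoc] at hpre
    obtain ⟨ihS, ih⟩ := ih hpre
    obtain ⟨lam, u⟩ := p
    have hstep : scanPairs f L lo hi lab W (pre ++ [(lam, u)]) st =
        if W u = lam then arrive f L lo hi (decide (lam = lab)) u (scanPairs f L lo hi lab W pre st)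
        else scanPairs f L lo hi lab W pre st := by
      simp [scanPairs]
    rw [hstep]
    generalize scanPairs f L lo hi lab W pre st = s at ih ihS
    have hmem : ∀ e, (W e, e) ∈ pre ++ [(lam, u)] ↔ (W e, e) ∈ pre ∨ (e = u ∧ W u = lam) := by
      intro e
      simp only [List.mem_append, List.mem_singleton, Prod.mk.injEq]
      constructor
      · rintro (h | ⟨h1, rfl⟩)
        · exact Or.inl h
        · exact Or.inr ⟨rfl, h1⟩
      · rintro (h | ⟨rfl, h1⟩)
        · exact Or.inl h
        · exact Or.inr ⟨h1, rfl⟩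
    by_cases hu : W u = lam
    · rw [if_pos hu]
      subst hu
      simp only [and_true] at hmem
      have hin : (W u, u) ∈ pairs π lab D := by
        rw [← hfull, hpre]
        simp
      have hwin := mem_pairs.1 hin
      have hsort := pairs_sorted π lab D
      have hnd := pairs_nodup hπ lab D
      rw [← hfull, hpre] at hsort hnd
      -- earlier pairs have no larger label, and pairs with smaller label are earlier
      have hle : ∀ q ∈ pre, q.1 ≤ W u := fun q hq =>
        (List.pairwise_append.1 hsort).2.2 q hq (W u, u) (by simp)
      have hlt : ∀ e, lab ≤ W e → W e < W u → (W e, e) ∈ pre := by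
        intro e h1 h2
        have h3 : (W e, e) ∈ full := by
          rw [hfull]
          exact mem_pairs.2 ⟨h1, h2.trans hwin.2.1, hall e⟩
        rw [hpre, List.mem_append] at h3
        rcases h3 with h3 | h3
        · exact h3
        · rw [List.singleton_append, List.mem_cons] at h3
          rcases h3 with h3 | h3
          · simp only [Prod.mk.injEq] at h3
            omega
          · have h4 := (List.pairwise_append.1 hsort).2.1
            rw [List.singleton_append, List.pairwise_cons] at h4
            have := h4.1 _ h3
            simp only at this
            omega
      have hnew : (W u, u) ∉ pre := by
        intro h
        exact (List.nodup_append.1 hnd).2.2 _ h _ (by simp) rfl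
      have hcand : f (s.cand (some u) l) = g u := by
        rw [hg, St.cand, ihS]
        simp [tokenSet]
      refine ⟨by rw [arrive_S, ihS], ?_⟩
      by_cases hp : W u = lab
      · -- the item `u` is only observed
        obtain ⟨hN, hT, hC⟩ := arrive_level_prefix (f := f) (L := L) (st := s) (x := u) hl
        rw [hcand] at hT
        rw [show decide (W u = lab) = true by simp [hp]]
        have hpre0 : ∀ e, (W e, e) ∈ pre → W e = lab := by
          intro e he
          have h1 := hle _ he
          have h2 : (W e, e) ∈ pairs π lab D := by
            rw [← hfull, hpre]
            simp [he]
          have h3 := (mem_pairs.1 h2).1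
          simp only at h1 h3
          omega
        have hc0 := ih.start hpre0
        constructor
        · rw [hN, hT]
          exact ih.low.trans (le_max_left _ _)
        · intro e he
          rw [hT]
          rcases (hmem e).1 he with he | rfl
          · exact (ih.seen e he).trans (le_max_left _ _)
          · exact le_max_right _ _
        · intro e he hne
          rcases (hmem e).1 he with he | rfl
          · exact absurd (hpre0 e he) hne
          · exact absurd hp hne
        · rw [hT, hN]
          rcases le_total (s.tv l) (g u) with h | h
          · exact Or.inr ⟨u, (hmem u).2 (Or.inr rfl), hp, max_eq_right h⟩
          · rw [max_eq_left h]
            rcases ih.thr with h1 | ⟨z, h1, h2, h3⟩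
            · exact Or.inl h1
            · exact Or.inr ⟨z, (hmem z).2 (Or.inl h1), h2, h3⟩
        · intro _
          rw [hC, hc0]
        · rw [hC, hc0]
          exact Nat.zero_le _
      · rw [show decide (W u = lab) = false by simp [hp]]
        have hpfx : ∀ z, W z = lab → ((W z, z) ∈ pre ++ [(W u, u)] ↔ (W z, z) ∈ pre) := by
          intro z hz
          rw [hmem]
          refine or_iff_left ?_
          rintro rfl
          exact hp hz
        have hRmono : (R.filter fun e => (W e, e) ∈ pre).card ≤
            (R.filter fun e => (W e, e) ∈ pre ++ [(W u, u)]).card :=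
          card_le_card (monotone_filter_right _ fun e _ he => (hmem e).2 (Or.inl he))
        have hRcard : (R.filter fun e => (W e, e) ∈ pre).card ≤ R.card := card_filter_le _ _
        have hcL : s.c l < L := by
          have := ih.count
          split_ifs at this <;> omega
        have homono : (if (W o, o) ∈ pre then 1 else 0) ≤
            (if (W o, o) ∈ pre ++ [(W u, u)] then 1 else 0) := by
          by_cases h : (W o, o) ∈ pre
          · rw [if_pos h, if_pos ((hmem o).2 (Or.inl h))]
          · rw [if_neg h]
            exact Nat.zero_le _
        by_cases hacc : s.Acc f L lo hi false (some u) l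
        · -- the item `u` is accepted
          obtain ⟨hN, hT, hC⟩ := arrive_level_acc hacc
          rw [hcand] at hT
          obtain ⟨-, -, -, ha1, ha2, -⟩ := hacc
          rw [hcand] at ha1 ha2
          rw [not_lt] at ha2
          have hfN : f ((arrive f L lo hi false u s).N l) = g u := by rw [hN, hcand]
          constructor
          · rw [hfN, hT]
          · intro e he
            rw [hT]
            rcases (hmem e).1 he with he | rfl
            · exact (ih.seen e he).trans ha2
            · exact le_rfl
          · intro e he _
            rw [hfN]
            refine Or.inl ?_
            rcases (hmem e).1 he with he | rfl
            · exact (ih.seen e he).trans ha2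
            · exact le_rfl
          · exact Or.inl (by rw [hT, hfN])
          · intro h
            exact absurd (h u ((hmem u).2 (Or.inr rfl))) hp
          · -- the accepted item is `o`, or in `R`, or its value is the highest observed value
            rw [hC, hfN]
            have hthird : (if ∀ z, (W z, z) ∈ pre → W z = lab → g z ≤ f (s.N l) then 1 else 0) ≤
                (if ∀ z, (W z, z) ∈ pre ++ [(W u, u)] → W z = lab → g z ≤ g u then 1 else 0) := by
              by_cases h : ∀ z, (W z, z) ∈ pre → W z = lab → g z ≤ f (s.N l)
              · rw [if_pos h, if_pos]
                intro z hz hz'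
                exact (h z ((hpfx z hz').1 hz) hz').trans ha1.le
              · rw [if_neg h]
                exact Nat.zero_le _
            have hcount := ih.count
            by_cases huo : u = o
            · subst huo
              rw [if_neg hnew] at hcount
              rw [if_pos ((hmem u).2 (Or.inr rfl))]
              omega
            · by_cases huR : u ∈ R
              · have h1 : (R.filter fun e => (W e, e) ∈ pre).card <
                    (R.filter fun e => (W e, e) ∈ pre ++ [(W u, u)]).card := by
                  refine card_lt_card ⟨monotone_filter_right _ fun e _ he => (hmem e).2 (Or.inl he),
                    fun h => ?_⟩
                  have h2 := h (mem_filter.2 ⟨huR, (hmem u).2 (Or.inr rfl)⟩)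
                  exact hnew (mem_filter.1 h2).2
                omega
              · -- an item of higher rank came before, so it was only observed, and there is a tie
                have hlive : Live lab D o W u := ⟨huo, hwin.1, hwin.2.1⟩
                have hex : ∃ e', Live lab D o W e' ∧ r u < r e' ∧ W e' < W u := by
                  by_contra hno
                  push Not at hno
                  refine huR (mem_filter.2 ⟨mem_univ _, hlive, lt_of_le_of_ne hwin.1 (Ne.symm hp),
                    fun e' _ h1 h2 => hno e' h1 h2⟩)
                obtain ⟨e', h1, h2, h3⟩ := hex
                have h4 := hlt e' h1.2.1 h3
                have h5 := ih.seen e' h4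
                have h6 := hr u e' h2.le
                have h7 : W e' = lab := by
                  by_contra h7
                  rcases ih.post e' h4 h7 with h8 | h8 <;> linarith
                have h8 : ¬∀ z, (W z, z) ∈ pre → W z = lab → g z ≤ f (s.N l) := fun h => by
                  have := h e' h4 h7
                  linarith
                rw [if_neg h8] at hcount
                rw [if_pos (fun z hz hz' => (ih.seen z ((hpfx z hz').1 hz)).trans ha2)]
                omega
        · -- the item `u` is rejected, but not because of the bound `L`
          obtain ⟨hN, hT, hC⟩ := arrive_level_rej hacc
          have hrej : g u ≤ f (s.N l) ∨ g u < s.tv l := by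
            by_contra hno
            push Not at hno
            refine hacc ⟨hl.1, hl.2, rfl, ?_, ?_, hcL⟩ <;> rw [hcand]
            · exact hno.1
            · exact not_lt.2 hno.2
          constructor
          · rw [hN, hT]
            exact ih.low
          · intro e he
            rw [hT]
            rcases (hmem e).1 he with he | rfl
            · exact ih.seen e he
            · rcases hrej with h | h
              · exact h.trans ih.low
              · exact h.le
          · intro e he hne
            rw [hN, hT]
            rcases (hmem e).1 he with he | rfl
            · exact ih.post e he hne
            · exact hrej
          · rw [hT, hN]
            rcases ih.thr with h1 | ⟨z, h1, h2, h3⟩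
            · exact Or.inl h1
            · exact Or.inr ⟨z, (hmem z).2 (Or.inl h1), h2, h3⟩
          · intro h
            exact absurd (h u ((hmem u).2 (Or.inr rfl))) hp
          · rw [hC, hN]
            refine ih.count.trans ?_
            have hthird : (if ∀ z, (W z, z) ∈ pre → W z = lab → g z ≤ f (s.N l) then 1 else 0) ≤
                (if ∀ z, (W z, z) ∈ pre ++ [(W u, u)] → W z = lab → g z ≤ f (s.N l)
                  then 1 else 0) := by
              by_cases h : ∀ z, (W z, z) ∈ pre → W z = lab → g z ≤ f (s.N l)
              · rw [if_pos h, if_pos]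
                intro z hz hz'
                exact h z ((hpfx z hz').1 hz) hz'
              · rw [if_neg h]
                exact Nat.zero_le _
            omega
    · rw [if_neg hu]
      have hmem' : ∀ e, (W e, e) ∈ pre ++ [(lam, u)] ↔ (W e, e) ∈ pre := by
        intro e
        rw [hmem]
        exact or_iff_left fun h => hu h.2
      refine ⟨ihS, ?_⟩
      constructor
      · exact ih.low
      · simpa only [hmem'] using ih.seen
      · simpa only [hmem'] using ih.post
      · simpa only [hmem'] using ih.thr
      · simpa only [hmem'] using ih.start
      · simpa only [hmem'] using ih.count

/-- With favourable labels, an item that arrives in the window and is not only observed is not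
missed. -/
theorem le_scanPairs {D : ℕ} {W : Fin n → ℕ} {r : Fin n → ℕ} {o : Fin n} {π : List (Fin n)}
    (hl : lo < l ∧ l ≤ hi)
    (hr : ∀ e e', r e ≤ r e' → f (st.S (l - 1) ∪ {e}) ≤ f (st.S (l - 1) ∪ {e'}))
    (hπ : π.Nodup) (hall : ∀ e, e ∈ π) (hbad : ¬Bad lab D L r o W)
    (hv : st.tv l = f (st.N l)) (hc : st.c l = 0) (ho : W o ∈ Ioo lab (lab + D)) :
    f (st.S (l - 1) ∪ {o}) ≤ f ((scanPairs f L lo hi lab W (pairs π lab D) st).N l) := by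
  classical
  have hbad' : ¬BadTop lab D r o W ∧ recs lab D r o univ W + 2 < L := by
    rw [Bad, not_or, not_le] at hbad
    exact hbad
  obtain ⟨-, h⟩ := levelInv_scanPairs (D := D) (W := W) (r := r) (o := o) (S := st.S)
    (full := pairs π lab D) (pre := pairs π lab D) (post := []) (lab := lab)
    (g := fun e => f (st.S (l - 1) ∪ {e})) hl (fun _ => rfl) hr hπ hall hbad'.2 rfl (by simp) rfl
    hv hc
  generalize scanPairs f L lo hi lab W (pairs π lab D) st = s at h ⊢
  rw [mem_Ioo] at ho
  have hmem : ∀ e, lab ≤ W e → W e < lab + D → (W e, e) ∈ pairs π lab D :=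
    fun e h1 h2 => mem_pairs.2 ⟨h1, h2, hall e⟩
  rcases h.post o (hmem o ho.1.le ho.2) ho.1.ne' with h1 | h1
  · exact h1
  rcases h.thr with h2 | ⟨z, h2, h3, h4⟩
  · exact h1.le.trans h2.le
  -- the item of highest rank in the window is not only observed
  have hz := mem_pairs.1 h2
  have hzo : z ≠ o := by
    rintro rfl
    omega
  have hne : (univ.filter (Live lab D o W)).Nonempty :=
    ⟨z, mem_filter.2 ⟨mem_univ _, hzo, hz.1, hz.2.1⟩⟩
  obtain ⟨e, he, hmax⟩ := exists_max_image _ r hne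
  rw [mem_filter] at he
  have he' : W e ≠ lab := fun h5 => hbad'.1
    ⟨e, he.2, h5, fun e' h6 => hmax e' (mem_filter.2 ⟨mem_univ _, h6⟩)⟩
  have h5 := hr z e (hmax z (mem_filter.2 ⟨mem_univ _, hzo, hz.1, hz.2.1⟩))
  rcases h.post e (hmem e he.2.2.1 he.2.2.2) he' with h6 | h6 <;> linarith

end Level

end ShortlistSecretary

namespace ShortlistSecretary

variable {n : ℕ}

/-! ### Revealing the labels -/

theorem sum_piFinset_split {ι : Type} [Fintype ι] [DecidableEq ι] (A : ι → Finset ℕ) {u : ι}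
    {a : ℕ} (ha : a ∈ A u) (F : (ι → ℕ) → ℝ) :
    ∑ W ∈ Fintype.piFinset A, F W =
      ∑ W ∈ Fintype.piFinset (Function.update A u {a}), F W +
        ∑ W ∈ Fintype.piFinset (Function.update A u ((A u).erase a)), F W := by
  rw [← sum_filter_add_sum_filter_not (Fintype.piFinset A) (fun W => W u = a)]
  have key : ∀ (B : Finset ℕ) (p : (ι → ℕ) → Prop) [DecidablePred p],
      (∀ W, (W u ∈ A u ∧ p W) ↔ W u ∈ B) →
      (Fintype.piFinset A).filter p = Fintype.piFinset (Function.update A u B) := by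
    intro B p _ hp
    ext W
    rw [mem_filter, Fintype.mem_piFinset, Fintype.mem_piFinset]
    constructor
    · rintro ⟨h1, h2⟩ i
      by_cases hi : i = u
      · subst hi
        rw [Function.update_self]
        exact (hp W).1 ⟨h1 i, h2⟩
      · rw [Function.update_of_ne hi]
        exact h1 i
    · intro h
      have hu := h u
      rw [Function.update_self] at hu
      refine ⟨fun i => ?_, ((hp W).2 hu).2⟩
      by_cases hi : i = u
      · subst hi
        exact ((hp W).2 hu).1
      · have := h i
        rwa [Function.update_of_ne hi] at this
  congr 1
  · rw [key {a} _ fun W => ⟨fun h => by simp [h.2], fun h => by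
      rw [mem_singleton] at h
      exact ⟨h ▸ ha, h⟩⟩]
  · rw [key ((A u).erase a) _ fun W => by rw [mem_erase, and_comm]]

/-- The sets `A e` of the labels that are still possible for the items, when the labels of the
pairs in `ps` and those in `Fut` are yet to be considered: an item may have all these labels, or
none of them; in the latter case it is on the shortlist, or it was only observed. -/
def Valid (Pre : ℕ → Prop) (Fut : Finset ℕ) (ps : List (ℕ × Fin n)) (A : Fin n → Finset ℕ)
    (H : List (Fin n)) : Prop :=
  ∀ e, ((∀ l, (l, e) ∈ ps → l ∈ A e) ∧ Fut ⊆ A e) ∨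
    ((∀ l, (l, e) ∈ ps → l ∉ A e) ∧ Disjoint Fut (A e) ∧ (e ∈ H ∨ ∀ l ∈ A e, Pre l))

theorem arrive_of_not_acc {f : Finset (Fin n) → ℝ} {L lo hi : ℕ} {x : Fin n} {st : St n}
    (h : ¬∃ ℓ, st.Acc f L lo hi false (some x) ℓ) : arrive f L lo hi false x st = st := by
  rw [arrive, if_neg h]
  exact tryItem_of_silent (not_exists.1 h) (by simp)

/-- The decisions in a window reveal labels only of items that end up on the shortlist or are only
observed.  So if the future `R` is worth at least `Ψ` whatever has been revealed, then this holds
before the window, too. -/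
theorem sum_reveal {f : Finset (Fin n) → ℝ} {L lo hi lab : ℕ} {Pre : ℕ → Prop} {Fut U : Finset ℕ}
    {I : St n → Prop} {R Ψ : (Fin n → ℕ) → St n → ℝ} (hlab : Pre lab)
    (hI : ∀ st pm x, I st → I (arrive f L lo hi pm x st))
    (hleaf : ∀ A st, (∀ e, A e ⊆ U) → Valid Pre Fut [] A st.H → I st →
      ∑ W ∈ Fintype.piFinset A, Ψ W st ≤ ∑ W ∈ Fintype.piFinset A, R W st)
    (ps : List (ℕ × Fin n)) (hps : ps.Nodup) (hFut : ∀ p ∈ ps, p.1 ∉ Fut)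
    (A : Fin n → Finset ℕ) (st : St n) (hU : ∀ e, A e ⊆ U) (hA : Valid Pre Fut ps A st.H)
    (hst : I st) :
    ∑ W ∈ Fintype.piFinset A, Ψ W (scanPairs f L lo hi lab W ps st) ≤
      ∑ W ∈ Fintype.piFinset A, R W (scanPairs f L lo hi lab W ps st) := by
  classical
  induction ps generalizing A st with
  | nil => exact hleaf A st hU hA hst
  | cons p ps ih =>
    obtain ⟨l, u⟩ := p
    rw [List.nodup_cons] at hps
    have hFut' : ∀ p ∈ ps, p.1 ∉ Fut := fun p hp => hFut p (List.mem_cons_of_mem _ hp)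
    have hlF : l ∉ Fut := hFut (l, u) (by simp)
    have hweak : Valid Pre Fut ps A st.H := fun e => by
      rcases hA e with ⟨h1, h2⟩ | ⟨h1, h2, h3⟩
      · exact Or.inl ⟨fun l' hl' => h1 l' (List.mem_cons_of_mem _ hl'), h2⟩
      · exact Or.inr ⟨fun l' hl' => h1 l' (List.mem_cons_of_mem _ hl'), h2, h3⟩
    have hcons : ∀ W, scanPairs f L lo hi lab W ((l, u) :: ps) st =
        scanPairs f L lo hi lab W ps
          (if W u = l then arrive f L lo hi (decide (l = lab)) u st else st) := fun W => rfl
    simp only [hcons]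
    have hU' : ∀ B ⊆ A u, ∀ e, Function.update A u B e ⊆ U := by
      intro B hB e
      by_cases he : e = u
      · subst he
        rw [Function.update_self]
        exact hB.trans (hU e)
      · rw [Function.update_of_ne he]
        exact hU e
    by_cases hlu : l ∈ A u
    · by_cases hsil : arrive f L lo hi (decide (l = lab)) u st = st
      · -- the arrival would change nothing, so that it need not be revealed whether `u` arrives
        simp only [hsil, ite_self]
        exact ih hps.2 hFut' A st hU hweak hst
      · rw [sum_piFinset_split A hlu, sum_piFinset_split A hlu]
        have hyes : ∀ W ∈ Fintype.piFinset (Function.update A u {l}), W u = l := by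
          intro W hW
          have := Fintype.mem_piFinset.1 hW u
          simpa using this
        have hno : ∀ W ∈ Fintype.piFinset (Function.update A u ((A u).erase l)), W u ≠ l := by
          intro W hW
          have := Fintype.mem_piFinset.1 hW u
          rw [Function.update_self, mem_erase] at this
          exact this.1
        refine add_le_add ?_ ?_
        · -- `u` arrives: it was only observed, or it is put on the shortlist
          rw [sum_congr rfl fun W hW => by rw [if_pos (hyes W hW)]]
          conv_rhs => rw [sum_congr rfl fun W hW => by rw [if_pos (hyes W hW)]]
          refine ih hps.2 hFut' _ _ (hU' _ (singleton_subset_iff.2 hlu)) (fun e => ?_)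
            (hI _ _ _ hst)
          by_cases he : e = u
          · subst he
            refine Or.inr ⟨fun l' hl' => ?_, ?_, ?_⟩
            · rw [Function.update_self, mem_singleton]
              rintro rfl
              exact hps.1 hl'
            · rw [Function.update_self, disjoint_singleton_right]
              exact hlF
            · by_cases hl : l = lab
              · right
                rw [Function.update_self]
                intro l' hl'
                rw [mem_singleton] at hl'
                rw [hl', hl]
                exact hlab
              · left
                simp only [hl, decide_false] at hsil ⊢
                obtain ⟨ℓ, hℓ⟩ := not_not.1 (mt arrive_of_not_acc hsil)
                exact (arrive_H f L lo hi false e st).2 ℓ hℓ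
          · rw [Function.update_of_ne he]
            rcases hweak e with h | ⟨h1, h2, h3⟩
            · exact Or.inl h
            · refine Or.inr ⟨h1, h2, h3.imp (fun h => ?_) id⟩
              have h4 := (arrive_H f L lo hi (decide (l = lab)) u st).1
                (List.mem_toFinset.2 h)
              exact List.mem_toFinset.1 h4
        · -- `u` does not arrive: all its other labels remain possible
          rw [sum_congr rfl fun W hW => by rw [if_neg (hno W hW)]]
          conv_rhs => rw [sum_congr rfl fun W hW => by rw [if_neg (hno W hW)]]
          refine ih hps.2 hFut' _ _ (hU' _ (erase_subset _ _)) (fun e => ?_) hst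
          by_cases he : e = u
          · subst he
            rw [Function.update_self]
            rcases hA e with ⟨h1, h2⟩ | ⟨h1, -⟩
            · refine Or.inl ⟨fun l' hl' => mem_erase.2 ⟨?_, h1 l' (List.mem_cons_of_mem _ hl')⟩,
                fun x hx => mem_erase.2 ⟨?_, h2 hx⟩⟩
              · rintro rfl
                exact hps.1 hl'
              · rintro rfl
                exact hlF hx
            · exact absurd hlu (h1 l (by simp))
          · rw [Function.update_of_ne he]
            exact hweak e
    · have hno : ∀ W ∈ Fintype.piFinset A, W u ≠ l := by
        rintro W hW rfl
        exact hlu (Fintype.mem_piFinset.1 hW u)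
      rw [sum_congr rfl fun W hW => by rw [if_neg (hno W hW)]]
      conv_rhs => rw [sum_congr rfl fun W hW => by rw [if_neg (hno W hW)]]
      exact ih hps.2 hFut' A st hU hweak hst

end ShortlistSecretary

namespace ShortlistSecretary

variable {n : ℕ}

/-! ### The value of the solutions during a window -/

theorem IsMonotoneSubmodular.le_add_sum {f : Finset (Fin n) → ℝ} (hf : IsMonotoneSubmodular f)
    (S T : Finset (Fin n)) : f (S ∪ T) ≤ f S + ∑ o ∈ T, (f (S ∪ {o}) - f S) := by
  induction T using Finset.induction_on with
  | empty => simp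
  | insert a T ha ih =>
    have h1 := hf.submodular (S ∪ T) (S ∪ {a})
    have h2 := hf.mono S ((S ∪ T) ∩ (S ∪ {a})) fun x hx => by simp [hx]
    have h3 : S ∪ T ∪ (S ∪ {a}) = S ∪ insert a T := by
      ext x
      simp only [mem_union, mem_singleton, mem_insert]
      tauto
    rw [h3] at h1
    rw [sum_insert ha]
    linarith

section Merge

variable {f : Finset (Fin n) → ℝ} (S : ℕ → Finset (Fin n))

theorem le_merge (a ℓ : ℕ) : f (S ℓ) ≤ f (merge f a S ℓ) := by
  unfold merge
  split_ifs with h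
  · rw [h.1]
    exact h.2.le
  · exact le_rfl

theorem le_merge_succ (a : ℕ) : f (S a) ≤ f (merge f a S (a + 1)) := by
  unfold merge
  split_ifs with h
  · exact le_rfl
  · exact not_lt.1 fun h' => h ⟨rfl, h'⟩

theorem le_mergeUp (a t ℓ : ℕ) : f (S ℓ) ≤ f (mergeUp f a t S ℓ) := by
  induction t with
  | zero => exact le_rfl
  | succ t ih => exact ih.trans (le_merge _ _ _)

theorem le_mergeUp_top (a t : ℕ) {ℓ : ℕ} (h1 : a ≤ ℓ) (h2 : ℓ ≤ a + t) :
    f (S ℓ) ≤ f (mergeUp f a t S (a + t)) := by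
  induction t with
  | zero =>
    obtain rfl : ℓ = a := by omega
    exact le_rfl
  | succ t ih =>
    rcases Nat.lt_or_ge ℓ (a + (t + 1)) with h | h
    · exact (ih (by omega)).trans (le_merge_succ _ (a + t))
    · obtain rfl : ℓ = a + (t + 1) := by omega
      exact le_mergeUp S a (t + 1) _

end Merge

theorem le_tryItem (f : Finset (Fin n) → ℝ) (L lo hi : ℕ) (pm : Bool) (inc : ℕ)
    (x : Option (Fin n)) (st : St n) (ℓ : ℕ) :
    f (st.N ℓ) ≤ f ((tryItem f L lo hi pm inc x st).N ℓ) := by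
  simp only [tryItem]
  split_ifs with h
  · exact h.2.2.2.1.le
  · exact le_rfl

theorem le_arrive (f : Finset (Fin n) → ℝ) (L lo hi : ℕ) (pm : Bool) (x : Fin n) (st : St n)
    (ℓ : ℕ) : f (st.N ℓ) ≤ f ((arrive f L lo hi pm x st).N ℓ) := by
  rw [arrive_N]
  exact le_tryItem f L lo hi pm 1 (some x) st ℓ

theorem le_scanPairs_N (f : Finset (Fin n) → ℝ) (L lo hi lab : ℕ) (W : Fin n → ℕ)
    (ps : List (ℕ × Fin n)) (st : St n) (ℓ : ℕ) :
    f (st.N ℓ) ≤ f ((scanPairs f L lo hi lab W ps st).N ℓ) := by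
  induction ps generalizing st with
  | nil => exact le_rfl
  | cons p ps ih =>
    refine le_trans ?_ (ih _)
    dsimp only
    split_ifs
    · exact le_arrive f L lo hi _ p.2 st ℓ
    · exact le_rfl

theorem le_scan_N (f : Finset (Fin n) → ℝ) (L lo hi : ℕ) (blk : ℕ → List (Fin n)) (lab D : ℕ)
    (st : St n) (ℓ : ℕ) : f (st.N ℓ) ≤ f ((scan f L lo hi blk lab D st).N ℓ) := by
  induction D with
  | zero => exact le_rfl
  | succ D ih =>
    rw [scan_succ]
    refine ih.trans ?_
    generalize scan f L lo hi blk lab D st = s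
    induction blk (lab + D) generalizing s with
    | nil => exact le_rfl
    | cons x l ih' => exact (le_arrive f L lo hi _ x s ℓ).trans (ih' _)

/-- The state after old items were sampled, in a window that started with the data `x`. -/
structure Sampled (f : Finset (Fin n) → ℝ) (x : Cf n) (st : St n) : Prop where
  S : st.S = x.1
  H : st.H = x.2
  tv : ∀ ℓ, st.tv ℓ = f (st.N ℓ)
  c : ∀ ℓ, st.c ℓ = 0
  le : ∀ ℓ, f (x.1 ℓ) ≤ f (st.N ℓ)

section Samples

variable {f : Finset (Fin n) → ℝ} {L lo hi : ℕ} {x : Cf n}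

theorem sampled_clean : Sampled f x (clean f x.1 x.2) :=
  ⟨rfl, rfl, fun _ => rfl, fun _ => rfl, fun _ => le_rfl⟩

theorem Sampled.tryItem {st : St n} (h : Sampled f x st) (y : Option (Fin n)) :
    Sampled f x (tryItem f L lo hi false 0 y st) where
  S := h.S
  H := h.H
  tv := fun ℓ => by
    by_cases ha : st.Acc f L lo hi false y ℓ
    · simp [ShortlistSecretary.tryItem, ha]
    · simpa [ShortlistSecretary.tryItem, ha] using h.tv ℓ
  c := fun ℓ => by simpa [ShortlistSecretary.tryItem] using h.c ℓ
  le := fun ℓ => (h.le ℓ).trans (le_tryItem f L lo hi false 0 y st ℓ)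

/-- An item that is sampled is not missed. -/
theorem Sampled.le_tryItem_some {st : St n} (h : Sampled f x st) (hL : 0 < L) (o : Fin n) {ℓ : ℕ}
    (hlo : lo ≤ ℓ) (hhi : ℓ < hi) :
    f (x.1 ℓ ∪ {o}) ≤ f ((ShortlistSecretary.tryItem f L lo hi false 0 (some o) st).N (ℓ + 1)) := by
  have hc : st.cand (some o) (ℓ + 1) = x.1 ℓ ∪ {o} := by
    rw [St.cand, h.S]
    simp [tokenSet]
  simp only [ShortlistSecretary.tryItem]
  split_ifs with ha
  · rw [hc]
  · by_contra hlt
    rw [not_le, ← hc] at hlt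
    refine ha ⟨by omega, by omega, rfl, hlt, ?_, ?_⟩
    · rw [h.tv]
      exact hlt.le.not_gt
    · rw [h.c]
      exact hL

/-- Samples from the items on the shortlist, with the positions in `l`. -/
noncomputable def trySamples (f : Finset (Fin n) → ℝ) (L lo hi : ℕ) (l : List ℕ) (st : St n) :
    St n :=
  l.foldl (fun st q => tryItem f L lo hi false 0 (st.H[q]?) st) st

theorem Sampled.trySamples {st : St n} (h : Sampled f x st) (l : List ℕ) :
    Sampled f x (trySamples f L lo hi l st) := by
  induction l generalizing st with
  | nil => exact h
  | cons q l ih => exact ih (h.tryItem _)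

theorem St.Good.trySamples {st : St n} {b : ℕ} (h : st.Good f L lo hi b) (l : List ℕ) :
    (trySamples f L lo hi l st).Good f L lo hi b := by
  induction l generalizing st with
  | nil => exact h
  | cons q l ih => exact ih (h.tryItem fun y hy => List.mem_of_getElem? hy)

theorem le_trySamples (l : List ℕ) (st : St n) (ℓ : ℕ) :
    f (st.N ℓ) ≤ f ((trySamples f L lo hi l st).N ℓ) := by
  induction l generalizing st with
  | nil => exact le_rfl
  | cons q l ih => exact (le_tryItem f L lo hi false 0 _ st ℓ).trans (ih _)

theorem Sampled.le_trySamples_of_mem {st : St n} (h : Sampled f x st) (hL : 0 < L) {o : Fin n}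
    {q : ℕ} (hq : x.2[q]? = some o) {l : List ℕ} (hl : q ∈ l) {ℓ : ℕ}
    (hlo : lo ≤ ℓ) (hhi : ℓ < hi) :
    f (x.1 ℓ ∪ {o}) ≤ f ((ShortlistSecretary.trySamples f L lo hi l st).N (ℓ + 1)) := by
  induction l generalizing st with
  | nil => simp at hl
  | cons q' l ih =>
    rcases List.mem_cons.1 hl with rfl | hl
    · refine le_trans ?_ (le_trySamples l _ (ℓ + 1))
      dsimp only
      rw [h.H, hq]
      exact h.le_tryItem_some hL o hlo hhi
    · exact ih (h.tryItem _) hl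

end Samples

/-- The positions that are sampled in a window, when `s` are the random numbers. -/
def positions (P : Par) (s : Fin P.Q → Fin (P.R1 + 1)) : List ℕ :=
  List.ofFn fun i => (i : ℕ) * P.stride + s i

theorem E_samples (f : Finset (Fin n) → ℝ) (P : Par) (j : ℕ) (x : Cf n) (g : St n → ℝ) :
    (samples f P j x).E g = (∑ s : Fin P.Q → Fin (P.R1 + 1),
      g (trySamples f P.L (P.lo j) (P.hi j) (positions P s) (clean f x.1 x.2))) /
        (P.R1 + 1) ^ P.Q := by
  have h := E_iter_rand P.Q P.R1 (fun i h st => tryItem f P.L (P.lo j) (P.hi j) false 0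
    (st.H[i * P.stride + h]?) st) (clean f x.1 x.2) g
  rw [samples]
  refine Eq.trans h ?_
  congr 1
  refine sum_congr rfl fun s _ => ?_
  congr 1
  rw [trySamples, positions, List.ofFn_eq_map, List.ofFn_eq_map, List.foldl_map, List.foldl_map]

theorem E_window (f : Finset (Fin n) → ℝ) (P : Par) (blk : ℕ → List (Fin n)) (j : ℕ) (x : Cf n)
    (g : Cf n → ℝ) : (window f P blk j x).E g = (∑ s : Fin P.Q → Fin (P.R1 + 1),
      g (finish f P blk j (trySamples f P.L (P.lo j) (P.hi j) (positions P s)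
        (clean f x.1 x.2)))) / (P.R1 + 1) ^ P.Q := by
  rw [window, Rnd.E_bind, E_samples]
  rfl

/-- The expected value of the solution that is returned, when `t` windows remain, beginning with
window `j`. -/
noncomputable def rest (f : Finset (Fin n) → ℝ) (P : Par) (blk : ℕ → List (Fin n)) (t j : ℕ)
    (x : Cf n) : ℝ :=
  (Rnd.iter t (fun i => window f P blk (j + i)) x).E fun y => f (answer f P y)

theorem rest_zero (f : Finset (Fin n) → ℝ) (P : Par) (blk : ℕ → List (Fin n)) (j : ℕ) (x : Cf n) :
    rest f P blk 0 j x = f (answer f P x) := rfl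

theorem rest_succ (f : Finset (Fin n) → ℝ) (P : Par) (blk : ℕ → List (Fin n)) (t j : ℕ)
    (x : Cf n) : rest f P blk (t + 1) j x = (window f P blk j x).E (rest f P blk t (j + 1)) := by
  rw [rest, Rnd.iter, Rnd.E_bind]
  have h : (fun i => window f P blk (j + (i + 1))) = fun i => window f P blk (j + 1 + i) := by
    funext i
    congr 1
    omega
  rw [h]
  rfl

theorem le_rest {f : Finset (Fin n) → ℝ} {P : Par} (blk : ℕ → List (Fin n)) (t j : ℕ)
    (x : Cf n) : f (x.1 P.K) ≤ rest f P blk t j x := by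
  induction t generalizing j x with
  | zero => exact le_mergeUp _ _ _ _
  | succ t ih =>
    rw [rest_succ, E_window, le_div_iff₀ (by positivity)]
    have h1 : ∀ s ∈ (univ : Finset (Fin P.Q → Fin (P.R1 + 1))), f (x.1 P.K) ≤
        rest f P blk t (j + 1) (finish f P blk j (trySamples f P.L (P.lo j) (P.hi j)
          (positions P s) (clean f x.1 x.2))) := fun s _ => by
      refine le_trans ?_ (ih _ _)
      refine le_trans ?_ (le_mergeUp _ _ _ _)
      exact ((sampled_clean.trySamples _).le _).trans (le_scan_N _ _ _ _ _ _ _ _ _)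
    have h2 := card_nsmul_le_sum _ _ _ h1
    simpa [mul_comm] using h2

end ShortlistSecretary

namespace ShortlistSecretary

variable {n : ℕ}

/-! ### The gain of a window -/

theorem one_sub_sum_le_prod {ι : Type} (s : Finset ι) (a : ι → ℝ)
    (h : ∀ i ∈ s, 0 ≤ a i ∧ a i ≤ 1) : 1 - ∑ i ∈ s, a i ≤ ∏ i ∈ s, (1 - a i) := by
  classical
  induction s using Finset.induction_on with
  | empty => simp
  | insert i s hi ih =>
    rw [sum_insert hi, prod_insert hi]
    have h1 := h i (mem_insert_self i s)
    have h2 := ih fun j hj => h j (mem_insert_of_mem hj)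
    have h3 : 0 ≤ ∑ j ∈ s, a j := sum_nonneg fun j hj => (h j (mem_insert_of_mem hj)).1
    have h4 := mul_le_mul_of_nonneg_left h2 (sub_nonneg.2 h1.2)
    nlinarith [h1.1]

/-- If every `x o` with `e o ≠ 0` is at most `M`, then the chance that no smaller item counts
bounds the weight of `x o`. -/
theorem sum_thinned_le {O : Finset (Fin n)} {a e x : Fin n → ℝ} {M : ℝ}
    (ha : ∀ o ∈ O, 0 ≤ a o ∧ a o ≤ 1) (he : ∀ o ∈ O, e o = 0 ∨ (e o = a o ∧ x o ≤ M))
    (hx : ∀ o ∈ O, 0 ≤ x o) (hM : 0 ≤ M) :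
    ∑ o ∈ O, x o * (e o - ∑ o' ∈ O with o' < o, a o * a o') ≤ M := by
  have h1 : ∀ o ∈ O, x o * (e o - ∑ o' ∈ O with o' < o, a o * a o') ≤
      M * (a o * ∏ o' ∈ O with o' < o, (1 - a o')) := by
    intro o ho
    have h2 : ∀ o' ∈ O.filter (· < o), 0 ≤ a o' ∧ a o' ≤ 1 := fun o' ho' =>
      ha o' (mem_filter.1 ho').1
    have h3 := one_sub_sum_le_prod _ a h2
    have h4 : 0 ≤ ∑ o' ∈ O with o' < o, a o' := sum_nonneg fun o' ho' => (h2 o' ho').1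
    have h5 : 0 ≤ ∏ o' ∈ O with o' < o, (1 - a o') :=
      prod_nonneg fun o' ho' => sub_nonneg.2 (h2 o' ho').2
    have h6 := (ha o ho).1
    have h7 := hx o ho
    rw [← mul_sum]
    rcases he o ho with h8 | ⟨h8, h9⟩
    · rw [h8, zero_sub, mul_neg]
      have : 0 ≤ x o * (a o * ∑ o' ∈ O with o' < o, a o') := by positivity
      have : 0 ≤ M * (a o * ∏ o' ∈ O with o' < o, (1 - a o')) := by positivity
      linarith
    · rw [h8]
      calc x o * (a o - a o * ∑ o' ∈ O with o' < o, a o')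
          = x o * (a o * (1 - ∑ o' ∈ O with o' < o, a o')) := by ring
        _ ≤ x o * (a o * ∏ o' ∈ O with o' < o, (1 - a o')) := by gcongr
        _ ≤ _ := by gcongr
  refine (sum_le_sum h1).trans ?_
  rw [← mul_sum]
  have h2 := prod_one_sub_ordered O a
  have h3 : 0 ≤ ∏ o ∈ O, (1 - a o) := prod_nonneg fun o ho => sub_nonneg.2 (ha o ho).2
  have h4 : ∑ o ∈ O, a o * ∏ o' ∈ O with o' < o, (1 - a o') ≤ 1 := by linarith
  exact mul_le_of_le_one_right hM h4

/-- `sum_thinned_le` on average. -/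
theorem sum_gain_le {τ : Type} (Z : Finset τ) {O : Finset (Fin n)} {a e : Fin n → τ → ℝ}
    {x : Fin n → ℝ} {M : τ → ℝ} {p q : ℝ}
    (ha : ∀ o ∈ O, ∀ z ∈ Z, 0 ≤ a o z ∧ a o z ≤ 1)
    (he : ∀ o ∈ O, ∀ z ∈ Z, e o z = 0 ∨ (e o z = a o z ∧ x o ≤ M z))
    (hx : ∀ o ∈ O, 0 ≤ x o) (hM : ∀ z ∈ Z, 0 ≤ M z)
    (hmean : ∀ o ∈ O, p * Z.card ≤ ∑ z ∈ Z, e o z)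
    (hpair : ∀ o ∈ O, ∀ o' ∈ O, o ≠ o' → ∑ z ∈ Z, a o z * a o' z ≤ q * Z.card) (hq : 0 ≤ q) :
    (∑ o ∈ O, x o) * (p - O.card * q) * Z.card ≤ ∑ z ∈ Z, M z := by
  calc (∑ o ∈ O, x o) * (p - O.card * q) * Z.card
      = ∑ o ∈ O, x o * (p * Z.card - O.card * (q * Z.card)) := by
        rw [mul_assoc, sum_mul]
        refine sum_congr rfl fun o _ => ?_
        ring
    _ ≤ ∑ o ∈ O, x o * (∑ z ∈ Z, e o z - ∑ o' ∈ O with o' < o, ∑ z ∈ Z, a o z * a o' z) := by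
        refine sum_le_sum fun o ho => mul_le_mul_of_nonneg_left ?_ (hx o ho)
        have h1 : ∑ o' ∈ O with o' < o, ∑ z ∈ Z, a o z * a o' z ≤
            ∑ o' ∈ O with o' < o, q * Z.card := by
          refine sum_le_sum fun o' ho' => ?_
          rw [mem_filter] at ho'
          exact hpair o ho o' ho'.1 ho'.2.ne'
        rw [sum_const, nsmul_eq_mul] at h1
        have h2 : ((O.filter (· < o)).card : ℝ) ≤ O.card := by exact_mod_cast card_filter_le _ _
        have h3 : 0 ≤ q * Z.card := by positivity
        have h4 := mul_le_mul_of_nonneg_right h2 h3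
        linarith [hmean o ho]
    _ = ∑ z ∈ Z, ∑ o ∈ O, x o * (e o z - ∑ o' ∈ O with o' < o, a o z * a o' z) := by
        rw [sum_comm]
        refine sum_congr rfl fun o _ => ?_
        rw [← mul_sum, sum_sub_distrib]
        congr 2
        exact sum_comm
    _ ≤ _ := sum_le_sum fun z hz =>
        sum_thinned_le (fun o ho => ha o ho z hz) (fun o ho => he o ho z hz) hx (hM z hz)

section Draws

variable {Q b : ℕ}

/-- Random numbers in `{0, …, b}`, the `i`-th one shifted by `i * (b + 1)`, hit the number `q`. -/
def Hit (q : ℕ) (s : Fin Q → Fin (b + 1)) : Prop := ∃ i : Fin Q, (i : ℕ) * (b + 1) + s i = q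

theorem hit_iff {q : ℕ} (hq : q / (b + 1) < Q) (s : Fin Q → Fin (b + 1)) :
    Hit q s ↔ (s ⟨q / (b + 1), hq⟩ : ℕ) ∈ ({q % (b + 1)} : Finset ℕ) := by
  rw [mem_singleton]
  constructor
  · rintro ⟨i, hi⟩
    have h1 : (s i : ℕ) < b + 1 := (s i).isLt
    have h2 : q / (b + 1) = i := by
      rw [← hi, mul_comm, Nat.mul_add_div (by omega), Nat.div_eq_of_lt h1, add_zero]
    have h3 : q % (b + 1) = s i := by
      rw [← hi, mul_comm, Nat.mul_add_mod, Nat.mod_eq_of_lt h1]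
    have h4 : (⟨q / (b + 1), hq⟩ : Fin Q) = i := Fin.ext h2
    rw [h4, h3]
  · intro h
    refine ⟨⟨q / (b + 1), hq⟩, ?_⟩
    rw [h, mul_comm]
    exact Nat.div_add_mod q (b + 1)

theorem card_draws :
    ((Fintype.piFinset fun _ : Fin Q => range (b + 1)).card : ℝ) = ((b : ℝ) + 1) ^ Q := by
  simp

open Classical in
theorem sum_hit {q : ℕ} (hq : q < Q * (b + 1)) :
    ((b : ℝ) + 1) * ∑ s : Fin Q → Fin (b + 1), (if Hit q s then (1 : ℝ) else 0) =
      ((b : ℝ) + 1) ^ Q := by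
  have hq' : q / (b + 1) < Q := (Nat.div_lt_iff_lt_mul (by omega)).2 hq
  have h := card_mul_sum_mem (fun _ : Fin Q => range (b + 1)) ⟨q / (b + 1), hq'⟩
    (J := {q % (b + 1)}) (singleton_subset_iff.2 (mem_range.2 (Nat.mod_lt _ (by omega))))
    (F := fun _ => 1) (fun _ _ => rfl)
  rw [← sum_fin_eq_sum_piFinset (b + 1) (fun V : Fin Q → ℕ =>
    if V ⟨q / (b + 1), hq'⟩ ∈ ({q % (b + 1)} : Finset ℕ) then (1 : ℝ) else 0)] at h
  simp only [sum_const, card_draws, nsmul_eq_mul, mul_one, card_range, card_singleton,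
    Nat.cast_one, one_mul, Nat.cast_add] at h
  rw [← h]
  congr 1
  exact sum_congr rfl fun s _ => if_congr (hit_iff hq' s) rfl rfl

open Classical in
theorem sum_hit_hit {q q' : ℕ} (hq : q < Q * (b + 1)) (hq' : q' < Q * (b + 1)) (hne : q ≠ q') :
    ((b : ℝ) + 1) ^ 2 * ∑ s : Fin Q → Fin (b + 1),
      (if Hit q s then (1 : ℝ) else 0) * (if Hit q' s then 1 else 0) ≤ ((b : ℝ) + 1) ^ Q := by
  have h1 : q / (b + 1) < Q := (Nat.div_lt_iff_lt_mul (by omega)).2 hq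
  have h2 : q' / (b + 1) < Q := (Nat.div_lt_iff_lt_mul (by omega)).2 hq'
  by_cases heq : q / (b + 1) = q' / (b + 1)
  · rw [sum_eq_zero, mul_zero]
    · positivity
    · intro s _
      by_contra h0
      have h : Hit q s ∧ Hit q' s := by
        by_contra h
        rcases not_and_or.1 h with h | h <;> simp [h] at h0
      rw [hit_iff h1, hit_iff h2, mem_singleton, mem_singleton] at h
      have h3 : (⟨q / (b + 1), h1⟩ : Fin Q) = ⟨q' / (b + 1), h2⟩ := Fin.ext heq
      rw [h3] at h
      have h4 := h.1.symm.trans h.2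
      have h5 := Nat.div_add_mod q (b + 1)
      have h6 := Nat.div_add_mod q' (b + 1)
      rw [heq, h4] at h5
      exact hne (h5.symm.trans h6)
  · have hi : (⟨q / (b + 1), h1⟩ : Fin Q) ≠ ⟨q' / (b + 1), h2⟩ := fun h => heq (Fin.mk.inj_iff.1 h)
    have h := card_mul_card_mul_sum_mem (fun _ : Fin Q => range (b + 1)) hi
      (J := {q % (b + 1)}) (singleton_subset_iff.2 (mem_range.2 (Nat.mod_lt _ (by omega))))
      (J' := {q' % (b + 1)}) (singleton_subset_iff.2 (mem_range.2 (Nat.mod_lt _ (by omega))))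
    rw [← sum_fin_eq_sum_piFinset (b + 1) (fun V : Fin Q → ℕ =>
      (if V ⟨q / (b + 1), h1⟩ ∈ ({q % (b + 1)} : Finset ℕ) then (1 : ℝ) else 0) *
      (if V ⟨q' / (b + 1), h2⟩ ∈ ({q' % (b + 1)} : Finset ℕ) then 1 else 0))] at h
    simp only [card_draws, card_range, card_singleton, Nat.cast_one, one_mul, Nat.cast_add] at h
    rw [← h, pow_two, mul_assoc]
    refine le_of_eq ?_
    congr 2
    exact sum_congr rfl fun s _ => congrArg₂ _ (if_congr (hit_iff h1 s) rfl rfl)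
      (if_congr (hit_iff h2 s) rfl rfl)

end Draws

section Gain

variable {Q b D lab L : ℕ} {r : Fin n → ℕ} {A : Fin n → Finset ℕ} {H : List (Fin n)}

open Classical in
/-- The items `o` for which all labels of the window are possible arrive in the window with
probability at least `1 / (b + 1)`, and those on the shortlist are sampled with probability
`1 / (b + 1)`; these events are independent.  If finding `o` is worth `x o`, then this bounds the
expected gain `M` from below. -/
theorem window_gain {O : Finset (Fin n)} {x : Fin n → ℝ}
    {M : (Fin Q → Fin (b + 1)) → (Fin n → ℕ) → ℝ} (hD : 0 < D)
    (hL : (D : ℝ) ^ 2 ≤ (3 / 2) ^ (L - 2)) (hr : Function.Injective r)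
    (hA : ∀ e, Ico lab (lab + D) ⊆ A e ∨ Disjoint (Ico lab (lab + D)) (A e))
    (hU : ∀ e, A e ⊆ range ((b + 1) * D)) (hH : H.length ≤ Q * (b + 1))
    (hO : ∀ o ∈ O, Ico lab (lab + D) ⊆ A o ∨ o ∈ H) (hx : ∀ o ∈ O, 0 ≤ x o)
    (hM : ∀ s W, 0 ≤ M s W)
    (hnew : ∀ o ∈ O, ∀ s W, W o ∈ Ioo lab (lab + D) → ¬Bad lab D L r o W → x o ≤ M s W)
    (hold : ∀ o ∈ O, ∀ s W q, H[q]? = some o → Hit q s → x o ≤ M s W) :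
    (∑ o ∈ O, x o) * ((1 - 3 / D) / (b + 1) - O.card * (1 / ((b : ℝ) + 1) ^ 2)) *
        (((b : ℝ) + 1) ^ Q * (Fintype.piFinset A).card) ≤
      ∑ s, ∑ W ∈ Fintype.piFinset A, M s W := by
  have hD' : (0 : ℝ) < D := by exact_mod_cast hD
  have hb : (0 : ℝ) < (b : ℝ) + 1 := by positivity
  let u : Fin n → (Fin Q → Fin (b + 1)) → ℝ := fun o s =>
    if Ico lab (lab + D) ⊆ A o then 1 else if Hit (H.idxOf o) s then 1 else 0
  -- the factor thins out the arrivals in the window to probability exactly `1 / (b + 1)`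
  let v : Fin n → (Fin n → ℕ) → ℝ := fun o W =>
    if Ico lab (lab + D) ⊆ A o then
      ((A o).card : ℝ) / ((b + 1) * D) * (if W o ∈ Ico lab (lab + D) then 1 else 0) else 1
  let e : Fin n → (Fin Q → Fin (b + 1)) × (Fin n → ℕ) → ℝ := fun o z =>
    if Ico lab (lab + D) ⊆ A o then
      ((A o).card : ℝ) / ((b + 1) * D) *
        (if z.2 o ∈ Ioo lab (lab + D) ∧ ¬Bad lab D L r o z.2 then 1 else 0)
    else u o z.1
  have hcard : ∀ o, 0 ≤ ((A o).card : ℝ) / ((b + 1) * D) ∧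
      ((A o).card : ℝ) / ((b + 1) * D) ≤ 1 := by
    intro o
    refine ⟨by positivity, ?_⟩
    rw [div_le_one (by positivity)]
    have := card_le_card (hU o)
    rw [card_range] at this
    exact_mod_cast this
  have hpos : ∀ o, Ico lab (lab + D) ⊆ A o → (0 : ℝ) < (A o).card := by
    intro o ho
    have h1 : lab ∈ A o := ho (by simp [hD])
    exact_mod_cast card_pos.2 ⟨lab, h1⟩
  have hidx : ∀ o ∈ O, ¬Ico lab (lab + D) ⊆ A o → H.idxOf o < Q * (b + 1) ∧
      H[H.idxOf o]? = some o := by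
    intro o ho h
    have h1 := (hO o ho).resolve_left h
    have h2 := List.idxOf_lt_length_of_mem h1
    refine ⟨h2.trans_le hH, ?_⟩
    rw [List.getElem?_eq_getElem h2, List.getElem_idxOf]
  have hZ : ((univ ×ˢ Fintype.piFinset A : Finset ((Fin Q → Fin (b + 1)) × (Fin n → ℕ))).card : ℝ) =
      ((b : ℝ) + 1) ^ Q * (Fintype.piFinset A).card := by
    rw [card_product, card_univ]
    simp
  have hI : ((Ico lab (lab + D)).card : ℝ) = D := by
    rw [Nat.card_Ico, Nat.add_sub_cancel_left]
  -- the averages of `u`, `v` and their products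
  have hu1 : ∀ o ∈ O, ∑ s, u o s =
      (if Ico lab (lab + D) ⊆ A o then 1 else 1 / ((b : ℝ) + 1)) * ((b : ℝ) + 1) ^ Q := by
    intro o ho
    by_cases h : Ico lab (lab + D) ⊆ A o
    · simp [u, h]
    · have h1 := sum_hit (Q := Q) (b := b) (hidx o ho h).1
      simp only [u, h, if_false]
      rw [← h1]
      field_simp
  have hv1 : ∀ o, ∑ W ∈ Fintype.piFinset A, v o W =
      (if Ico lab (lab + D) ⊆ A o then 1 / ((b : ℝ) + 1) else 1) * (Fintype.piFinset A).card := by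
    intro o
    by_cases h : Ico lab (lab + D) ⊆ A o
    · have h1 := card_mul_sum_mem A o h (F := fun _ => 1) (fun _ _ => rfl)
      rw [sum_const, nsmul_eq_mul, mul_one, hI] at h1
      simp only [v, h, if_true]
      rw [← mul_sum, div_mul_eq_mul_div, h1]
      field_simp
    · simp [v, h]
  have hu2 : ∀ o ∈ O, ∀ o' ∈ O, o ≠ o' → ∑ s, u o s * u o' s ≤
      (if Ico lab (lab + D) ⊆ A o then 1 else 1 / ((b : ℝ) + 1)) *
      (if Ico lab (lab + D) ⊆ A o' then 1 else 1 / ((b : ℝ) + 1)) * ((b : ℝ) + 1) ^ Q := by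
    intro o ho o' ho' hne
    by_cases h : Ico lab (lab + D) ⊆ A o
    · have h1 := hu1 o' ho'
      rw [if_pos h, one_mul, ← h1]
      simp [u, h]
    · by_cases h' : Ico lab (lab + D) ⊆ A o'
      · have h1 := hu1 o ho
        rw [if_pos h', mul_one, ← h1]
        simp [u, h']
      · have h1 := hidx o ho h
        have h1' := hidx o' ho' h'
        have h2 := sum_hit_hit (Q := Q) (b := b) h1.1 h1'.1 (fun h3 => hne (by
          have := h1.2
          rw [h3, h1'.2] at this
          exact (Option.some.inj this).symm))
        simp only [u, h, h', if_false]
        refine le_of_mul_le_mul_left (h2.trans (le_of_eq ?_)) (pow_pos hb 2)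
        field_simp
  have hv2 : ∀ o ∈ O, ∀ o' ∈ O, o ≠ o' → ∑ W ∈ Fintype.piFinset A, v o W * v o' W ≤
      (if Ico lab (lab + D) ⊆ A o then 1 / ((b : ℝ) + 1) else 1) *
      (if Ico lab (lab + D) ⊆ A o' then 1 / ((b : ℝ) + 1) else 1) *
        (Fintype.piFinset A).card := by
    intro o _ o' _ hne
    by_cases h : Ico lab (lab + D) ⊆ A o
    · by_cases h' : Ico lab (lab + D) ⊆ A o'
      · have h1 := card_mul_card_mul_sum_mem A hne h h'
        have h2 := hpos o h
        have h3 := hpos o' h'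
        rw [hI] at h1
        simp only [v, h, h', if_true]
        have h4 : ∀ W : Fin n → ℕ, ((A o).card : ℝ) / ((b + 1) * D) *
            (if W o ∈ Ico lab (lab + D) then 1 else 0) * (((A o').card : ℝ) / ((b + 1) * D) *
            (if W o' ∈ Ico lab (lab + D) then 1 else 0)) =
            1 / (((b : ℝ) + 1) * D * ((b + 1) * D)) * ((A o).card * ((A o').card *
            ((if W o ∈ Ico lab (lab + D) then (1 : ℝ) else 0) *
            (if W o' ∈ Ico lab (lab + D) then 1 else 0)))) := by
          intro W
          generalize (if W o ∈ Ico lab (lab + D) then (1 : ℝ) else 0) = c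
          generalize (if W o' ∈ Ico lab (lab + D) then (1 : ℝ) else 0) = c'
          field_simp
        simp only [h4]
        rw [← mul_sum, ← mul_sum, ← mul_sum, h1]
        refine le_of_eq ?_
        field_simp
      · have h1 := hv1 o
        rw [if_neg h', mul_one, ← h1]
        simp [v, h']
    · have h1 := hv1 o'
      rw [if_neg h, one_mul, ← h1]
      simp [v, h]
  have hprod : ∀ o : Fin n, (if Ico lab (lab + D) ⊆ A o then 1 else 1 / ((b : ℝ) + 1)) *
      (if Ico lab (lab + D) ⊆ A o then 1 / ((b : ℝ) + 1) else 1) = 1 / ((b : ℝ) + 1) := by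
    intro o
    split_ifs <;> simp
  rw [← hZ, ← sum_product (f := fun z : (Fin Q → Fin (b + 1)) × (Fin n → ℕ) => M z.1 z.2)]
  refine sum_gain_le (univ ×ˢ Fintype.piFinset A) (a := fun o z => u o z.1 * v o z.2) (e := e)
    ?_ ?_ hx (fun z _ => hM z.1 z.2) ?_ ?_ (by positivity)
  · intro o _ z _
    have h1 := hcard o
    simp only [u, v]
    split_ifs <;> simp [h1]
  · intro o ho z _
    by_cases h : Ico lab (lab + D) ⊆ A o
    · by_cases hz : z.2 o ∈ Ioo lab (lab + D) ∧ ¬Bad lab D L r o z.2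
      · right
        have h1 : z.2 o ∈ Ico lab (lab + D) := Ioo_subset_Ico_self hz.1
        refine ⟨?_, hnew o ho _ _ hz.1 hz.2⟩
        simp only [e, u, v]
        rw [if_pos h, if_pos h, if_pos h, if_pos hz, if_pos h1, one_mul]
      · left
        simp only [e]
        rw [if_pos h, if_neg hz, mul_zero]
    · by_cases hz : Hit (H.idxOf o) z.1
      · right
        refine ⟨by simp [e, v, h], hold o ho _ _ _ (hidx o ho h).2 hz⟩
      · left
        simp [e, u, h, hz]
  · intro o ho
    rw [hZ, sum_product]
    by_cases h : Ico lab (lab + D) ⊆ A o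
    · have h1 := le_sum_not_bad hD hL hr hA h
      have h5 : ∀ s W, e o (s, W) = ((A o).card : ℝ) / ((b + 1) * D) *
          (if W o ∈ Ioo lab (lab + D) ∧ ¬Bad lab D L r o W then 1 else 0) := fun s W => by
        simp only [e]
        rw [if_pos h]
      simp only [h5, ← mul_sum]
      have h2 : ((Fintype.card (Fin Q → Fin (b + 1)) : ℕ) : ℝ) = ((b : ℝ) + 1) ^ Q := by simp
      generalize ∑ W ∈ Fintype.piFinset A,
        (if W o ∈ Ioo lab (lab + D) ∧ ¬Bad lab D L r o W then (1 : ℝ) else 0) = X at h1 ⊢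
      rw [sum_const, nsmul_eq_mul, card_univ, h2]
      have h3 : (1 - 3 / (D : ℝ)) / (b + 1) * (((b : ℝ) + 1) ^ Q * (Fintype.piFinset A).card) =
          ((b : ℝ) + 1) ^ Q / ((b + 1) * D) * ((D - 3) * (Fintype.piFinset A).card) := by
        field_simp
      have h4 : (A o).card / ((b + 1) * D) * (((b : ℝ) + 1) ^ Q * X) =
          ((b : ℝ) + 1) ^ Q / ((b + 1) * D) * ((A o).card * X) := by
        field_simp
      rw [h3, h4]
      exact mul_le_mul_of_nonneg_left h1 (by positivity)
    · have h1 := hu1 o ho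
      simp only [e, h, if_false, sum_const, nsmul_eq_mul] at h1 ⊢
      rw [← mul_sum, h1, div_mul_eq_mul_div, one_div_mul_eq_div, ← mul_div_assoc]
      refine div_le_div_of_nonneg_right ?_ hb.le
      have h2 : 0 ≤ 3 / (D : ℝ) := by positivity
      have h3 : 0 ≤ ((b : ℝ) + 1) ^ Q * (Fintype.piFinset A).card := by positivity
      nlinarith
  · intro o ho o' ho' hne
    rw [hZ, sum_product]
    have h1 : ∀ s, ∑ W ∈ Fintype.piFinset A, u o s * v o W * (u o' s * v o' W) =
        u o s * u o' s * ∑ W ∈ Fintype.piFinset A, v o W * v o' W := by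
      intro s
      rw [mul_sum]
      exact sum_congr rfl fun W _ => by ring
    simp only [h1]
    rw [← sum_mul]
    have h2 : 0 ≤ ∑ W ∈ Fintype.piFinset A, v o W * v o' W := by
      refine sum_nonneg fun W _ => mul_nonneg ?_ ?_ <;>
        simp only [v] <;> split_ifs <;> simp [hcard]
    refine (mul_le_mul (hu2 o ho o' ho' hne) (hv2 o ho o' ho' hne) h2 ?_).trans (le_of_eq ?_)
    · split_ifs <;> positivity
    · have h3 := hprod o
      have h4 := hprod o'
      have h5 : 1 / ((b : ℝ) + 1) ^ 2 = 1 / ((b : ℝ) + 1) * (1 / ((b : ℝ) + 1)) := by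
        rw [pow_two]
        field_simp
      rw [h5]
      generalize (if Ico lab (lab + D) ⊆ A o then 1 else 1 / ((b : ℝ) + 1)) = y1 at h3 ⊢
      generalize (if Ico lab (lab + D) ⊆ A o then 1 / ((b : ℝ) + 1) else 1) = y2 at h3 ⊢
      generalize (if Ico lab (lab + D) ⊆ A o' then 1 else 1 / ((b : ℝ) + 1)) = y3 at h4 ⊢
      generalize (if Ico lab (lab + D) ⊆ A o' then 1 / ((b : ℝ) + 1) else 1) = y4 at h4 ⊢
      calc _ = y1 * y2 * (y3 * y4) * (((b : ℝ) + 1) ^ Q * (Fintype.piFinset A).card) := by ring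
        _ = _ := by rw [h3, h4]

end Gain

end ShortlistSecretary

namespace ShortlistSecretary

variable {n : ℕ}

/-! ### The potential -/

/-- The price of being `y` levels ahead of schedule; it grows quadratically from `y = -w` on. -/
noncomputable def ramp (w y : ℝ) : ℝ := (max (y + w) 0) ^ 2 / (4 * w)

section Ramp

variable {w : ℝ}

theorem ramp_nonneg (hw : 0 < w) (y : ℝ) : 0 ≤ ramp w y := by
  unfold ramp
  positivity

theorem ramp_mono (hw : 0 < w) {y z : ℝ} (h : y ≤ z) : ramp w y ≤ ramp w z := by
  unfold ramp
  gcongr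

theorem ramp_eq_zero {y : ℝ} (h : y + w ≤ 0) : ramp w y = 0 := by
  rw [ramp, max_eq_right h]
  simp

theorem le_ramp (hw : 0 < w) (y : ℝ) : y ≤ ramp w y := by
  rw [ramp, le_div_iff₀ (by positivity)]
  rcases le_total 0 (y + w) with h | h
  · rw [max_eq_left h]
    nlinarith [sq_nonneg (y - w)]
  · rw [max_eq_right h]
    nlinarith

/-- A walk that goes up with probability at most `a` in each step, while the schedule advances
by `a`, does not increase the price by much. -/
theorem ramp_step (hw : 0 < w) {a p : ℝ} (h0 : 0 ≤ p) (ha : p ≤ a) (z : ℝ) :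
    ramp w z + p * (ramp w (z + 1) - ramp w z) ≤ ramp w (z + a) + a / (4 * w) := by
  have h1 : ramp w z ≤ ramp w (z + 1) := ramp_mono hw (by linarith)
  have h2 : ramp w z + p * (ramp w (z + 1) - ramp w z) ≤
      ramp w z + a * (ramp w (z + 1) - ramp w z) := by
    have := mul_le_mul_of_nonneg_right ha (sub_nonneg.2 h1)
    linarith
  refine h2.trans ?_
  have ha0 : 0 ≤ a := h0.trans ha
  have h3 : (max (z + 1 + w) 0) ^ 2 ≤ (max (z + w) 0 + 1) ^ 2 := by
    refine pow_le_pow_left₀ (le_max_right _ _) (max_le ?_ ?_) 2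
    · linarith [le_max_left (z + w) 0]
    · linarith [le_max_right (z + w) 0]
  have h4 : (max (z + w) 0) ^ 2 + 2 * a * max (z + w) 0 ≤ (max (z + a + w) 0) ^ 2 := by
    rcases le_total 0 (z + w) with h | h
    · rw [max_eq_left h, max_eq_left (by linarith)]
      nlinarith
    · rw [max_eq_right h]
      nlinarith [sq_nonneg (max (z + a + w) 0)]
  unfold ramp
  rw [← sub_nonneg]
  have h5 : (max (z + a + w) 0) ^ 2 / (4 * w) + a / (4 * w) -
      ((max (z + w) 0) ^ 2 / (4 * w) + a * ((max (z + 1 + w) 0) ^ 2 / (4 * w) -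
        (max (z + w) 0) ^ 2 / (4 * w))) =
      ((max (z + a + w) 0) ^ 2 + a - ((max (z + w) 0) ^ 2 + a * ((max (z + 1 + w) 0) ^ 2 -
        (max (z + w) 0) ^ 2))) / (4 * w) := by
    field_simp
  rw [h5]
  refine div_nonneg ?_ (by positivity)
  have h6 := mul_le_mul_of_nonneg_left h3 ha0
  nlinarith

/-- At the upper end of the band the price falls fast when the schedule advances. -/
theorem le_ramp_sub (hw : 1 ≤ w) {a y : ℝ} (ha0 : 0 ≤ a) (ha : a ≤ 1) (hy : w ≤ y) :
    a ≤ ramp w y - ramp w (y - a) + a / (4 * w) := by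
  have hw0 : 0 < w := by linarith
  unfold ramp
  rw [max_eq_left (by linarith), max_eq_left (by linarith), ← sub_div, ← add_div,
    le_div_iff₀ (by positivity)]
  nlinarith

end Ramp

/-- The relations between the parameters that the analysis needs. -/
structure Par.Stream (P : Par) : Prop where
  stride : P.stride = P.m
  R1 : P.R1 + 1 = P.m
  m : P.m = P.α * P.K
  α0 : 0 < P.α
  W0 : 0 < P.W
  D0 : 0 < P.D
  K0 : 0 < P.K
  L0 : 0 < P.L
  Q : (2 * P.W + 1) * P.L ≤ P.Q
  records : (P.D : ℝ) ^ 2 ≤ (3 / 2) ^ (P.L - 2)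
  loss : 3 / (P.D : ℝ) + 1 / P.α ≤ 1

/-- Every window closes this fraction of the gap to the optimum, up to the price for levels. -/
noncomputable def Par.rate (P : Par) : ℝ := (1 - 3 / P.D - 1 / P.α) / P.m

/-- The price, in steps of one level, for being on level `ℓ` at the start of window `j`. -/
noncomputable def Par.price (P : Par) (j ℓ : ℕ) : ℝ :=
  ramp P.W (ℓ - j / P.α) + (P.m - j) / (4 * P.W * P.α)

/-- The items of `O` that are not only observed. -/
def target (D : ℕ) (O : Finset (Fin n)) (W : Fin n → ℕ) : Finset (Fin n) :=
  O.filter fun o => ¬W o % D = 0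

/-- A lower bound for the expected value that is returned, when the solution of level `ℓ` has the
value `v` at the start of window `j`. -/
noncomputable def potential (f : Finset (Fin n) → ℝ) (P : Par) (O : Finset (Fin n)) (j ℓ : ℕ)
    (v : ℝ) (W : Fin n → ℕ) : ℝ :=
  f (target P.D O W) - (1 - P.rate) ^ (P.m - j) * (f (target P.D O W) - v) -
    P.price j ℓ / P.K * f O

namespace Par.Stream

variable {P : Par}

theorem α_pos (h : P.Stream) : (0 : ℝ) < P.α := by exact_mod_cast h.α0
theorem K_pos (h : P.Stream) : (0 : ℝ) < P.K := by exact_mod_cast h.K0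
theorem W_pos (h : P.Stream) : (0 : ℝ) < P.W := by exact_mod_cast h.W0
theorem D_pos (h : P.Stream) : (0 : ℝ) < P.D := by exact_mod_cast h.D0
theorem m_eq (h : P.Stream) : (P.m : ℝ) = P.α * P.K := by
  rw [h.m]
  push_cast
  rfl
theorem m_pos (h : P.Stream) : (0 : ℝ) < P.m := by
  rw [h.m_eq]
  exact mul_pos h.α_pos h.K_pos

theorem rate_nonneg (h : P.Stream) : 0 ≤ P.rate :=
  div_nonneg (by linarith [h.loss]) h.m_pos.le

theorem rate_mul_K_le (h : P.Stream) : P.rate * P.K ≤ 1 / P.α := by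
  have h1 := h.α_pos
  have h2 := h.K_pos
  have h3 := h.D_pos
  have h4 : P.rate * P.K = (1 - 3 / P.D - 1 / P.α) / P.α := by
    rw [rate, h.m_eq]
    field_simp
  rw [h4]
  refine div_le_div_of_nonneg_right ?_ h1.le
  have : (0 : ℝ) ≤ 3 / P.D := by positivity
  have : (0 : ℝ) ≤ 1 / P.α := by positivity
  linarith

theorem rate_le_one (h : P.Stream) : P.rate ≤ 1 := by
  have h1 := h.rate_mul_K_le
  have h2 : (1 : ℝ) ≤ P.K := by exact_mod_cast h.K0
  have h3 : (1 : ℝ) ≤ P.α := by exact_mod_cast h.α0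
  have h4 : 1 / (P.α : ℝ) ≤ 1 := by
    rw [div_le_one h.α_pos]
    exact h3
  nlinarith [h.rate_nonneg]

theorem div_le (h : P.Stream) {j : ℕ} (hj : j ≤ P.m) : j / P.α ≤ P.K := by
  have h1 := Nat.div_le_div_right (c := P.α) hj
  rwa [h.m, Nat.mul_div_cancel_left _ h.α0] at h1

theorem price_succ_mono (h : P.Stream) (j ℓ : ℕ) : P.price j ℓ ≤ P.price j (ℓ + 1) := by
  unfold price
  have := ramp_mono h.W_pos (y := (ℓ : ℝ) - j / P.α) (z := ((ℓ + 1 : ℕ) : ℝ) - j / P.α)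
    (by push_cast; linarith)
  linarith

theorem price_nonneg (h : P.Stream) {j : ℕ} (hj : j ≤ P.m) (ℓ : ℕ) : 0 ≤ P.price j ℓ := by
  have h1 := h.W_pos
  have h2 := h.α_pos
  have h3 : (j : ℝ) ≤ P.m := by exact_mod_cast hj
  have h4 := ramp_nonneg h1 ((ℓ : ℝ) - j / P.α)
  unfold price
  have : 0 ≤ ((P.m : ℝ) - j) / (4 * P.W * P.α) := div_nonneg (by linarith) (by positivity)
  linarith

theorem price_step (h : P.Stream) (j ℓ : ℕ) :
    P.price (j + 1) ℓ + P.rate * P.K * (P.price (j + 1) (ℓ + 1) - P.price (j + 1) ℓ) ≤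
      P.price j ℓ := by
  have h1 := h.W_pos
  have h2 := h.α_pos
  have h3 := ramp_step h1 (a := 1 / P.α) (mul_nonneg h.rate_nonneg h.K_pos.le) h.rate_mul_K_le
    ((ℓ : ℝ) - (j + 1 : ℕ) / P.α)
  have h4 : (ℓ : ℝ) - (j + 1 : ℕ) / P.α + 1 / P.α = ℓ - j / P.α := by
    push_cast
    field_simp
    ring
  have h5 : (ℓ : ℝ) - (j + 1 : ℕ) / P.α + 1 = (ℓ + 1 : ℕ) - (j + 1 : ℕ) / P.α := by
    push_cast
    ring
  have h6 : ((P.m : ℝ) - j) / (4 * P.W * P.α) =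
      (P.m - (j + 1 : ℕ)) / (4 * P.W * P.α) + 1 / P.α / (4 * P.W) := by
    push_cast
    field_simp
    ring
  rw [h4, h5] at h3
  unfold price
  rw [h6]
  linarith

/-- The price at the highest level in use falls fast enough. -/
theorem price_step_of_high (h : P.Stream) {j ℓ : ℕ} (hℓ : j / P.α + P.W + 1 ≤ ℓ) :
    P.price (j + 1) ℓ + P.rate * P.K ≤ P.price j ℓ := by
  have h1 := h.W_pos
  have h2 := h.α_pos
  have hW : (1 : ℝ) ≤ P.W := by exact_mod_cast h.W0
  have hα : (1 : ℝ) ≤ P.α := by exact_mod_cast h.α0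
  have h3 : (P.W : ℝ) ≤ ℓ - j / P.α := by
    have h4 : (j : ℝ) / P.α < ((j / P.α : ℕ) : ℝ) + 1 := by
      rw [div_lt_iff₀ h2]
      have := Nat.lt_div_mul_add (a := j) h.α0
      have h5 : (j : ℝ) < ((j / P.α : ℕ) : ℝ) * P.α + P.α := by exact_mod_cast this
      linarith
    have h5 : ((j / P.α : ℕ) : ℝ) + P.W + 1 ≤ ℓ := by exact_mod_cast hℓ
    linarith
  have h4 := le_ramp_sub hW (a := 1 / P.α) (by positivity) (by rwa [div_le_one h2]) h3
  have h5 : (ℓ : ℝ) - j / P.α - 1 / P.α = ℓ - (j + 1 : ℕ) / P.α := by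
    push_cast
    field_simp
    ring
  have h6 : ((P.m : ℝ) - j) / (4 * P.W * P.α) =
      (P.m - (j + 1 : ℕ)) / (4 * P.W * P.α) + 1 / P.α / (4 * P.W) := by
    push_cast
    field_simp
    ring
  rw [h5] at h4
  have h7 := h.rate_mul_K_le
  unfold price
  rw [h6]
  linarith

/-- Levels at the lower end of the band have the same price. -/
theorem price_succ_of_low {j ℓ : ℕ} (hℓ : ℓ + 1 = P.lo j) :
    P.price j (ℓ + 1) = P.price j ℓ := by
  have h1 : ℓ + 1 + P.W = j / P.α := by
    unfold lo at hℓ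
    omega
  have h2 : ((j / P.α : ℕ) : ℝ) ≤ j / P.α := Nat.cast_div_le
  rw [← h1] at h2
  push_cast at h2
  unfold price
  rw [ramp_eq_zero (by push_cast; linarith), ramp_eq_zero (by linarith)]

/-- At level `K` the price pays for the gap that could still be closed. -/
theorem le_price_K (h : P.Stream) {j : ℕ} (hj : j ≤ P.m) :
    1 - (1 - P.rate) ^ (P.m - j) ≤ P.price j P.K / P.K := by
  have hα := h.α_pos
  have hK := h.K_pos
  have hW := h.W_pos
  have hj' : (j : ℝ) ≤ P.m := by exact_mod_cast hj
  have h1 := one_add_mul_le_pow (a := -P.rate) (by linarith [h.rate_le_one]) (P.m - j)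
  have h2 : ((P.m - j : ℕ) : ℝ) = P.m - j := by rw [Nat.cast_sub hj]
  rw [h2, ← sub_eq_add_neg] at h1
  have h3 := le_ramp hW ((P.K : ℝ) - j / P.α)
  have h4 : 0 ≤ ((P.m : ℝ) - j) / (4 * P.W * P.α) := div_nonneg (by linarith) (by positivity)
  have h5 : (P.m - j) * P.rate ≤ (P.m - j) / P.α / P.K := by
    have h6 := mul_le_mul_of_nonneg_left h.rate_mul_K_le (sub_nonneg.2 hj')
    rw [le_div_iff₀ hK, div_eq_mul_one_div]
    linarith
  have h6 : ((P.m : ℝ) - j) / P.α = P.K - j / P.α := by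
    rw [h.m_eq]
    field_simp
  have h7 : (P.m - j) / P.α / P.K ≤ P.price j P.K / P.K := by
    refine div_le_div_of_nonneg_right ?_ hK.le
    unfold price
    linarith
  linarith

end Par.Stream

end ShortlistSecretary

namespace ShortlistSecretary

variable {n : ℕ}

/-! ### The value of the remaining windows -/

/-- The items of each label, in the order of the list `π`, when `W` are the labels. -/
def labelled (π : List (Fin n)) (W : Fin n → ℕ) (lab : ℕ) : List (Fin n) :=
  π.filter fun e => decide (W e = lab)

/-- The data at the end of window `j`. -/
noncomputable def closeWindow (f : Finset (Fin n) → ℝ) (P : Par) (j : ℕ) (st : St n) : Cf n :=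
  (mergeUp f (P.lo j) (P.lo (j + 1) - P.lo j) st.N, st.H)

theorem St.Good.closeWindow {f : Finset (Fin n) → ℝ} {P : Par} {j b : ℕ} {st : St n}
    (h : st.Good f P.L (P.lo j) (P.hi j) b) :
    (ShortlistSecretary.closeWindow f P j st).Good (b + (2 * P.W + 1) * P.L) :=
  St.Good.finish (P := { P with D := 0 }) (blk := fun _ => []) h

theorem finish_labelled (f : Finset (Fin n) → ℝ) (P : Par) (π : List (Fin n)) (W : Fin n → ℕ)
    (j : ℕ) (st : St n) : finish f P (labelled π W) j st =
      closeWindow f P j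
        (scanPairs f P.L (P.lo j) (P.hi j) (j * P.D) W (pairs π (j * P.D) P.D) st) := by
  rw [← scan_eq_scanPairs]
  rfl

/-- The label sets `A` after `j` windows, where `H` lists the items on the shortlist. -/
def Par.Possible (P : Par) (j : ℕ) (A : Fin n → Finset ℕ) (H : List (Fin n)) : Prop :=
  Valid (fun l => l % P.D = 0) (Ico (j * P.D) (P.m * P.D)) [] A H ∧ ∀ e, A e ⊆ range (P.m * P.D)

/-- The expected value that is returned is at least the potential, at every level in use. -/
def PotentialBound (f : Finset (Fin n) → ℝ) (P : Par) (O : Finset (Fin n)) (π : List (Fin n))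
    (t j : ℕ) : Prop :=
  ∀ (x : Cf n) (A : Fin n → Finset ℕ) (ℓ : ℕ), x.Good (j * ((2 * P.W + 1) * P.L)) →
    P.Possible j A x.2 → P.lo j ≤ ℓ → ℓ ≤ P.hi j →
      ∑ W ∈ Fintype.piFinset A, potential f P O j ℓ (f (x.1 ℓ)) W ≤
        ∑ W ∈ Fintype.piFinset A, rest f P (labelled π W) t j x

section Step

variable {f : Finset (Fin n) → ℝ} {P : Par} {O : Finset (Fin n)} {π : List (Fin n)} {t j : ℕ}

theorem potential_mono (hP : P.Stream) {ℓ : ℕ} {v v' : ℝ} (h : v ≤ v') (W : Fin n → ℕ) :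
    potential f P O j ℓ v W ≤ potential f P O j ℓ v' W := by
  have h1 : 0 ≤ (1 - P.rate) ^ (P.m - j) := pow_nonneg (by linarith [hP.rate_le_one]) _
  unfold potential
  nlinarith

theorem Par.hi_mono (P : Par) (j : ℕ) : P.hi j ≤ P.hi (j + 1) := by
  have h1 : j / P.α ≤ (j + 1) / P.α := Nat.div_le_div_right (by omega)
  unfold Par.hi
  omega

/-- The potential bound after a window. -/
theorem PotentialBound.after (ih : PotentialBound f P O π t (j + 1)) (hP : P.Stream)
    (hj : j + 1 ≤ P.m) {st : St n}
    (hst : st.Good f P.L (P.lo j) (P.hi j) (j * ((2 * P.W + 1) * P.L)))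
    {A : Fin n → Finset ℕ} (hA : P.Possible (j + 1) A st.H) {ℓ : ℕ} (hlo : P.lo j ≤ ℓ)
    (hhi : ℓ ≤ P.hi j) {v : ℝ} (hv : v ≤ f (st.N ℓ)) :
    ∑ W ∈ Fintype.piFinset A, potential f P O (j + 1) ℓ v W ≤
      ∑ W ∈ Fintype.piFinset A, rest f P (labelled π W) t (j + 1) (closeWindow f P j st) := by
  have hgood := hst.closeWindow
  rw [← Nat.succ_mul] at hgood
  have h1 := P.lo_succ_le hP.α0 j
  have h2 := P.lo_le_lo_succ j
  have h3 := P.hi_mono j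
  have h4 : P.lo (j + 1) ≤ P.hi (j + 1) := Par.lo_le_hi (hP.div_le hj)
  rcases Nat.lt_or_ge ℓ (P.lo (j + 1)) with h | h
  · -- the level is abandoned; the next level has a solution that is as good, and the same price
    have h5 : ℓ + 1 = P.lo (j + 1) := by omega
    refine le_trans (sum_le_sum fun W _ => ?_)
      (ih (closeWindow f P j st) A (ℓ + 1) hgood hA (by omega) (by omega))
    have h6 : potential f P O (j + 1) ℓ v W = potential f P O (j + 1) (ℓ + 1) v W := by
      rw [potential, potential, Par.Stream.price_succ_of_low h5]
    rw [h6]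
    refine potential_mono hP (hv.trans ?_) W
    have h7 := le_mergeUp_top (f := f) st.N (P.lo j) (P.lo (j + 1) - P.lo j) hlo (by omega)
    rwa [show P.lo j + (P.lo (j + 1) - P.lo j) = ℓ + 1 by omega] at h7
  · refine le_trans (sum_le_sum fun W _ => ?_)
      (ih (closeWindow f P j st) A ℓ hgood hA h (by omega))
    exact potential_mono hP (hv.trans (le_mergeUp _ _ _ _)) W

/-- What is known in a window about data that do not depend on labels yet to be revealed. -/
def Inside (f : Finset (Fin n) → ℝ) (P : Par) (j : ℕ) (x : Cf n) (st : St n) : Prop :=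
  st.Good f P.L (P.lo j) (P.hi j) (j * ((2 * P.W + 1) * P.L)) ∧ ∀ ℓ, f (x.1 ℓ) ≤ f (st.N ℓ)

/-- The potential bound at the start of a window, for a function `Ψ` of the data at its end. -/
theorem sum_rest_succ_ge (hπ : π.Nodup) (hj : j + 1 ≤ P.m) {x : Cf n}
    (hx : x.Good (j * ((2 * P.W + 1) * P.L))) {A : Fin n → Finset ℕ} (hA : P.Possible j A x.2)
    {Ψ : (Fin n → ℕ) → St n → ℝ}
    (hΨ : ∀ A st, P.Possible (j + 1) A st.H → Inside f P j x st →
      ∑ W ∈ Fintype.piFinset A, Ψ W st ≤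
        ∑ W ∈ Fintype.piFinset A, rest f P (labelled π W) t (j + 1) (closeWindow f P j st)) :
    (∑ s, ∑ W ∈ Fintype.piFinset A, Ψ W (scanPairs f P.L (P.lo j) (P.hi j) (j * P.D) W
      (pairs π (j * P.D) P.D) (trySamples f P.L (P.lo j) (P.hi j) (positions P s)
        (clean f x.1 x.2)))) / (P.R1 + 1) ^ P.Q ≤
      ∑ W ∈ Fintype.piFinset A, rest f P (labelled π W) (t + 1) j x := by
  simp only [rest_succ, E_window, finish_labelled]
  rw [← sum_div, sum_comm (s := Fintype.piFinset A)]
  refine div_le_div_of_nonneg_right (sum_le_sum fun s _ => ?_) (by positivity)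
  have hs : Sampled f x (trySamples f P.L (P.lo j) (P.hi j) (positions P s) (clean f x.1 x.2)) :=
    sampled_clean.trySamples _
  have hD : j * P.D + P.D ≤ P.m * P.D := by
    rw [← Nat.succ_mul]
    exact Nat.mul_le_mul_right _ hj
  refine sum_reveal (Pre := fun l => l % P.D = 0) (Fut := Ico ((j + 1) * P.D) (P.m * P.D))
    (U := range (P.m * P.D)) (I := Inside f P j x)
    (R := fun W st => rest f P (labelled π W) t (j + 1) (closeWindow f P j st))
    (by simp) ?_ ?_ _ (pairs_nodup hπ _ _) ?_ A _ hA.2 ?_ ?_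
  · exact fun st pm y h => ⟨h.1.arrive pm y, fun ℓ => (h.2 ℓ).trans (le_arrive _ _ _ _ _ _ _ _)⟩
  · exact fun A st hU hv hI => hΨ A st ⟨hv, hU⟩ hI
  · intro p hp hp'
    have h1 := (mem_pairs.1 hp).2.1
    have h2 := (mem_Ico.1 hp').1
    rw [Nat.succ_mul] at h2
    omega
  · -- the labels of the window are no longer in the future
    rw [hs.H]
    intro e
    rcases hA.1 e with ⟨-, h2⟩ | ⟨-, h2, h3⟩
    · left
      constructor
      · intro l hl
        have h4 := mem_pairs.1 hl
        exact h2 (mem_Ico.2 ⟨h4.1, h4.2.1.trans_le hD⟩)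
      · exact (Ico_subset_Ico_left (Nat.mul_le_mul_right _ (by omega))).trans h2
    · right
      refine ⟨?_, disjoint_of_subset_left
        (Ico_subset_Ico_left (Nat.mul_le_mul_right _ (by omega))) h2, h3⟩
      intro l hl
      have h4 := mem_pairs.1 hl
      exact disjoint_left.1 h2 (mem_Ico.2 ⟨h4.1, h4.2.1.trans_le hD⟩)
  · exact ⟨(hx.clean f _ _ _).trySamples _, hs.le⟩

/-- On the highest level below `K`, the potential bound holds even if nothing is gained. -/
theorem PotentialBound.of_high (ih : PotentialBound f P O π t (j + 1)) (hf : IsMonotoneSubmodular f)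
    (hP : P.Stream) (hπ : π.Nodup) (hj : j + 1 ≤ P.m) {x : Cf n}
    (hx : x.Good (j * ((2 * P.W + 1) * P.L))) {A : Fin n → Finset ℕ} (hA : P.Possible j A x.2)
    {ℓ : ℕ} (hℓ : ℓ = P.hi j) (hK : ℓ < P.K) :
    ∑ W ∈ Fintype.piFinset A, potential f P O j ℓ (f (x.1 ℓ)) W ≤
      ∑ W ∈ Fintype.piFinset A, rest f P (labelled π W) (t + 1) j x := by
  have h := sum_rest_succ_ge (t := t) hπ hj hx hA
    (Ψ := fun W _ => potential f P O (j + 1) ℓ (f (x.1 ℓ)) W)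
    fun A st hA hst => ih.after hP hj hst.1 hA
      (by rw [hℓ]; exact Par.lo_le_hi (hP.div_le (by omega))) hℓ.le (hst.2 ℓ)
  rw [sum_const, card_univ, nsmul_eq_mul] at h
  have hN : ((Fintype.card (Fin P.Q → Fin (P.R1 + 1)) : ℕ) : ℝ) = ((P.R1 : ℝ) + 1) ^ P.Q := by simp
  rw [hN, mul_div_cancel_left₀ _ (by positivity)] at h
  refine (sum_le_sum fun W _ => ?_).trans h
  have hlev : j / P.α + P.W + 1 ≤ ℓ := by
    unfold Par.hi at hℓ
    omega
  have h1 := hP.price_step_of_high hlev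
  have h2 : P.m - j = (P.m - (j + 1)) + 1 := by omega
  have hq0 := hP.rate_nonneg
  have hq1 := hP.rate_le_one
  have h3 : 0 ≤ (1 - P.rate) ^ (P.m - (j + 1)) := pow_nonneg (by linarith) _
  have h4 : (1 - P.rate) ^ (P.m - (j + 1)) ≤ 1 := pow_le_one₀ (by linarith) (by linarith)
  have h5 : f (target P.D O W) - f (x.1 ℓ) ≤ f O := by
    have h6 := hf.mono (target P.D O W) O (filter_subset _ _)
    have h7 := hf.nonneg (x.1 ℓ)
    linarith
  have h6 := hf.nonneg O
  have hKp := hP.K_pos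
  have h7 : P.rate * f O ≤ (P.price j ℓ / P.K - P.price (j + 1) ℓ / P.K) * f O := by
    refine mul_le_mul_of_nonneg_right ?_ h6
    rw [← sub_div, le_div_iff₀ hKp]
    linarith
  have h8 : P.rate * (1 - P.rate) ^ (P.m - (j + 1)) * (f (target P.D O W) - f (x.1 ℓ)) ≤
      P.rate * f O := by
    rw [mul_assoc]
    refine mul_le_mul_of_nonneg_left ?_ hq0
    calc _ ≤ (1 - P.rate) ^ (P.m - (j + 1)) * f O := mul_le_mul_of_nonneg_left h5 h3
      _ ≤ f O := mul_le_of_le_one_left h6 h4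
  unfold potential
  rw [h2, pow_succ]
  nlinarith

theorem exists_rank (g : Fin n → ℝ) :
    ∃ r : Fin n → ℕ, Function.Injective r ∧ ∀ e e', r e ≤ r e' → g e ≤ g e' := by
  refine ⟨fun e => ((Tuple.sort g).symm e : ℕ), fun e e' h => ?_, fun e e' h => ?_⟩
  · exact (Tuple.sort g).symm.injective (Fin.ext h)
  · have h1 := Tuple.monotone_sort g (a := (Tuple.sort g).symm e) (b := (Tuple.sort g).symm e') h
    simpa using h1

/-- Below the highest level, the gain of the window pays for the decrease of the potential. -/
theorem PotentialBound.of_lt_hi (ih : PotentialBound f P O π t (j + 1))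
    (hf : IsMonotoneSubmodular f) (hO : O.card ≤ P.K)
    (hP : P.Stream) (hπ : π.Nodup) (hall : ∀ e, e ∈ π) (hj : j + 1 ≤ P.m) {x : Cf n}
    (hx : x.Good (j * ((2 * P.W + 1) * P.L))) {A : Fin n → Finset ℕ} (hA : P.Possible j A x.2)
    {ℓ : ℕ} (hlo : P.lo j ≤ ℓ) (hhi : ℓ < P.hi j) :
    ∑ W ∈ Fintype.piFinset A, potential f P O j ℓ (f (x.1 ℓ)) W ≤
      ∑ W ∈ Fintype.piFinset A, rest f P (labelled π W) (t + 1) j x := by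
  classical
  have hKp := hP.K_pos
  have hq0 := hP.rate_nonneg
  have hq1 := hP.rate_le_one
  have hfO := hf.nonneg O
  set S := x.1 ℓ with hS
  set a := (1 - P.rate) ^ (P.m - (j + 1)) with ha
  have ha0 : 0 ≤ a := pow_nonneg (by linarith) _
  set c := (P.price (j + 1) (ℓ + 1) - P.price (j + 1) ℓ) / P.K * f O with hc
  have hc0 : 0 ≤ c :=
    mul_nonneg (div_nonneg (sub_nonneg.2 (hP.price_succ_mono _ _)) hKp.le) hfO
  -- the gain of going up one level
  let Δ : St n → ℝ := fun st => a * (f (st.N (ℓ + 1)) - f S) - c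
  have h := sum_rest_succ_ge (t := t) hπ hj hx hA
    (Ψ := fun W st => potential f P O (j + 1) ℓ (f S) W + max 0 (Δ st))
    fun A st hA hst => by
      rcases le_total (Δ st) 0 with hd | hd
      · simp only [max_eq_left hd, add_zero]
        exact ih.after hP hj hst.1 hA hlo hhi.le (hst.2 ℓ)
      · refine le_trans (sum_le_sum fun W _ => le_of_eq ?_)
          (ih.after hP hj hst.1 hA (ℓ := ℓ + 1) (by omega) hhi le_rfl)
        rw [max_eq_right hd]
        simp only [Δ, hc, potential, ← ha]
        field_simp
        ring
  refine le_trans ?_ h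
  simp only [sum_add_distrib]
  rw [sum_const, card_univ, nsmul_eq_mul]
  have hN : ((Fintype.card (Fin P.Q → Fin (P.R1 + 1)) : ℕ) : ℝ) = ((P.R1 : ℝ) + 1) ^ P.Q := by simp
  have hm1 : (P.R1 : ℝ) + 1 = P.m := by exact_mod_cast hP.R1
  obtain ⟨r, hr, hr'⟩ := exists_rank fun e => f (S ∪ {e})
  have hjD : j * P.D + P.D ≤ P.m * P.D := by
    rw [← Nat.succ_mul]
    exact Nat.mul_le_mul_right _ hj
  have hwin : Ico (j * P.D) (j * P.D + P.D) ⊆ Ico (j * P.D) (P.m * P.D) :=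
    Ico_subset_Ico_right hjD
  set O' := O.filter fun o => Ico (j * P.D) (j * P.D + P.D) ⊆ A o ∨ o ∈ x.2 with hO'
  have hlevel : P.lo j < ℓ + 1 ∧ ℓ + 1 ≤ P.hi j := ⟨by omega, hhi⟩
  have hs : ∀ s, Sampled f x (trySamples f P.L (P.lo j) (P.hi j) (positions P s)
      (clean f x.1 x.2)) := fun s => sampled_clean.trySamples _
  have hgain := window_gain (Q := P.Q) (b := P.R1) (D := P.D) (lab := j * P.D) (L := P.L) (r := r)
    (A := A) (H := x.2) (O := O') (x := fun o => max 0 (a * (f (S ∪ {o}) - f S) - c))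
    (M := fun s W => max 0 (Δ (scanPairs f P.L (P.lo j) (P.hi j) (j * P.D) W
      (pairs π (j * P.D) P.D) (trySamples f P.L (P.lo j) (P.hi j) (positions P s)
        (clean f x.1 x.2))))) hP.D0 hP.records hr
    (fun e => by
      rcases hA.1 e with ⟨-, h2⟩ | ⟨-, h2, -⟩
      · exact Or.inl (hwin.trans h2)
      · exact Or.inr (disjoint_of_subset_left hwin h2))
    (by rw [hP.R1]; exact hA.2)
    (by
      rw [hP.R1, mul_comm]
      exact hx.len.trans (Nat.mul_le_mul (by omega) hP.Q))
    (fun o ho => (mem_filter.1 ho).2) (fun _ _ => le_max_left _ _) (fun _ _ => le_max_left _ _)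
    (fun o _ s W ho hbad => by
      have h1 := le_scanPairs (f := f) (π := π) hlevel (st := trySamples f P.L (P.lo j) (P.hi j)
        (positions P s) (clean f x.1 x.2)) (fun e e' he => by
          rw [Nat.add_sub_cancel, (hs s).S]
          exact hr' e e' he) hπ hall hbad ((hs s).tv _) ((hs s).c _) ho
      rw [Nat.add_sub_cancel, (hs s).S] at h1
      exact max_le_max le_rfl (sub_le_sub_right (mul_le_mul_of_nonneg_left
        (sub_le_sub_right h1 _) ha0) _))
    (fun o _ s W q hq hit => by
      have h1 : q ∈ positions P s := by
        obtain ⟨i, hi⟩ := hit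
        rw [positions, List.mem_ofFn]
        refine ⟨i, ?_⟩
        rw [hP.stride, ← hP.R1]
        exact hi
      have h2 := (sampled_clean (f := f) (x := x)).le_trySamples_of_mem (lo := P.lo j)
        (hi := P.hi j) hP.L0 hq h1 hlo hhi
      have h3 := h2.trans (le_scanPairs_N f P.L (P.lo j) (P.hi j) (j * P.D) W
        (pairs π (j * P.D) P.D) _ (ℓ + 1))
      exact max_le_max le_rfl (sub_le_sub_right (mul_le_mul_of_nonneg_left
        (sub_le_sub_right h3 _) ha0) _))
  rw [le_div_iff₀ (by positivity), hN]
  refine le_trans ?_ (add_le_add_right hgain _)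
  generalize hX : ∑ o ∈ O', max 0 (a * (f (S ∪ {o}) - f S) - c) = X
  have hcard : (O'.card : ℝ) ≤ P.K := by exact_mod_cast (card_filter_le _ _).trans hO
  have hX0 : 0 ≤ X := by
    rw [← hX]
    exact sum_nonneg fun _ _ => le_max_left _ _
  have hκ : P.rate ≤ (1 - 3 / P.D) / (P.R1 + 1) - O'.card * (1 / ((P.R1 : ℝ) + 1) ^ 2) := by
    have h1 := hP.α_pos
    have h2 := hP.D_pos
    have h3 := hP.m_pos
    rw [hm1, Par.rate]
    have h4 : (O'.card : ℝ) * (1 / (P.m : ℝ) ^ 2) ≤ 1 / P.α / P.m := by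
      have h5 : (1 : ℝ) / P.α / P.m = P.K * (1 / (P.m : ℝ) ^ 2) := by
        rw [hP.m_eq]
        field_simp
      rw [h5]
      exact mul_le_mul_of_nonneg_right hcard (by positivity)
    rw [sub_div] at *
    linarith
  have hkey : ∀ W ∈ Fintype.piFinset A, potential f P O j ℓ (f S) W ≤
      potential f P O (j + 1) ℓ (f S) W + P.rate * X := by
    intro W hW
    have h1 : target P.D O W ⊆ O' := by
      intro o ho
      rw [target, mem_filter] at ho
      refine mem_filter.2 ⟨ho.1, ?_⟩
      rcases hA.1 o with ⟨-, h2⟩ | ⟨-, -, h2 | h2⟩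
      · exact Or.inl (hwin.trans h2)
      · exact Or.inr h2
      · exact absurd (h2 _ (Fintype.mem_piFinset.1 hW o)) ho.2
    have h2 : f (target P.D O W) - f S ≤ ∑ o ∈ O', (f (S ∪ {o}) - f S) := by
      have h3 := hf.le_add_sum S O'
      have h4 := hf.mono (target P.D O W) (S ∪ O') (h1.trans subset_union_right)
      linarith
    have h3 : a * (f (target P.D O W) - f S) - P.K * c ≤ X := by
      calc a * (f (target P.D O W) - f S) - P.K * c
          ≤ a * ∑ o ∈ O', (f (S ∪ {o}) - f S) - O'.card * c := by
            have := mul_le_mul_of_nonneg_left h2 ha0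
            have := mul_le_mul_of_nonneg_right hcard hc0
            linarith
        _ = ∑ o ∈ O', (a * (f (S ∪ {o}) - f S) - c) := by
            rw [mul_sum, ← nsmul_eq_mul, ← sum_const, ← sum_sub_distrib]
        _ ≤ X := by
            rw [← hX]
            exact sum_le_sum fun _ _ => le_max_right _ _
    have h4 := mul_le_mul_of_nonneg_left h3 hq0
    have h5 := hP.price_step j ℓ
    have h6 : (P.price (j + 1) ℓ / P.K * f O + P.rate * (P.K * c)) ≤ P.price j ℓ / P.K * f O := by
      have h7 : P.price (j + 1) ℓ / P.K * f O + P.rate * (P.K * c) =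
          (P.price (j + 1) ℓ + P.rate * P.K * (P.price (j + 1) (ℓ + 1) - P.price (j + 1) ℓ)) /
            P.K * f O := by
        rw [hc]
        field_simp
      rw [h7]
      exact mul_le_mul_of_nonneg_right (div_le_div_of_nonneg_right h5 hKp.le) hfO
    have h7 : P.m - j = (P.m - (j + 1)) + 1 := by omega
    unfold potential
    rw [h7, pow_succ, ← ha]
    linarith
  have hsum := sum_le_sum hkey
  rw [sum_add_distrib, sum_const, nsmul_eq_mul] at hsum
  have hN0 : (0 : ℝ) ≤ ((P.R1 : ℝ) + 1) ^ P.Q := by positivity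
  have h1 := mul_le_mul_of_nonneg_right hsum hN0
  have h2 : P.rate * X * (((P.R1 : ℝ) + 1) ^ P.Q * (Fintype.piFinset A).card) ≤
      X * ((1 - 3 / P.D) / (P.R1 + 1) - O'.card * (1 / ((P.R1 : ℝ) + 1) ^ 2)) *
        (((P.R1 : ℝ) + 1) ^ P.Q * (Fintype.piFinset A).card) := by
    refine mul_le_mul_of_nonneg_right ?_ (by positivity)
    rw [mul_comm]
    exact mul_le_mul_of_nonneg_left hκ hX0
  linarith

/-- The potential bounds the expected value that is returned from below. -/
theorem potentialBound (hf : IsMonotoneSubmodular f) (hO : O.card ≤ P.K) (hP : P.Stream)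
    (hπ : π.Nodup) (hall : ∀ e, e ∈ π) (t j : ℕ) (htj : j + t = P.m) :
    PotentialBound f P O π t j := by
  induction t generalizing j with
  | zero =>
    intro x A ℓ _ _ hlo hhi
    refine sum_le_sum fun W _ => ?_
    obtain rfl : j = P.m := htj
    have h1 := hP.price_nonneg le_rfl ℓ
    have h2 : 0 ≤ P.price P.m ℓ / P.K * f O :=
      mul_nonneg (div_nonneg h1 hP.K_pos.le) (hf.nonneg O)
    rw [rest_zero]
    have h3 : P.lo P.m ≤ P.K := Par.lo_le_K (hP.div_le le_rfl)
    have h4 := le_mergeUp_top (f := f) x.1 (P.lo P.m) (P.K - P.lo P.m) hlo (by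
      have : P.hi P.m ≤ P.K := min_le_left _ _
      omega)
    rw [show P.lo P.m + (P.K - P.lo P.m) = P.K by omega] at h4
    unfold potential answer
    rw [Nat.sub_self, pow_zero]
    linarith
  | succ t ih =>
    intro x A ℓ hx hA hlo hhi
    have hj : j + 1 ≤ P.m := by omega
    have ih' := ih (j + 1) (by omega)
    rcases Nat.lt_or_ge ℓ (P.hi j) with h | h
    · exact ih'.of_lt_hi hf hO hP hπ hall hj hx hA hlo h
    have hℓ : ℓ = P.hi j := by omega
    rcases Nat.lt_or_ge ℓ P.K with hK | hK
    · exact ih'.of_high hf hP hπ hj hx hA hℓ hK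
    · -- level `K` is never worse at the end than now, and the price pays for the rest of the gap
      have hℓK : ℓ = P.K := by
        have : P.hi j ≤ P.K := min_le_left _ _
        omega
      rw [hℓK]
      refine sum_le_sum fun W _ => le_trans ?_ (le_rest _ _ _ _)
      have h1 := hP.le_price_K (j := j) (by omega)
      have h2 : 0 ≤ 1 - (1 - P.rate) ^ (P.m - j) := sub_nonneg.2
        (pow_le_one₀ (by linarith [hP.rate_le_one]) (by linarith [hP.rate_nonneg]))
      have h3 : f (target P.D O W) ≤ f O := hf.mono _ _ (filter_subset _ _)
      have h4 := hf.nonneg (x.1 P.K)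
      have h5 := mul_le_mul_of_nonneg_right h1 (hf.nonneg O)
      have h6 : (1 - (1 - P.rate) ^ (P.m - j)) * (f (target P.D O W) - f (x.1 P.K)) ≤
          (1 - (1 - P.rate) ^ (P.m - j)) * f O := mul_le_mul_of_nonneg_left (by linarith) h2
      unfold potential
      linarith

end Step

end ShortlistSecretary

namespace ShortlistSecretary

variable {n : ℕ}

/-! ### The value of the solution when the items have random labels -/

/-- All windows together have the value of the remaining windows at the start. -/
theorem windows_E (f : Finset (Fin n) → ℝ) (P : Par) (blk : ℕ → List (Fin n)) (H : List (Fin n)) :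
    (windows f P blk H).E (fun x => f (answer f P x)) = rest f P blk P.m 0 (fun _ => ∅, H) := by
  simp only [windows, rest, zero_add]

theorem card_multiples_le (m D : ℕ) (hD : 0 < D) :
    ((range (m * D)).filter fun l => l % D = 0).card ≤ m := by
  have h : ((range (m * D)).filter fun l => l % D = 0) ⊆ (range m).image (· * D) := by
    intro l hl
    rw [mem_filter, mem_range] at hl
    have h1 := Nat.div_add_mod l D
    rw [hl.2, add_zero, mul_comm] at h1
    refine mem_image.2 ⟨l / D, mem_range.2 ?_, h1⟩
    exact (Nat.div_lt_iff_lt_mul hD).2 hl.1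
  exact (card_le_card h).trans (card_image_le.trans (card_range m).le)

/-- On average, little is lost with the items that are only observed. -/
theorem le_sum_target {f : Finset (Fin n) → ℝ} (hf : IsMonotoneSubmodular f) {m D : ℕ}
    (hm : 0 < m) (hD : 0 < D) (O : Finset (Fin n)) :
    (1 - 1 / (D : ℝ)) * f O * (Fintype.piFinset fun _ : Fin n => range (m * D)).card ≤
      ∑ W ∈ Fintype.piFinset fun _ : Fin n => range (m * D), f (target D O W) := by
  classical
  set Z := Fintype.piFinset fun _ : Fin n => range (m * D) with hZ
  have hm' : (0 : ℝ) < m := by exact_mod_cast hm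
  have hD' : (0 : ℝ) < D := by exact_mod_cast hD
  have hD1 : (1 : ℝ) ≤ D := by exact_mod_cast hD
  have hfrac : 0 ≤ 1 - 1 / (D : ℝ) := sub_nonneg.2 ((div_le_one hD').2 hD1)
  have hone : ∀ o : Fin n, (1 - 1 / (D : ℝ)) * Z.card ≤
      ∑ W ∈ Z, if ¬W o % D = 0 then (1 : ℝ) else 0 := by
    intro o
    have h1 := card_mul_sum_mem (fun _ : Fin n => range (m * D)) o
      (J := (range (m * D)).filter fun l => l % D = 0) (filter_subset _ _) (F := fun _ => 1)
      (fun _ _ => rfl)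
    have h2 : ((((range (m * D)).filter fun l => l % D = 0).card : ℕ) : ℝ) ≤ m := by
      exact_mod_cast card_multiples_le m D hD
    have h3 : ∑ W ∈ Z, (if W o ∈ (range (m * D)).filter fun l => l % D = 0 then (1 : ℝ) else 0) =
        ∑ W ∈ Z, if W o % D = 0 then (1 : ℝ) else 0 := by
      refine sum_congr rfl fun W hW => ?_
      have h4 := Fintype.mem_piFinset.1 hW o
      simp only [mem_filter, h4, true_and]
    rw [h3, sum_const, nsmul_eq_mul, mul_one, card_range, Nat.cast_mul] at h1
    have h4 := mul_le_mul_of_nonneg_right h2 (Nat.cast_nonneg (α := ℝ) Z.card)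
    rw [← h1, mul_assoc] at h4
    have h5 := le_of_mul_le_mul_left h4 hm'
    have h6 : ∑ W ∈ Z, (if ¬W o % D = 0 then (1 : ℝ) else 0) =
        Z.card - ∑ W ∈ Z, if W o % D = 0 then (1 : ℝ) else 0 := by
      rw [card_eq_sum_ones, Nat.cast_sum, ← sum_sub_distrib]
      refine sum_congr rfl fun W _ => ?_
      split_ifs <;> simp
    have h7 : ∑ W ∈ Z, (if W o % D = 0 then (1 : ℝ) else 0) ≤ Z.card / D := by
      rw [le_div_iff₀ hD', mul_comm]
      exact h5
    rw [h6, sub_mul, one_mul, one_div_mul_eq_div]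
    linarith
  -- add the items of `O` one by one; by submodularity each keeps its marginal value
  have key : ∀ T : Finset (Fin n), (f ∅ + (1 - 1 / (D : ℝ)) * (f T - f ∅)) * Z.card ≤
      ∑ W ∈ Z, f (target D T W) := by
    intro T
    induction T using Finset.induction_on with
    | empty => simp [target, mul_comm]
    | insert o T ho ih =>
      have h1 : 0 ≤ f (insert o T) - f T := sub_nonneg.2 (hf.mono _ _ (subset_insert o T))
      have h2 : ∀ W ∈ Z, f (target D T W) +
          (f (insert o T) - f T) * (if ¬W o % D = 0 then (1 : ℝ) else 0) ≤
          f (target D (insert o T) W) := by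
        intro W _
        unfold target
        by_cases h : W o % D = 0
        · rw [filter_insert, if_neg (not_not.2 h), if_neg (not_not.2 h), mul_zero, add_zero]
        · rw [filter_insert, if_pos h, if_pos h, mul_one]
          have h3 := hf.submodular T (insert o (T.filter fun o => ¬W o % D = 0))
          have h4 : T ∪ insert o (T.filter fun o => ¬W o % D = 0) = insert o T := by
            ext x
            simp only [mem_union, mem_insert, mem_filter]
            tauto
          have h5 := hf.mono (T.filter fun o => ¬W o % D = 0)
            (T ∩ insert o (T.filter fun o => ¬W o % D = 0)) fun x hx => by
              simp only [mem_inter, mem_insert, mem_filter] at hx ⊢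
              tauto
          rw [h4] at h3
          linarith
      refine le_trans ?_ (sum_le_sum h2)
      rw [sum_add_distrib, ← mul_sum]
      have h3 := mul_le_mul_of_nonneg_left (hone o) h1
      linarith
  refine le_trans ?_ (key O)
  refine mul_le_mul_of_nonneg_right ?_ (Nat.cast_nonneg _)
  have h1 := hf.nonneg ∅
  have h2 : (1 - 1 / (D : ℝ)) * f ∅ ≤ f ∅ := by
    refine mul_le_of_le_one_left h1 ?_
    have : 0 ≤ 1 / (D : ℝ) := by positivity
    linarith
  linarith

theorem Par.Stream.price_zero {P : Par} (hP : P.Stream) :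
    P.price 0 0 / P.K = P.W / (4 * P.K) + 1 / (4 * P.W) := by
  have h1 := hP.W_pos
  have h2 := hP.K_pos
  have h3 := hP.α_pos
  unfold price ramp
  rw [hP.m_eq]
  simp only [Nat.cast_zero, zero_div, sub_zero, zero_add]
  rw [max_eq_left h1.le]
  field_simp

/-- The value of the algorithm with random labels. -/
theorem stream_value {f : Finset (Fin n) → ℝ} (hf : IsMonotoneSubmodular f) {P : Par}
    (hP : P.Stream) {O : Finset (Fin n)} (hO : O.card ≤ P.K) :
    ((1 - 1 / (P.D : ℝ)) * (1 - Real.exp (-(1 - 3 / P.D - 1 / P.α))) -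
        (P.W / (4 * P.K) + 1 / (4 * P.W))) * f O ≤
      (∑ σ : Equiv.Perm (Fin n), ((labels (P.m * P.D - 1) n).bind fun l =>
        windows f P (blocks (List.ofFn σ) l) []).E fun x => f (answer f P x)) /
          Fintype.card (Equiv.Perm (Fin n)) := by
  classical
  have hm : 0 < P.m := by
    rw [hP.m]
    exact Nat.mul_pos hP.α0 hP.K0
  have hmD : P.m * P.D - 1 + 1 = P.m * P.D := by
    have := Nat.mul_pos hm hP.D0
    omega
  have hfO := hf.nonneg O
  rw [le_div_iff₀ (by exact_mod_cast Fintype.card_pos)]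
  simp only [Rnd.E_bind, windows_E]
  have h1 : ∀ σ : Equiv.Perm (Fin n), (labels (P.m * P.D - 1) n).E (fun l =>
      rest f P (blocks (List.ofFn σ) l) P.m 0 (fun _ => ∅, [])) = _ :=
    fun σ => E_labels _ _ _
  simp only [h1]
  rw [← sum_div, sum_perm_blocks (P.m * P.D - 1 + 1)
    (fun blk => rest f P blk P.m 0 (fun _ => ∅, []))]
  rw [le_div_iff₀ (by positivity)]
  have hZ : ((Fintype.piFinset fun _ : Fin n => range (P.m * P.D)).card : ℝ) =
      (((P.m * P.D - 1 : ℕ) : ℝ) + 1) ^ n := by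
    have : ((P.m * P.D - 1 : ℕ) : ℝ) + 1 = (P.m * P.D : ℕ) := by exact_mod_cast hmD
    rw [this, Fintype.card_piFinset]
    simp
  have h2 : ∀ ρ : Equiv.Perm (Fin n),
      ((1 - 1 / (P.D : ℝ)) * (1 - Real.exp (-(1 - 3 / P.D - 1 / P.α))) -
        (P.W / (4 * P.K) + 1 / (4 * P.W))) * f O * (((P.m * P.D - 1 : ℕ) : ℝ) + 1) ^ n ≤
      ∑ w : Fin n → Fin (P.m * P.D - 1 + 1),
        rest f P (labelled (List.ofFn ρ) fun e => w e) P.m 0 (fun _ => ∅, []) := by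
    intro ρ
    rw [sum_fin_eq_sum_piFinset _ fun W => rest f P (labelled (List.ofFn ρ) W) P.m 0
      (fun _ => ∅, []), hmD, ← hZ]
    have hall : ∀ e, e ∈ List.ofFn ρ := fun e => by
      rw [List.mem_ofFn]
      exact ρ.surjective e
    have h3 := potentialBound hf hO hP (List.nodup_ofFn.2 ρ.injective) hall P.m 0 (by omega)
      (fun _ => ∅, []) (fun _ => range (P.m * P.D)) 0 ⟨by simp, by simp, by simp⟩
      ⟨fun e => Or.inl ⟨by simp, fun l hl => by
        rw [mem_Ico] at hl
        exact mem_range.2 hl.2⟩, fun _ => Subset.rfl⟩ (by simp [Par.lo]) (Nat.zero_le _)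
    refine le_trans ?_ h3
    have hpow0 : 0 ≤ (1 - P.rate) ^ P.m := pow_nonneg (by linarith [hP.rate_le_one]) _
    have hpow : (1 - P.rate) ^ P.m ≤ Real.exp (-(1 - 3 / P.D - 1 / P.α)) := by
      have h4 := Real.add_one_le_exp (-P.rate)
      have h5 := pow_le_pow_left₀ (by linarith [hP.rate_le_one]) (show 1 - P.rate ≤ _ by linarith)
        P.m
      rw [← Real.exp_nat_mul] at h5
      refine h5.trans (le_of_eq ?_)
      congr 1
      have := hP.m_pos
      unfold Par.rate
      field_simp
    have hpow1 : Real.exp (-(1 - 3 / (P.D : ℝ) - 1 / P.α)) ≤ 1 := by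
      rw [Real.exp_le_one_iff]
      linarith [hP.loss]
    have h4 : ∀ W ∈ Fintype.piFinset fun _ : Fin n => range (P.m * P.D),
        (1 - Real.exp (-(1 - 3 / (P.D : ℝ) - 1 / P.α))) * f (target P.D O W) -
          (P.W / (4 * P.K) + 1 / (4 * P.W)) * f O ≤ potential f P O 0 0 (f ∅) W := by
      intro W _
      unfold potential
      rw [hP.price_zero, Nat.sub_zero]
      have h5 := mul_nonneg hpow0 (hf.nonneg ∅)
      have h6 := mul_le_mul_of_nonneg_right hpow (hf.nonneg (target P.D O W))
      linarith
    refine le_trans ?_ (sum_le_sum h4)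
    rw [sum_sub_distrib, ← mul_sum, sum_const, nsmul_eq_mul]
    have h5 := mul_le_mul_of_nonneg_left (le_sum_target hf hm hP.D0 O) (sub_nonneg.2 hpow1)
    linarith
  have h3 := card_nsmul_le_sum univ _ _ fun ρ _ => h2 ρ
  rw [nsmul_eq_mul, card_univ] at h3
  refine le_trans (le_of_eq ?_) h3
  ring

end ShortlistSecretary

namespace ShortlistSecretary

variable {n : ℕ}

/-! ### The value of the solution when all items are kept -/

section Keep

variable {f : Finset (Fin n) → ℝ} {L k : ℕ}

theorem keepPar_lo (j : ℕ) : (keepPar L k n).lo j = j := by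
  simp [keepPar, Par.lo]

theorem keepPar_hi {j : ℕ} (hj : j < min k n) : (keepPar L k n).hi j = j + 1 := by
  simp only [keepPar, Par.hi, Nat.div_one, add_zero]
  omega

/-- The value of the best solution for level `j + 1` found so far. -/
noncomputable def bestSoFar (f : Finset (Fin n) → ℝ) (j : ℕ) (x : Cf n) (st : St n) : ℝ :=
  max (f (st.N (j + 1))) (f (x.1 j))

/-- Greedy steps with sampling: every sample is in `O` with probability `|O| / n`. -/
theorem le_E_bestSoFar {j : ℕ} (hL : 0 < L) (hj : j < min k n) {O : Finset (Fin n)}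
    (hO : O.card = min k n) (σ : Equiv.Perm (Fin n)) {x : Cf n} (hx : x.2 = List.ofFn σ)
    (N : ℕ) {st : St n} (hst : Sampled f x st) {A : ℝ}
    (hA : ∑ o ∈ O, f (x.1 j ∪ {o}) = (min k n : ℕ) * A) :
    A - (1 - (min k n : ℕ) / n) ^ N * (A - bestSoFar f j x st) ≤
      (Rnd.iter N (fun _ => hStep f (keepPar L k n) j (j + 1) 0) st).E (bestSoFar f j x) := by
  classical
  have hn : 0 < n := by omega
  have hn' : (0 : ℝ) < n := by exact_mod_cast hn
  have hK : ((min k n : ℕ) : ℝ) ≤ n := by exact_mod_cast min_le_right k n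
  have hx0 : 0 ≤ 1 - ((min k n : ℕ) : ℝ) / n := sub_nonneg.2 ((div_le_one hn').2 hK)
  induction N generalizing st with
  | zero => simp [Rnd.iter]
  | succ N ih =>
    rw [Rnd.iter, Rnd.E_bind, hStep, Rnd.E_rand]
    simp only [Rnd.E_pure]
    have hR : (keepPar L k n).R1 + 1 = n := by
      simp only [keepPar]
      omega
    have hR' : ((keepPar L k n).R1 : ℝ) + 1 = n := by exact_mod_cast hR
    rw [hR', le_div_iff₀ hn']
    set γ := 1 - ((min k n : ℕ) : ℝ) / n with hγ
    let s : ℕ → St n := fun h => tryItem f (keepPar L k n).L j (j + 1) false 0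
      (st.H[0 * (keepPar L k n).stride + h]?) st
    have h1 : ∑ h : Fin ((keepPar L k n).R1 + 1), (A - γ ^ N * (A - bestSoFar f j x (s h))) ≤ _ :=
      sum_le_sum fun h _ => ih (hst.tryItem (st.H[0 * (keepPar L k n).stride + h]?))
    refine le_trans ?_ h1
    rw [Fin.sum_univ_eq_sum_range (fun h => A - γ ^ N * (A - bestSoFar f j x (s h))), hR,
      sum_sub_distrib, ← mul_sum, sum_sub_distrib, sum_const, card_range, nsmul_eq_mul]
    have h2 : ∑ o ∈ O, f (x.1 j ∪ {o}) + (n - (min k n : ℕ)) * bestSoFar f j x st ≤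
        ∑ h ∈ range n, bestSoFar f j x (s h) := by
      rw [← Fin.sum_univ_eq_sum_range (fun h => bestSoFar f j x (s h)) n]
      have h3 : ∀ h : Fin n, (if σ h ∈ O then f (x.1 j ∪ {σ h}) else bestSoFar f j x st) ≤
          bestSoFar f j x (s h) := by
        intro h
        split_ifs with ho
        · refine le_max_of_le_left ?_
          have h4 : st.H[0 * (keepPar L k n).stride + (h : ℕ)]? = some (σ h) := by
            rw [hst.H, hx]
            simp
          simp only [s, h4]
          exact hst.le_tryItem_some hL _ le_rfl (Nat.lt_succ_self j)
        · exact max_le_max (le_tryItem _ _ _ _ _ _ _ _ _) le_rfl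
      refine le_trans (le_of_eq ?_) (sum_le_sum fun h _ => h3 h)
      rw [Equiv.sum_comp σ fun e => if e ∈ O then f (x.1 j ∪ {e}) else bestSoFar f j x st,
        sum_ite, filter_mem_eq_inter, univ_inter, sum_const, nsmul_eq_mul]
      congr 2
      rw [filter_not, filter_mem_eq_inter, univ_inter, card_sdiff_of_subset (subset_univ _), hO,
        card_univ, Fintype.card_fin, Nat.cast_sub (min_le_right k n)]
    rw [hA] at h2
    have h3 : 0 ≤ γ ^ N := pow_nonneg hx0 N
    have h4 := mul_le_mul_of_nonneg_left h2 h3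
    have h5 : γ * n = n - (min k n : ℕ) := by
      rw [hγ]
      field_simp
    rw [pow_succ]
    have h6 : (A - γ ^ N * γ * (A - bestSoFar f j x st)) * n =
        A * n - γ ^ N * (γ * n) * (A - bestSoFar f j x st) := by ring
    rw [h6, h5]
    linarith

/-- With `t` greedy steps left, the gap to `f O` shrinks in each step by the factor expected from a
set that contains an item of `O` with high probability. -/
theorem le_rest_keep (hf : IsMonotoneSubmodular f) (hL : 0 < L) {O : Finset (Fin n)}
    (hO : O.card = min k n) (h0 : 0 < min k n) (σ : Equiv.Perm (Fin n))
    (blk : ℕ → List (Fin n)) (t j : ℕ) (htj : j + t = min k n) {x : Cf n}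
    (hx : x.2 = List.ofFn σ) :
    f O - (1 - (1 - (1 - ((min k n : ℕ) : ℝ) / n) ^ (keepPar L k n).Q) / (min k n : ℕ)) ^ t *
      (f O - f (x.1 j)) ≤ rest f (keepPar L k n) blk t j x := by
  have hn : 0 < n := by omega
  have hn' : (0 : ℝ) < n := by exact_mod_cast hn
  have hK : ((min k n : ℕ) : ℝ) ≤ n := by exact_mod_cast min_le_right k n
  have hK1 : (1 : ℝ) ≤ (min k n : ℕ) := by exact_mod_cast h0
  have hK0 : (0 : ℝ) < (min k n : ℕ) := by linarith
  have hx0 : 0 ≤ 1 - ((min k n : ℕ) : ℝ) / n := sub_nonneg.2 ((div_le_one hn').2 hK)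
  have hx1 : 1 - ((min k n : ℕ) : ℝ) / n ≤ 1 := by
    have : 0 ≤ ((min k n : ℕ) : ℝ) / n := by positivity
    linarith
  have hδ0 : 0 ≤ (1 - ((min k n : ℕ) : ℝ) / n) ^ (keepPar L k n).Q := pow_nonneg hx0 _
  have hδ1 : (1 - ((min k n : ℕ) : ℝ) / n) ^ (keepPar L k n).Q ≤ 1 := pow_le_one₀ hx0 hx1
  set δ := (1 - ((min k n : ℕ) : ℝ) / n) ^ (keepPar L k n).Q with hδ
  have hγ0 : 0 ≤ 1 - (1 - δ) / (min k n : ℕ) := by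
    rw [sub_nonneg, div_le_one hK0]
    linarith
  set γ := 1 - (1 - δ) / ((min k n : ℕ) : ℝ) with hγ
  induction t generalizing j x with
  | zero =>
    have hj : j = min k n := htj
    have h1 : (keepPar L k n).K - (keepPar L k n).lo (keepPar L k n).m = 0 := by
      rw [keepPar_lo]
      simp [keepPar]
    rw [rest_zero, answer, h1, mergeUp, hj]
    simp [keepPar]
  | succ t ih =>
    have hj : j < min k n := by omega
    rw [rest_succ, E_window]
    have h1 : ∀ s ∈ (univ : Finset (Fin (keepPar L k n).Q → Fin ((keepPar L k n).R1 + 1))),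
        f O - γ ^ t * (f O - bestSoFar f j x (trySamples f (keepPar L k n).L
          ((keepPar L k n).lo j) ((keepPar L k n).hi j) (positions _ s) (clean f x.1 x.2))) ≤
        rest f (keepPar L k n) blk t (j + 1) (finish f (keepPar L k n) blk j
          (trySamples f (keepPar L k n).L ((keepPar L k n).lo j) ((keepPar L k n).hi j)
            (positions _ s) (clean f x.1 x.2))) := by
      intro s _
      have hs : Sampled f x (trySamples f (keepPar L k n).L ((keepPar L k n).lo j)
        ((keepPar L k n).hi j) (positions _ s) (clean f x.1 x.2)) := sampled_clean.trySamples _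
      generalize trySamples f (keepPar L k n).L ((keepPar L k n).lo j)
        ((keepPar L k n).hi j) (positions _ s) (clean f x.1 x.2) = st at hs ⊢
      have h2 : finish f (keepPar L k n) blk j st = (mergeUp f j 1 st.N, st.H) := by
        rw [finish, keepPar_lo, keepPar_lo, Nat.add_sub_cancel_left]
        simp [scan, keepPar]
      rw [h2]
      refine le_trans ?_ (ih (j + 1) (by omega) (by rw [← hx]; exact hs.H))
      have h3 : bestSoFar f j x st ≤ f (mergeUp f j 1 st.N (j + 1)) :=
        max_le (le_mergeUp_top st.N j 1 (by omega) le_rfl)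
          ((hs.le j).trans (le_mergeUp_top st.N j 1 le_rfl (by omega)))
      have h4 := mul_le_mul_of_nonneg_left h3 (pow_nonneg hγ0 t)
      linarith
    refine le_trans ?_ (div_le_div_of_nonneg_right (sum_le_sum h1) (by positivity))
    have h2 := E_samples f (keepPar L k n) j x (fun st => f O - γ ^ t * (f O - bestSoFar f j x st))
    rw [← h2]
    have hlin : ∀ {X : Type} (a : Rnd X) (u : X → ℝ) (p q : ℝ),
        a.E (fun y => p - q * (p - u y)) = p - q * (p - a.E u) := by
      intro X a u p q
      induction a with
      | pure y => rfl
      | rand b c ih =>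
        simp only [Rnd.E_rand, ih, sum_sub_distrib, ← mul_sum, sum_const, card_univ,
          Fintype.card_fin, nsmul_eq_mul, Nat.cast_add, Nat.cast_one]
        have : (b : ℝ) + 1 ≠ 0 := by positivity
        field_simp
    rw [hlin]
    set A := (∑ o ∈ O, f (x.1 j ∪ {o})) / ((min k n : ℕ) : ℝ) with hA
    have h3 : ∑ o ∈ O, f (x.1 j ∪ {o}) = ((min k n : ℕ) : ℝ) * A := by
      rw [hA]
      field_simp
    have h4 := le_E_bestSoFar (L := L) hL hj hO σ hx (keepPar L k n).Q
      (sampled_clean (f := f) (x := x)) h3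
    have h5 : samples f (keepPar L k n) j x = Rnd.iter (keepPar L k n).Q
        (fun _ => hStep f (keepPar L k n) j (j + 1) 0) (clean f x.1 x.2) := by
      rw [samples, keepPar_lo, keepPar_hi hj]
      congr 1
    rw [h5]
    generalize (Rnd.iter (keepPar L k n).Q (fun _ => hStep f (keepPar L k n) j (j + 1) 0)
      (clean f x.1 x.2)).E (bestSoFar f j x) = X at h4 ⊢
    have h6 : f (x.1 j) ≤ bestSoFar f j x (clean f x.1 x.2) := le_max_right _ _
    have h7 := mul_le_mul_of_nonneg_left h6 hδ0
    have h8 : f O - f (x.1 j) ≤ (min k n : ℕ) * (A - f (x.1 j)) := by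
      have h9 := hf.le_add_sum (x.1 j) O
      have h10 := hf.mono O (x.1 j ∪ O) subset_union_right
      rw [sum_sub_distrib, h3, sum_const, hO, nsmul_eq_mul] at h9
      linarith
    have h9 : (1 - δ) / (min k n : ℕ) * (f O - f (x.1 j)) ≤ (1 - δ) * (A - f (x.1 j)) := by
      rw [div_mul_eq_mul_div, div_le_iff₀ hK0]
      have := mul_le_mul_of_nonneg_left h8 (sub_nonneg.2 hδ1)
      linarith
    have h10 : f O - X ≤ γ * (f O - f (x.1 j)) := by
      rw [hγ]
      linarith
    have h11 := mul_le_mul_of_nonneg_left h10 (pow_nonneg hγ0 t)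
    rw [pow_succ]
    linarith

/-- The value of the algorithm that keeps all items. -/
theorem keep_value (hf : IsMonotoneSubmodular f) (hL : 0 < L) {O : Finset (Fin n)}
    (hO : O.card = min k n) (h0 : 0 < min k n) (σ : Equiv.Perm (Fin n))
    (blk : ℕ → List (Fin n)) :
    (1 - Real.exp (-(1 - Real.exp (-L)))) * f O ≤
      (windows f (keepPar L k n) blk (List.ofFn σ)).E fun x => f (answer f (keepPar L k n) x) := by
  have hn : 0 < n := by omega
  have hn' : (0 : ℝ) < n := by exact_mod_cast hn
  have hK : ((min k n : ℕ) : ℝ) ≤ n := by exact_mod_cast min_le_right k n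
  have hK0 : (0 : ℝ) < (min k n : ℕ) := by exact_mod_cast h0
  have hx0 : 0 ≤ 1 - ((min k n : ℕ) : ℝ) / n := sub_nonneg.2 ((div_le_one hn').2 hK)
  have h1 := le_rest_keep hf hL hO h0 σ blk (min k n) 0 (by omega) (x := (fun _ => ∅, List.ofFn σ))
    rfl
  rw [windows_E]
  refine le_trans ?_ h1
  have h2 : (1 - ((min k n : ℕ) : ℝ) / n) ^ (keepPar L k n).Q ≤ Real.exp (-L) := by
    have h3 := Real.add_one_le_exp (-(((min k n : ℕ) : ℝ) / n))
    have h4 := pow_le_pow_left₀ hx0 (show 1 - ((min k n : ℕ) : ℝ) / n ≤ _ by linarith)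
      (keepPar L k n).Q
    rw [← Real.exp_nat_mul] at h4
    refine h4.trans (Real.exp_le_exp.2 ?_)
    have h5 : ((n * L : ℕ) : ℝ) / (min k n : ℕ) ≤ (keepPar L k n).Q := by
      have := (Nat.lt_floor_add_one (((n * L : ℕ) : ℝ) / (min k n : ℕ))).le
      rw [Nat.floor_div_eq_div] at this
      simpa [keepPar] using this
    have h6 : ((n * L : ℕ) : ℝ) / (min k n : ℕ) * (((min k n : ℕ) : ℝ) / n) = L := by
      rw [Nat.cast_mul]
      field_simp
    have h7 := mul_le_mul_of_nonneg_right h5 (show 0 ≤ ((min k n : ℕ) : ℝ) / n by positivity)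
    rw [h6] at h7
    linarith
  set δ := (1 - ((min k n : ℕ) : ℝ) / n) ^ (keepPar L k n).Q with hδ
  have hδ0 : 0 ≤ δ := pow_nonneg hx0 _
  have hK1 : (1 : ℝ) ≤ (min k n : ℕ) := by exact_mod_cast h0
  have hγ0 : 0 ≤ 1 - (1 - δ) / (min k n : ℕ) := by
    rw [sub_nonneg, div_le_one hK0]
    linarith
  have h3 : (1 - (1 - δ) / ((min k n : ℕ) : ℝ)) ^ (min k n) ≤
      Real.exp (-(1 - Real.exp (-L))) := by
    have h4 := Real.add_one_le_exp (-((1 - δ) / ((min k n : ℕ) : ℝ)))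
    have h5 := pow_le_pow_left₀ hγ0 (show 1 - (1 - δ) / ((min k n : ℕ) : ℝ) ≤ _ by linarith)
      (min k n)
    rw [← Real.exp_nat_mul] at h5
    refine h5.trans (Real.exp_le_exp.2 ?_)
    rw [mul_neg, mul_div_cancel₀ _ hK0.ne']
    linarith
  have h4 := mul_le_mul_of_nonneg_right h3 (hf.nonneg O)
  have h5 := mul_nonneg (pow_nonneg hγ0 (min k n)) (hf.nonneg ∅)
  simp only
  linarith

end Keep

end ShortlistSecretary

namespace ShortlistSecretary

variable {n : ℕ}

/-! ### Choice of the parameters -/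

/-- The bound for the number of improvements per window and level, when a window has `20 * w`
labels. -/
def records (w : ℕ) : ℕ := 2 + 4 * Nat.clog 2 (20 * w)

theorem two_le_records (w : ℕ) : 2 ≤ records w := Nat.le_add_right _ _

theorem sq_le_pow_records (w : ℕ) :
    ((20 * w : ℕ) : ℝ) ^ 2 ≤ (3 / 2 : ℝ) ^ (records w - 2) := by
  have h1 : ((20 * w : ℕ) : ℝ) ≤ 2 ^ Nat.clog 2 (20 * w) := by
    exact_mod_cast Nat.le_pow_clog (by norm_num) _
  have h2 : records w - 2 = 4 * Nat.clog 2 (20 * w) := by simp [records]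
  calc ((20 * w : ℕ) : ℝ) ^ 2 ≤ (2 ^ Nat.clog 2 (20 * w)) ^ 2 := by gcongr
    _ = 4 ^ Nat.clog 2 (20 * w) := by rw [← pow_mul, mul_comm, pow_mul]; norm_num
    _ ≤ ((3 / 2 : ℝ) ^ 4) ^ Nat.clog 2 (20 * w) := by gcongr; norm_num
    _ = _ := by rw [h2, ← pow_mul]

/-- The bound `records` also serves as the number of samples per selected item when all items are
kept, up to the factor `n / k`. -/
theorem exp_neg_records_le {w : ℕ} (hw : 0 < w) : Real.exp (-(records w : ℝ)) ≤ 1 / w := by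
  have hw' : (0 : ℝ) < w := by exact_mod_cast hw
  have h1 : ((20 * w : ℕ) : ℝ) ≤ 2 ^ Nat.clog 2 (20 * w) := by
    exact_mod_cast Nat.le_pow_clog (by norm_num) _
  have h2 : (2 : ℝ) ^ Nat.clog 2 (20 * w) ≤ 2 ^ records w :=
    pow_le_pow_right₀ (by norm_num) (by unfold records; omega)
  have h3 : (2 : ℝ) ≤ Real.exp 1 := by linarith [Real.add_one_le_exp 1]
  have h4 : (2 : ℝ) ^ records w ≤ Real.exp (records w) := by
    have := pow_le_pow_left₀ (by norm_num) h3 (records w)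
    rwa [← Real.exp_nat_mul, mul_one] at this
  rw [Real.exp_neg, ← one_div]
  refine one_div_le_one_div_of_le hw' ?_
  push_cast at h1
  linarith

theorem records_le {w : ℕ} (hw : 0 < w) {ε : ℝ} (h0 : 0 < ε) (h1 : ε ≤ 1)
    (hwε : (w : ℝ) ≤ 2 / ε) : (records w : ℝ) ≤ 60 * Real.log (2 / ε) := by
  have hl2 : (1 / 2 : ℝ) ≤ Real.log 2 := by linarith [Real.log_two_gt_d9]
  have hl : Real.log 2 ≤ Real.log (2 / ε) :=
    Real.log_le_log (by norm_num) (by rw [le_div_iff₀ h0]; linarith)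
  have h2 : 2 ^ (Nat.clog 2 (20 * w) - 1) < 20 * w := by
    have := Nat.pow_pred_clog_lt_self (b := 2) (by norm_num) (x := 20 * w) (by omega)
    simpa using this
  have h3 : ((Nat.clog 2 (20 * w) : ℝ) - 1) * Real.log 2 ≤ 5 * Real.log 2 + Real.log (2 / ε) := by
    have h4 : ((Nat.clog 2 (20 * w) : ℝ) - 1) ≤ ((Nat.clog 2 (20 * w) - 1 : ℕ) : ℝ) := by
      have : Nat.clog 2 (20 * w) ≤ Nat.clog 2 (20 * w) - 1 + 1 := by omega
      rw [sub_le_iff_le_add]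
      exact_mod_cast this
    have h5 : (2 : ℝ) ^ (Nat.clog 2 (20 * w) - 1) ≤ 2 ^ 5 * (2 / ε) := by
      have h6 : (2 : ℝ) ^ (Nat.clog 2 (20 * w) - 1) ≤ 20 * w := by exact_mod_cast h2.le
      have h7 : 0 ≤ 2 / ε := by positivity
      linarith
    have h6 := Real.log_le_log (by positivity) h5
    rw [Real.log_pow, Real.log_mul (by norm_num) (by positivity), Real.log_pow] at h6
    have h7 := mul_le_mul_of_nonneg_right h4 (show 0 ≤ Real.log 2 by linarith)
    push_cast at h6
    linarith
  have h4 : (records w : ℝ) = 2 + 4 * Nat.clog 2 (20 * w) := by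
    rw [records]
    push_cast
    rfl
  rw [h4]
  have h5 : (0 : ℝ) ≤ Nat.clog 2 (20 * w) := Nat.cast_nonneg _
  rcases le_total (Nat.clog 2 (20 * w) : ℝ) 6 with h6 | h6
  · linarith
  · have h7 := mul_le_mul_of_nonneg_left hl2 (show 0 ≤ (Nat.clog 2 (20 * w) : ℝ) - 6 by linarith)
    linarith

theorem streamPar_stream {w k : ℕ} (hw : 0 < w) (hk : 0 < k) :
    (streamPar (20 * w) w ((2 * w + 1) * records w) (20 * w) (records w) k).Stream where
  stride := rfl
  R1 := by
    have : 0 < 20 * w * k := by positivity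
    simp only [streamPar]
    omega
  m := rfl
  α0 := by simp only [streamPar]; omega
  W0 := hw
  D0 := by simp only [streamPar]; omega
  K0 := hk
  L0 := by
    have := two_le_records w
    simp only [streamPar]
    omega
  Q := le_rfl
  records := sq_le_pow_records w
  loss := by
    have hw' : (1 : ℝ) ≤ w := by exact_mod_cast hw
    simp only [streamPar]
    rw [← add_div, div_le_one (by positivity)]
    push_cast
    linarith

section Value

variable {w : ℕ} {ε : ℝ}

theorem exp_neg_one_le : Real.exp (-1) ≤ 1 / 2 := by
  rw [Real.exp_neg, ← one_div]
  exact one_div_le_one_div_of_le (by norm_num) (by linarith [Real.add_one_le_exp 1])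

/-- Losses in the exponent are losses in the ratio. -/
theorem exp_neg_one_sub_le {η : ℝ} (h0 : 0 ≤ η) (h1 : η ≤ 1) :
    Real.exp (-(1 - η)) ≤ Real.exp (-1) + η := by
  have h2 : Real.exp η ≤ 1 + 2 * η := by
    have := Real.abs_exp_sub_one_le (x := η) (by rwa [abs_of_nonneg h0])
    rw [abs_of_nonneg h0] at this
    linarith [le_abs_self (Real.exp η - 1)]
  have h3 : Real.exp (-(1 - η)) = Real.exp (-1) * Real.exp η := by
    rw [← Real.exp_add]
    congr 1
    ring
  rw [h3]
  have h4 := mul_le_mul_of_nonneg_left h2 (Real.exp_pos (-1)).le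
  have h5 := mul_le_mul_of_nonneg_left exp_neg_one_le h0
  linarith

/-- With `α = D = 20 w` and `W = w`, where `w` is about `1 / ε`, the losses add up to at most `ε`:
one half is due to `W / (4 k)`, one fourth to `1 / (4 W)`, and one fourth to the labels and
windows. -/
theorem stream_ratio (h0 : 0 < ε) (h1 : ε ≤ 1) (hw : 1 / ε ≤ w) (hw' : (w : ℝ) ≤ 1 / ε + 1)
    {k : ℕ} (hk : 1 / ε ^ 2 ≤ k) :
    1 - 1 / Real.exp 1 - ε ≤ (1 - 1 / ((20 * w : ℕ) : ℝ)) *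
      (1 - Real.exp (-(1 - 3 / ((20 * w : ℕ) : ℝ) - 1 / ((20 * w : ℕ) : ℝ)))) -
        (w / (4 * k) + 1 / (4 * w)) := by
  have h1w : 1 ≤ 1 / ε := (one_le_div h0).2 h1
  have hw0 : (0 : ℝ) < w := by linarith
  have hk0 : (0 : ℝ) < k := lt_of_lt_of_le (by positivity) hk
  have hwi : 1 / (w : ℝ) ≤ ε := by
    rw [div_le_iff₀ hw0]
    rw [div_le_iff₀ h0] at hw
    linarith
  have h20 : 1 / ((20 * w : ℕ) : ℝ) = 1 / w / 20 := by
    push_cast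
    field_simp
  have hx0 : 0 ≤ 1 / (w : ℝ) := by positivity
  have hx1 : 1 / (w : ℝ) ≤ 1 := hwi.trans h1
  have h3 : 3 / ((20 * w : ℕ) : ℝ) = 3 * (1 / w / 20) := by
    push_cast
    field_simp
  rw [h3, h20]
  have hη := exp_neg_one_sub_le (η := 3 * (1 / (w : ℝ) / 20) + 1 / w / 20) (by linarith)
    (by linarith)
  rw [← sub_sub] at hη
  have hexp : 1 / Real.exp 1 = Real.exp (-1) := by rw [Real.exp_neg, one_div]
  rw [hexp]
  have h4 : (w : ℝ) / (4 * k) ≤ ε / 2 := by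
    rw [div_le_iff₀ (by positivity)]
    have h5 : (w : ℝ) ≤ 2 / ε := by
      have : (2 : ℝ) / ε = 1 / ε + 1 / ε := by ring
      linarith
    refine h5.trans ?_
    have h6 := mul_le_mul_of_nonneg_left hk (show 0 ≤ 2 * ε by positivity)
    have h7 : 2 * ε * (1 / ε ^ 2) = 2 / ε := by field_simp
    linarith
  have h5 : 1 / (4 * (w : ℝ)) = 1 / w / 4 := by field_simp
  rw [h5]
  have h6 := Real.exp_pos (-(1 - 3 * (1 / (w : ℝ) / 20) - 1 / w / 20))
  have h7 := mul_nonneg hx0 h6.le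
  linarith

theorem keep_ratio (h0 : 0 < ε) (h1 : ε ≤ 1) (hw : 1 / ε ≤ w) :
    1 - 1 / Real.exp 1 - ε ≤ 1 - Real.exp (-(1 - Real.exp (-(records w : ℝ)))) := by
  have h1w : 1 ≤ 1 / ε := (one_le_div h0).2 h1
  have hw0 : (0 : ℝ) < w := by linarith
  have hwi : 1 / (w : ℝ) ≤ ε := by
    rw [div_le_iff₀ hw0]
    rw [div_le_iff₀ h0] at hw
    linarith
  have h2 := exp_neg_records_le (w := w) (by exact_mod_cast hw0)
  have h3 := exp_neg_one_sub_le (Real.exp_pos (-(records w : ℝ))).le (by linarith)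
  have hexp : 1 / Real.exp 1 = Real.exp (-1) := by rw [Real.exp_neg, one_div]
  rw [hexp]
  linarith

end Value

theorem exists_bestValue (f : Finset (Fin n) → ℝ) (k : ℕ) :
    ∃ O : Finset (Fin n), O.card ≤ k ∧ f O = bestValue f univ k := by
  obtain ⟨O, hO, h⟩ := exists_mem_eq_sup' (s := (univ : Finset (Fin n)).powerset.filter fun S =>
    S.card ≤ k) ⟨∅, by simp⟩ f
  exact ⟨O, (mem_filter.1 hO).2, h.symm⟩

/-- By monotonicity an optimal set may be taken as large as is allowed. -/
theorem exists_bestValue_card {f : Finset (Fin n) → ℝ} (hf : IsMonotoneSubmodular f) (k : ℕ) :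
    ∃ O : Finset (Fin n), O.card = min k n ∧ bestValue f univ k ≤ f O := by
  obtain ⟨O, hO, h⟩ := exists_bestValue f k
  have h1 : O.card ≤ n := by simpa using card_le_univ O
  obtain ⟨O', h2, h3⟩ := exists_superset_card_eq (s := O) (n := min k n) (le_min hO h1) (by simp)
  exact ⟨O', h3, h ▸ hf.mono _ _ h2⟩

theorem le_bestValue (f : Finset (Fin n) → ℝ) {S A : Finset (Fin n)} {k : ℕ} (hS : S ⊆ A)
    (hk : S.card ≤ k) : f S ≤ bestValue f A k :=
  le_sup' f (mem_filter.2 ⟨mem_powerset.2 hS, hk⟩)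

/-- From the verified program to the properties of its runs. -/
theorem run_of_sim {f : Finset (Fin n) → ℝ} {P : Par} {Pr : Prog} {M b k T' T : ℕ}
    {a : Equiv.Perm (Fin n) → Rnd (Cf n)}
    (h : ∀ σ, Sim f Pr (initial Pr n k σ) (a σ) T' (Final f P M b)) (hT : T' ≤ T) (hK : P.K ≤ k)
    {v : ℝ} (hv : v ≤ (∑ σ, (a σ).E fun x => f (answer f P x)) /
      Fintype.card (Equiv.Perm (Fin n))) :
    (∀ s ∈ (run Pr k f T).support, s.Halted ∧ s.shortlist.card ≤ b ∧ s.output ⊆ s.shortlist ∧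
      s.output.card ≤ k ∧ s.queries ≤ T ∧ s.peak ≤ M) ∧
    v ≤ expectation (run Pr k f T) (fun s => f s.output) ∧
    v ≤ expectation (run Pr k f T) (fun s => bestValue f s.shortlist k) := by
  obtain ⟨h1, h2⟩ := run_of_res Pr k f T _ _ _ fun σ => (h σ).res.mono hT le_rfl
  have h3 : ∀ s ∈ (run Pr k f T).support, s.Halted ∧ s.shortlist.card ≤ b ∧
      s.output ⊆ s.shortlist ∧ s.output.card ≤ k ∧ s.queries ≤ T ∧ s.peak ≤ M := by
    intro s hs
    obtain ⟨h4, ⟨x, hx⟩, h5⟩ := h1 s hs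
    obtain ⟨h6, h7⟩ := answer_good (f := f) (P := P) hx.good
    refine ⟨h4, ?_, ?_, ?_, h5, hx.peak⟩
    · rw [hx.short]
      exact (List.toFinset_card_le _).trans hx.good.len
    · rw [hx.short, hx.output]
      exact h7
    · rw [hx.output]
      exact h6.trans hK
  refine ⟨h3, hv.trans h2, (hv.trans h2).trans ?_⟩
  exact expectation_mono_support _ (run_support_finite Pr k f T) fun s hs =>
    le_bestValue f (h3 s hs).2.2.1 (h3 s hs).2.2.2.1

section Bounds

variable {w L k : ℕ}

/-- A bound for all integers of the computation. -/
def peakBound (n k w L : ℕ) : ℕ := 1000 * ((n + k) * w ^ 2 * L)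

/-- A bound for the number of steps of the computation. -/
def timeBound (n w L : ℕ) : ℕ := 565 * (n * w) + 350 * (n * L)

/-- All quantities that occur in the bounds for the integers are below one monomial. -/
theorem monomials_le (hw : 1 ≤ w) (hL : 1 ≤ L) (hn : 1 ≤ n) (hk : 1 ≤ k) :
    1 ≤ (n + k) * w ^ 2 * L ∧ n * L ≤ (n + k) * w ^ 2 * L ∧ n ≤ (n + k) * w ^ 2 * L ∧
      k ≤ (n + k) * w ^ 2 * L ∧ w ≤ (n + k) * w ^ 2 * L ∧ w * k ≤ (n + k) * w ^ 2 * L ∧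
      w ^ 2 * k ≤ (n + k) * w ^ 2 * L ∧ L ≤ (n + k) * w ^ 2 * L ∧ w * L ≤ (n + k) * w ^ 2 * L ∧
      w * k * L ≤ (n + k) * w ^ 2 * L ∧ w ^ 2 * k * L ≤ (n + k) * w ^ 2 * L := by
  have key : ∀ a b c : ℕ, a ≤ n + k → b ≤ w ^ 2 → c ≤ L → a * b * c ≤ (n + k) * w ^ 2 * L :=
    fun a b c ha hb hc => Nat.mul_le_mul (Nat.mul_le_mul ha hb) hc
  have h1 : 1 ≤ w ^ 2 := Nat.one_le_pow _ _ hw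
  have h2 : w ≤ w ^ 2 := Nat.le_self_pow (by norm_num) w
  refine ⟨?_, ?_, ?_, ?_, ?_, ?_, ?_, ?_, ?_, ?_, ?_⟩
  · simpa using key 1 1 1 (by omega) h1 hL
  · simpa using key n 1 L (by omega) h1 le_rfl
  · simpa using key n 1 1 (by omega) h1 hL
  · simpa using key k 1 1 (by omega) h1 hL
  · simpa using key 1 w 1 (by omega) h2 hL
  · simpa [mul_comm] using key k w 1 (by omega) h2 hL
  · simpa [mul_comm] using key k (w ^ 2) 1 (by omega) le_rfl hL
  · simpa using key 1 1 L (by omega) h1 le_rfl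
  · simpa using key 1 w L (by omega) h2 le_rfl
  · simpa [mul_comm] using key k w L (by omega) h2 le_rfl
  · simpa [mul_comm] using key k (w ^ 2) L (by omega) le_rfl le_rfl

theorem streamPar_bdd (hw : 1 ≤ w) (hL : 1 ≤ L) (hn : 1 ≤ n) (hk : 1 ≤ k) :
    (streamPar (20 * w) w ((2 * w + 1) * L) (20 * w) L k).Bdd (peakBound n k w L) n := by
  obtain ⟨h1, h2, h3, h4, h5, h6, h7, h8, h9, h10, h11⟩ := monomials_le hw hL hn hk
  have e1 : (2 * w + 1) * L = 2 * (w * L) + L := by ring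
  have e2 : (2 * w + 1) * L * (20 * w * k) = 40 * (w ^ 2 * k * L) + 20 * (w * k * L) := by ring
  have e3 : 20 * w * k = 20 * (w * k) := by ring
  have e4 : 20 * w * k * (20 * w) = 400 * (w ^ 2 * k) := by ring
  unfold peakBound
  generalize (n + k) * w ^ 2 * L = U at *
  constructor <;> try simp only [streamPar]
  all_goals try omega
  exact Nat.mul_comm _ _

theorem keepPar_bdd (hw : 1 ≤ w) (hL : 1 ≤ L) (hn : 1 ≤ n) (hk : 1 ≤ k) :
    (keepPar L k n).Bdd (peakBound n k w L) n := by
  obtain ⟨h1, h2, h3, h4, h5, h6, h7, h8, h9, h10, h11⟩ := monomials_le hw hL hn hk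
  have h12 : n * L / min k n ≤ n * L := Nat.div_le_self _ _
  have h13 : min k n ≤ n := min_le_right k n
  unfold peakBound
  generalize (n + k) * w ^ 2 * L = U at *
  constructor <;> try simp only [keepPar, mul_zero, mul_one, zero_add, add_zero]
  all_goals omega

theorem keep_side (hw : 1 ≤ w) (hL : 1 ≤ L) (hn : 1 ≤ n) (hk : 1 ≤ k) :
    (20 * w ≤ peakBound n k w L ∧ w ≤ peakBound n k w L ∧ (2 * w + 1) * L ≤ peakBound n k w L ∧
      20 * w ≤ peakBound n k w L ∧ L ≤ peakBound n k w L ∧ 65 ≤ peakBound n k w L ∧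
      20 * w * k ≤ peakBound n k w L ∧
      20 * w * k * ((2 * w + 1) * L) ≤ peakBound n k w L) ∧ n * L ≤ peakBound n k w L := by
  obtain ⟨h1, h2, h3, h4, h5, h6, h7, h8, h9, h10, h11⟩ := monomials_le hw hL hn hk
  have e1 : (2 * w + 1) * L = 2 * (w * L) + L := by ring
  have e2 : 20 * w * k * ((2 * w + 1) * L) = 40 * (w ^ 2 * k * L) + 20 * (w * k * L) := by ring
  have e3 : 20 * w * k = 20 * (w * k) := by ring
  rw [e2, e1, e3]
  unfold peakBound
  generalize (n + k) * w ^ 2 * L = U at *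
  omega

/-- The samples take `m Q (80 w + 54)` steps; as `n` is at least `m Q`, they cost no more than the
arrivals. -/
theorem stream_time (hw : 1 ≤ w) (hL : 2 ≤ L) (hk : 1 ≤ k)
    (h : 20 * w * k * ((2 * w + 1) * L) ≤ n) :
    mainTime (streamPar (20 * w) w ((2 * w + 1) * L) (20 * w) L k) n + 14 * n + 100 ≤
      timeBound n w L := by
  simp only [mainTime, streamPar, levelTime, timeBound]
  set m := 20 * w * k with hm
  set Q := (2 * w + 1) * L with hQ
  have hm1 : 20 * k ≤ m := by nlinarith
  have hQ1 : 4 * w + 2 ≤ Q := by nlinarith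
  have h1 : m * (4 * w + 2) ≤ n := (Nat.mul_le_mul_left m hQ1).trans h
  have h2 : m * Q * (80 * w + 54) ≤ n * (80 * w + 54) := Nat.mul_le_mul_right _ h
  have h3 : m * (Q * (40 * (2 * w + 1) + 3 + 11) + 10 * (20 * w) + 12 * (2 * w + 1) + 71) =
      m * Q * (80 * w + 54) + 56 * (m * (4 * w + 2)) - 29 * m := by
    have : m * (Q * (40 * (2 * w + 1) + 3 + 11) + 10 * (20 * w) + 12 * (2 * w + 1) + 71) + 29 * m =
      m * Q * (80 * w + 54) + 56 * (m * (4 * w + 2)) := by ring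
    omega
  have h4 : n ≤ n * w := Nat.le_mul_of_pos_right n hw
  have h5 : n * (80 * w + 54) = 80 * (n * w) + 54 * n := by ring
  have h6 : n * (40 * (2 * w + 1) + 3 + 15) = 80 * (n * w) + 58 * n := by ring
  have h7 : m ≤ m * (4 * w + 2) := Nat.le_mul_of_pos_right m (by omega)
  rw [h3, h6]
  generalize m * Q * (80 * w + 54) = X at *
  generalize m * (4 * w + 2) = Y at *
  generalize n * w = Z at *
  omega

/-- With all items kept, the samples of all windows together are about `n L`. -/
theorem keep_time (hL : 2 ≤ L) (hn : 1 ≤ n) (w : ℕ) :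
    mainTime (keepPar L k n) 0 + 10 * n + 100 ≤ timeBound n w L := by
  simp only [mainTime, keepPar, levelTime, timeBound]
  have h1 : min k n * (n * L / min k n) ≤ n * L := Nat.mul_div_le _ _
  have h2 : min k n ≤ n := min_le_right k n
  generalize hK : min k n = K at *
  have h3 : K * ((n * L / K + 1) * (40 * (2 * 0 + 1) + 3 + 11) + 10 * 0 + 12 * (2 * 0 + 1) + 71) =
      54 * (K * (n * L / K)) + 137 * K := by ring
  have h4 : 2 * n ≤ n * L := by nlinarith
  rw [h3]
  generalize K * (n * L / K) = X at *
  generalize n * L = Y at *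
  omega

end Bounds

end ShortlistSecretary

theorem mainTheorem1 :
    ∃ (C : ℝ) (c : ℕ), 0 < C ∧
      ∀ ε : ℝ, 0 < ε → ε ≤ 1 →
        ∃ P : ShortlistSecretary.Prog,
          ∀ n k : ℕ, 1 ≤ n → 1 ≤ k →
            ∃ T : ℕ, (T : ℝ) ≤ C * (n / ε) * Real.log (2 / ε) ^ c ∧
              ∀ f : Finset (Fin n) → ℝ, ShortlistSecretary.IsMonotoneSubmodular f →
                (∀ s ∈ (ShortlistSecretary.run P k f T).support,
                  s.Halted ∧
                  (s.shortlist.card : ℝ) ≤ C * (k / ε ^ 2) * Real.log (2 / ε) ^ c ∧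
                  s.output ⊆ s.shortlist ∧
                  s.output.card ≤ k ∧
                  (s.queries : ℝ) ≤ C * (n / ε) * Real.log (2 / ε) ^ c ∧
                  (s.peak : ℝ) ≤ C * ((n + k) / ε) ^ c) ∧
                (1 / ε ^ 2 ≤ k →
                  (1 - 1 / Real.exp 1 - ε) * ShortlistSecretary.bestValue f Finset.univ k ≤
                    ShortlistSecretary.expectation (ShortlistSecretary.run P k f T)
                      (fun s => f s.output) ∧
                  (1 - 1 / Real.exp 1 - ε) * ShortlistSecretary.bestValue f Finset.univ k ≤
                    ShortlistSecretary.expectation (ShortlistSecretary.run P k f T)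
                      (fun s => ShortlistSecretary.bestValue f s.shortlist k)) := by
  -- all constants of the program are multiples of `w`, up to a logarithmic factor `L`
  refine ⟨480000, 3, by norm_num, fun ε h0 h1 => ?_⟩
  set w := ⌈1 / ε⌉₊ with hw
  set L := ShortlistSecretary.records w with hL
  have h1ε : 1 ≤ 1 / ε := (one_le_div h0).2 h1
  have hwl : 1 / ε ≤ w := Nat.le_ceil _
  have hwu : (w : ℝ) ≤ 1 / ε + 1 := (Nat.ceil_lt_add_one (by positivity)).le
  have hwu2 : (w : ℝ) ≤ 2 / ε := by
    have : (2 : ℝ) / ε = 1 / ε + 1 / ε := by ring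
    linarith
  have hw1 : 1 ≤ w := by exact_mod_cast h1ε.trans hwl
  have hw1' : (1 : ℝ) ≤ w := by exact_mod_cast hw1
  have hL2 : 2 ≤ L := ShortlistSecretary.two_le_records w
  have hLl : (L : ℝ) ≤ 60 * Real.log (2 / ε) := ShortlistSecretary.records_le hw1 h0 h1 hwu2
  have hll : (1 / 2 : ℝ) ≤ Real.log (2 / ε) := by
    have h2 : Real.log 2 ≤ Real.log (2 / ε) :=
      Real.log_le_log (by norm_num) (by rw [le_div_iff₀ h0]; linarith)
    linarith [Real.log_two_gt_d9]
  have hlu : Real.log (2 / ε) ≤ 2 / ε := by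
    have := Real.log_le_sub_one_of_pos (show 0 < 2 / ε by positivity)
    linarith
  set l := Real.log (2 / ε) with hl
  -- one logarithm would do, but the integers need the exponent `3`
  have hl3 : l ≤ 4 * l ^ 3 := by nlinarith [sq_nonneg (2 * l - 1)]
  refine ⟨ShortlistSecretary.Code.program (20 * w) w ((2 * w + 1) * L) (20 * w) L,
    fun n k hn hk => ?_⟩
  have hT : (ShortlistSecretary.timeBound n w L : ℝ) ≤ 480000 * (n / ε) * l ^ 3 := by
    have h2 : (ShortlistSecretary.timeBound n w L : ℝ) = 565 * (n * w) + 350 * (n * L) := by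
      unfold ShortlistSecretary.timeBound
      push_cast
      rfl
    have hn0 : (0 : ℝ) ≤ n := Nat.cast_nonneg n
    have h3 : (n : ℝ) * w ≤ 2 * (n / ε) := by
      have := mul_le_mul_of_nonneg_left hwu2 hn0
      have h4 : (n : ℝ) * (2 / ε) = 2 * (n / ε) := by ring
      linarith
    have h5 : 0 ≤ (n : ℝ) / ε := by positivity
    have h4 : (n : ℝ) * L ≤ n / ε * (60 * l) := by
      have h6 : (n : ℝ) ≤ n / ε := (le_div_iff₀ h0).2 (mul_le_of_le_one_right hn0 h1)
      exact mul_le_mul h6 hLl (Nat.cast_nonneg L) h5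
    have h6 := mul_le_mul_of_nonneg_left hl3 h5
    have h7 := mul_le_mul_of_nonneg_left hll h5
    have h8 : 0 ≤ (n : ℝ) / ε * l ^ 3 := by positivity
    rw [h2]
    linarith
  refine ⟨ShortlistSecretary.timeBound n w L, hT, fun f hf => ?_⟩
  have hB : ∀ b : ℕ, b ≤ 20 * w * k * ((2 * w + 1) * L) →
      (b : ℝ) ≤ 480000 * (k / ε ^ 2) * l ^ 3 := by
    intro b hb
    have h2 : (b : ℝ) ≤ 20 * w * k * ((2 * w + 1) * L) := by exact_mod_cast hb
    have h3 : (20 : ℝ) * w * k * ((2 * w + 1) * L) ≤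
        20 * (2 / ε) * k * ((3 * (2 / ε)) * (60 * l)) := by
      gcongr
      linarith
    have h4 : 20 * (2 / ε) * k * ((3 * (2 / ε)) * (60 * l)) = 14400 * (k / ε ^ 2) * l := by
      field_simp
      ring
    have h5 : 0 ≤ (k : ℝ) / ε ^ 2 := by positivity
    have h6 := mul_le_mul_of_nonneg_left hl3 h5
    have h7 : 0 ≤ (k : ℝ) / ε ^ 2 * l ^ 3 := by positivity
    linarith
  have hM : ∀ b : ℕ, b ≤ ShortlistSecretary.peakBound n k w L →
      (b : ℝ) ≤ 480000 * ((n + k) / ε) ^ 3 := by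
    intro b hb
    have h2 : (b : ℝ) ≤ 1000 * ((n + k) * w ^ 2 * L) := by
      unfold ShortlistSecretary.peakBound at hb
      exact_mod_cast hb
    have h3 : (1000 : ℝ) * ((n + k) * w ^ 2 * L) ≤
        1000 * ((n + k) * (2 / ε) ^ 2 * (60 * (2 / ε))) := by
      gcongr
      linarith
    have h4 : (1000 : ℝ) * ((n + k) * (2 / ε) ^ 2 * (60 * (2 / ε))) =
        480000 * (((n : ℝ) + k) / ε ^ 3) := by
      field_simp
      ring
    have h5 : (1 : ℝ) ≤ n + k := by
      have : (1 : ℝ) ≤ n := by exact_mod_cast hn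
      linarith [Nat.cast_nonneg (α := ℝ) k]
    have h6 : ((n : ℝ) + k) / ε ^ 3 ≤ ((n + k) / ε) ^ 3 := by
      rw [div_pow]
      gcongr
      exact le_self_pow₀ h5 (by norm_num)
    linarith
  have hr0 : ∀ {x v b : ℝ}, x ≤ v → 0 ≤ b → x * b ≤ v * b :=
    fun hxv hb => mul_le_mul_of_nonneg_right hxv hb
  rcases Nat.lt_or_ge n (20 * w * k * ((2 * w + 1) * L)) with hcase | hcase
  · -- few items: all of them are put on the shortlist
    obtain ⟨O, hO, hbest⟩ := ShortlistSecretary.exists_bestValue_card hf k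
    have hkn : 0 < min k n := lt_min hk hn
    obtain ⟨hside, hside'⟩ := ShortlistSecretary.keep_side (w := w) (L := L) hw1 (by omega) hn hk
    have hval : (1 - Real.exp (-(1 - Real.exp (-L)))) * f O ≤
        (∑ σ : Equiv.Perm (Fin n), (ShortlistSecretary.windows f
          (ShortlistSecretary.keepPar L k n) (fun _ => []) (List.ofFn σ)).E fun x =>
            f (ShortlistSecretary.answer f (ShortlistSecretary.keepPar L k n) x)) /
          Fintype.card (Equiv.Perm (Fin n)) := by
      rw [le_div_iff₀ (by exact_mod_cast Fintype.card_pos), mul_comm, ← nsmul_eq_mul]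
      exact card_nsmul_le_sum _ _ _ fun σ _ =>
        ShortlistSecretary.keep_value hf (by omega) hO hkn σ fun _ => []
    obtain ⟨h2, h3, h4⟩ := ShortlistSecretary.run_of_sim (k := k)
      (fun σ => ShortlistSecretary.program_sim_keep (α := 20 * w) (W := w)
        (Q := (2 * w + 1) * L) (D := 20 * w)
        (Pr := ShortlistSecretary.Code.program (20 * w) w ((2 * w + 1) * L) (20 * w) L)
        (ShortlistSecretary.keepPar_bdd (w := w) hw1 (by omega) hn hk) hk hn hcase hside hside' σ)
      (ShortlistSecretary.keep_time (k := k) hL2 hn w) (min_le_left k n) hval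
    have hfinal : (1 - 1 / Real.exp 1 - ε) * ShortlistSecretary.bestValue f Finset.univ k ≤
        (1 - Real.exp (-(1 - Real.exp (-L)))) * f O := by
      have h5 := ShortlistSecretary.keep_ratio h0 h1 hwl
      rw [← hL] at h5
      have h6 : 0 ≤ 1 - Real.exp (-(1 - Real.exp (-(L : ℝ)))) := by
        rw [sub_nonneg, Real.exp_le_one_iff, neg_nonpos, sub_nonneg, Real.exp_le_one_iff]
        linarith [Nat.cast_nonneg (α := ℝ) L]
      exact (hr0 h5 ((hf.nonneg _).trans (ShortlistSecretary.le_bestValue f (S := ∅)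
        (Finset.empty_subset _) (by simp)))).trans (mul_le_mul_of_nonneg_left hbest h6)
    refine ⟨fun s hs => ?_, fun _ => ⟨hfinal.trans h3, hfinal.trans h4⟩⟩
    obtain ⟨h5, -, h7, h8, h9, h10⟩ := h2 s hs
    refine ⟨h5, hB _ ?_, h7, h8, le_trans (by exact_mod_cast h9) hT, hM _ h10⟩
    have h11 : s.shortlist.card ≤ n := by simpa using Finset.card_le_univ s.shortlist
    omega
  · -- many items: they are divided into windows by random labels
    obtain ⟨O, hO, hbest⟩ := ShortlistSecretary.exists_bestValue f k
    have hP := ShortlistSecretary.streamPar_stream (w := w) hw1 hk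
    rw [← hL] at hP
    obtain ⟨h2, h3, h4⟩ := ShortlistSecretary.run_of_sim (k := k)
      (fun σ => ShortlistSecretary.program_sim_stream
        (Pr := ShortlistSecretary.Code.program (20 * w) w ((2 * w + 1) * L) (20 * w) L)
        (ShortlistSecretary.streamPar_bdd hw1 (by omega) hn hk) (by positivity) hcase σ)
      (ShortlistSecretary.stream_time hw1 hL2 hk hcase) le_rfl
      (ShortlistSecretary.stream_value hf hP hO)
    refine ⟨fun s hs => ?_, fun hkε => ?_⟩
    · obtain ⟨h5, h6, h7, h8, h9, h10⟩ := h2 s hs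
      exact ⟨h5, hB _ h6, h7, h8, le_trans (by exact_mod_cast h9) hT, hM _ h10⟩
    · have h5 := hr0 (ShortlistSecretary.stream_ratio h0 h1 hwl hwu hkε) (hf.nonneg O)
      rw [← hbest]
      exact ⟨h5.trans h3, h5.trans h4⟩
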